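/- A discrete Borel groupoid is a groupoid $\mathcal G$ with source and target maps $s,t\colon\mathcal G\to\mathcal G^{(0)}$ that is equipped with a standard Borel structure for which the unit space $\mathcal G^{(0)}\subseteq\mathcal G$ is Borel, $s$, $t$, multiplication and inversion are Borel, and all fibres $\mathcal G_x=s^{-1}(x)$ and $\mathcal G^x=t^{-1}(x)$ are countable. Products $gh$ are defined when $s(g)=t(h)$. For a Borel probability measure $\mu$ on $\mathcal G^{(0)}$ put $\mu_s(A)=\int\#(\mathcal G_x\cap A)\,d\mu(x)$ and $\mu_t(A)=\int\#(\mathcal G^x\cap A)\,d\mu(x)$ for Borel $A\subseteq\mathcal G$; $(\mathcal G,\mu)$ is called a discrete probability measure-preserving (p.m.p.) groupoid if $\mu_s=\mu_t$. The full group $[\mathcal G]$ consists of the Borel sets $\gamma\subseteq\mathcal G$ that meet every $\mathcal G_x$ and every $\mathcal G^x$ in at most one point and satisfy $\gamma\gamma^{-1}=\gamma^{-1}\gamma=\mathcal G^{(0)}$. For $\gamma\in[\mathcal G]$ and $x\in\mathcal G^{(0)}$ let $x\gamma$ denote the unique element of $\gamma$ with target $x$. Then $\gamma$ acts on $L^\infty(\mathcal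 G,\mu_t)$ by $(\alpha(\gamma)f)(g)=f(g\gamma)$, where $g\gamma:=g\cdot(s(g)\gamma)$, and on $L^\infty(\mathcal G^{(0)},\mu)$ by $(\alpha(\gamma)f)(x)=f(s(x\gamma))$. The space $L^\infty(\mathcal G^{(0)},\mu)$ is regarded as a subspace of $L^\infty(\mathcal G,\mu_t)$ through the $\alpha$-equivariant embedding $f\mapsto f\circ s$. The p.m.p. groupoid $(\mathcal G,\mu)$ is amenable if there is a bounded linear map $\Phi\colon L^\infty(\mathcal G,\mu_t)\to L^\infty(\mathcal G^{(0)},\mu)$ of norm $1$ with $\Phi(f)=f$ for all $f\in L^\infty(\mathcal G^{(0)},\mu)$ and $\Phi(\alpha(\gamma)f)=\alpha(\gamma)\Phi(f)$ for all $f\in L^\infty(\mathcal G,\mu_t)$ and $\gamma\in[\mathcal G]$. A symmetric Borel field of probability measures is a Borel function $\pi\colon\mathcal G\to\mathbb C$ with $\pi(g)\ge 0$ and $\pi(g^{-1})=\overline{\pi(g)}$ for $\mu_t$-almost every $g$ and $\sum_{g\in\mathcal G^x}\pi(g)=1$ for $\mu$-almost every $x$. A Borel set $E\subseteq\mathcal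 G^{(0)}$ is invariant if $\mu\bigl(t(s^{-1}(E))\,\triangle\,E\bigr)=0$. For such $E$ with $\mu(E)>0$, let $\mathcal G|_E=s^{-1}(E)\cap t^{-1}(E)$, a discrete p.m.p. groupoid with unit space $E$ and measure $\mu_E=\mu(E)^{-1}\mu|_E$, and let $P^\pi_E$ be the bounded operator on $L^2(\mathcal G|_E,(\mu_E)_t)$ given by $$(P^\pi_E\xi)(g)=\sum_{h\in(\mathcal G|_E)^{s(g)}}\xi(gh)\,\pi(h)\qquad\text{for almost every } g\in\mathcal G|_E .$$ The groupoid $(\mathcal G,\mu)$ satisfies Kesten's criterion if $\|P^\pi_E\|=1$ for every invariant Borel set $E\subseteq\mathcal G^{(0)}$ with $\mu(E)>0$ and every symmetric Borel field of probability measures $\pi$ on $\mathcal G$. **Theorem A.** A discrete p.m.p. groupoid $(\mathcal G,\mu)$ is amenable if and only if it satisfies Kesten's criterion. -/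

import Mathlib

open MeasureTheory
open scoped ENNReal ComplexOrder

/-- A discrete Borel groupoid with arrow space `G` and unit space `X`. The unit space is
identified with a Borel subset of `G` (with its induced Borel structure) through the
measurable embedding `unit`. The product `mul g h` is defined exactly when `s g = t h`. -/
structure DiscreteBorelGroupoid (X G : Type*) [MeasurableSpace X] [MeasurableSpace G] where
  /-- source -/
  s : G → X
  /-- target -/
  t : G → X
  /-- inclusion of the unit space -/
  unit : X → G
  /-- inversion -/
  inv : G → G
  /-- multiplication of composable pairs -/
  mul : (g h : G) → s g = t h → G
  s_unit : ∀ x, s (unit x) = x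
  t_unit : ∀ x, t (unit x) = x
  s_inv : ∀ g, s (inv g) = t g
  t_inv : ∀ g, t (inv g) = s g
  s_mul : ∀ g h e, s (mul g h e) = s h
  t_mul : ∀ g h e, t (mul g h e) = t g
  unit_mul : ∀ g, mul (unit (t g)) g (s_unit (t g)) = g
  mul_unit : ∀ g, mul g (unit (s g)) (t_unit (s g)).symm = g
  mul_assoc : ∀ g h k (e : s g = t h) (e' : s h = t k),
    mul (mul g h e) k ((s_mul g h e).trans e') = mul g (mul h k e') (e.trans (t_mul h k e').symm)
  inv_mul : ∀ g, mul (inv g) g (s_inv g) = unit (s g)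
  mul_inv : ∀ g, mul g (inv g) (t_inv g).symm = unit (t g)
  standardBorel : StandardBorelSpace G
  measurableEmbedding_unit : MeasurableEmbedding unit
  measurable_s : Measurable s
  measurable_t : Measurable t
  measurable_inv : Measurable inv
  measurable_mul : Measurable fun p : {p : G × G // s p.1 = t p.2} => mul p.1.1 p.1.2 p.2
  countable_s : ∀ x, (s ⁻¹' {x}).Countable
  countable_t : ∀ x, (t ⁻¹' {x}).Countable

namespace DiscreteBorelGroupoid

noncomputable section

variable {X G : Type*} [MeasurableSpace X] [MeasurableSpace G]

/-- `μ_s(A) = ∫ #(G_x ∩ A) dμ(x)`, the integral over `x` of the counting measures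
on the source fibres (a measurable family of measures, since `s` is Borel and
countable-to-one). -/
def sourceMeasure (𝒢 : DiscreteBorelGroupoid X G) (μ : Measure X) : Measure G :=
  μ.bind fun x => Measure.count.restrict (𝒢.s ⁻¹' {x})

/-- `μ_t(A) = ∫ #(G^x ∩ A) dμ(x)`, the integral over `x` of the counting measures
on the target fibres. -/
def targetMeasure (𝒢 : DiscreteBorelGroupoid X G) (μ : Measure X) : Measure G :=
  μ.bind fun x => Measure.count.restrict (𝒢.t ⁻¹' {x})

/-- `(𝒢, μ)` is a discrete probability measure-preserving groupoid. -/
structure IsPMP (𝒢 : DiscreteBorelGroupoid X G) (μ : Measure X) : Prop where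
  isProbabilityMeasure : IsProbabilityMeasure μ
  sourceMeasure_eq : 𝒢.sourceMeasure μ = 𝒢.targetMeasure μ

/-- The product `A B` of two sets of arrows. -/
def setMul (𝒢 : DiscreteBorelGroupoid X G) (A B : Set G) : Set G :=
  {k | ∃ g ∈ A, ∃ h ∈ B, ∃ e : 𝒢.s g = 𝒢.t h, k = 𝒢.mul g h e}

/-- The set `A⁻¹` of inverses of the elements of `A`. -/
def setInv (𝒢 : DiscreteBorelGroupoid X G) (A : Set G) : Set G :=
  𝒢.inv '' A

/-- `E` is invariant: `μ (t(𝒢 E) ∆ E) = 0`. -/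
def IsInvariant (𝒢 : DiscreteBorelGroupoid X G) (μ : Measure X) (E : Set X) : Prop :=
  μ (symmDiff (𝒢.t '' 𝒢.setMul Set.univ (𝒢.unit '' E)) E) = 0

/-- Borel bisections: Borel sets meeting each source fibre and each target fibre in at most
one element. -/
def IsBisection (𝒢 : DiscreteBorelGroupoid X G) (γ : Set G) : Prop :=
  MeasurableSet γ ∧
    ∀ x, (𝒢.setMul γ {𝒢.unit x}).Subsingleton ∧ (𝒢.setMul {𝒢.unit x} γ).Subsingleton

/-- The full group `[𝒢]`: the Borel bisections `γ` with `γ γ⁻¹ = γ⁻¹ γ = 𝒢⁽⁰⁾`. -/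
def fullGroup (𝒢 : DiscreteBorelGroupoid X G) : Set (Set G) :=
  {γ | 𝒢.IsBisection γ ∧ 𝒢.setMul γ (𝒢.setInv γ) = Set.range 𝒢.unit ∧
    𝒢.setMul (𝒢.setInv γ) γ = Set.range 𝒢.unit}

theorem exists_mem_target (𝒢 : DiscreteBorelGroupoid X G) {γ : Set G} (hγ : γ ∈ 𝒢.fullGroup)
    (x : X) : ∃ h ∈ γ, x = 𝒢.t h := by
  have hx : 𝒢.unit x ∈ 𝒢.setMul γ (𝒢.setInv γ) := hγ.2.1 ▸ Set.mem_range_self x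
  obtain ⟨g, hg, h, -, e, hk⟩ := hx
  exact ⟨g, hg, by rw [← 𝒢.t_mul g h e, ← hk, 𝒢.t_unit]⟩

/-- `x γ`, the unique element of `γ ∈ [𝒢]` with target `x`. -/
def fibreElt (𝒢 : DiscreteBorelGroupoid X G) {γ : Set G} (hγ : γ ∈ 𝒢.fullGroup) (x : X) : G :=
  (𝒢.exists_mem_target hγ x).choose

theorem fibreElt_mem (𝒢 : DiscreteBorelGroupoid X G) {γ : Set G} (hγ : γ ∈ 𝒢.fullGroup)
    (x : X) : 𝒢.fibreElt hγ x ∈ γ :=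
  (𝒢.exists_mem_target hγ x).choose_spec.1

theorem eq_t_fibreElt (𝒢 : DiscreteBorelGroupoid X G) {γ : Set G} (hγ : γ ∈ 𝒢.fullGroup)
    (x : X) : x = 𝒢.t (𝒢.fibreElt hγ x) :=
  (𝒢.exists_mem_target hγ x).choose_spec.2

/-- The right translation `g ↦ g γ` on arrows by an element `γ` of the full group. -/
def translate (𝒢 : DiscreteBorelGroupoid X G) {γ : Set G} (hγ : γ ∈ 𝒢.fullGroup) (g : G) : G :=
  𝒢.mul g (𝒢.fibreElt hγ (𝒢.s g)) (𝒢.eq_t_fibreElt hγ (𝒢.s g))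

/-- The right action `x ↦ s (x γ)` of the full group on the unit space. -/
def translateUnit (𝒢 : DiscreteBorelGroupoid X G) {γ : Set G} (hγ : γ ∈ 𝒢.fullGroup) (x : X) :
    X :=
  𝒢.s (𝒢.fibreElt hγ x)

/-- `Φ : L^∞(𝒢, μ_t) → L^∞(𝒢⁽⁰⁾, μ)` is a global invariant mean: it has norm `1`, it is the
identity on `L^∞(𝒢⁽⁰⁾, μ)`, which sits in `L^∞(𝒢, μ_t)` through `f ↦ f ∘ s` (the embedding that
intertwines the right actions of `[𝒢]`), and `Φ (α(γ) f) = α(γ) (Φ f)` for all `γ ∈ [𝒢]`, where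
`α(γ)` is composition with the right translation by `γ`. -/
structure IsGlobalInvariantMean (𝒢 : DiscreteBorelGroupoid X G) (μ : Measure X)
    (Φ : Lp ℂ ∞ (𝒢.targetMeasure μ) →L[ℂ] Lp ℂ ∞ μ) : Prop where
  norm_eq_one : ‖Φ‖ = 1
  map_unitSpace : ∀ (f : Lp ℂ ∞ μ) (F : Lp ℂ ∞ (𝒢.targetMeasure μ)),
    (∀ᵐ g ∂(𝒢.targetMeasure μ), F g = f (𝒢.s g)) → Φ F = f
  map_translate : ∀ (γ : Set G) (hγ : γ ∈ 𝒢.fullGroup) (f f' : Lp ℂ ∞ (𝒢.targetMeasure μ)),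
    (∀ᵐ g ∂(𝒢.targetMeasure μ), f' g = f (𝒢.translate hγ g)) →
      ∀ᵐ x ∂μ, Φ f' x = Φ f (𝒢.translateUnit hγ x)

/-- Amenability: existence of a global invariant mean. -/
def IsAmenable (𝒢 : DiscreteBorelGroupoid X G) (μ : Measure X) : Prop :=
  ∃ Φ : Lp ℂ ∞ (𝒢.targetMeasure μ) →L[ℂ] Lp ℂ ∞ μ, 𝒢.IsGlobalInvariantMean μ Φ

/-- `π` is a symmetric Borel field of probability measures. -/
structure IsSymmetricProbField (𝒢 : DiscreteBorelGroupoid X G) (μ : Measure X) (π : G → ℂ) :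
    Prop where
  measurable : Measurable π
  symmetric : ∀ᵐ g ∂(𝒢.targetMeasure μ), π (𝒢.inv g) = starRingEnd ℂ (π g)
  nonneg : ∀ᵐ g ∂(𝒢.targetMeasure μ), 0 ≤ π g
  hasSum_one : ∀ᵐ x ∂μ, HasSum (fun g : 𝒢.t ⁻¹' {x} => π g) 1

/-- `P` is the Markov operator `P^π` on `L²(𝒢, μ_t)`:
`(P ξ)(g) = ∑_{h ∈ 𝒢^{s(g)}} ξ(g h) π(h)` for almost every `g`, with convergence of the sum.
At most one bounded operator `P` has this property. -/
def IsMarkovOperator (𝒢 : DiscreteBorelGroupoid X G) (μ : Measure X) (π : G → ℂ)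
    (P : Lp ℂ 2 (𝒢.targetMeasure μ) →L[ℂ] Lp ℂ 2 (𝒢.targetMeasure μ)) : Prop :=
  ∀ ξ : Lp ℂ 2 (𝒢.targetMeasure μ), ∀ᵐ g ∂(𝒢.targetMeasure μ),
    HasSum (fun h : {h : G // 𝒢.s g = 𝒢.t h} => ξ (𝒢.mul g h.1 h.2) * π h.1) (P ξ g)

/-- The arrows of the restriction `𝒢|_E`: those with source and target in `E`. -/
abbrev RestrictArrows (𝒢 : DiscreteBorelGroupoid X G) (E : Set X) : Type _ :=
  {g : G // 𝒢.s g ∈ E ∧ 𝒢.t g ∈ E}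

/-- The restriction `𝒢|_E` of `𝒢` to a Borel set `E` of units. -/
def restrict (𝒢 : DiscreteBorelGroupoid X G) (E : Set X) (hE : MeasurableSet E) :
    DiscreteBorelGroupoid E (𝒢.RestrictArrows E) where
  s g := ⟨𝒢.s g.1, g.2.1⟩
  t g := ⟨𝒢.t g.1, g.2.2⟩
  unit x := ⟨𝒢.unit x.1, by rw [𝒢.s_unit]; exact x.2, by rw [𝒢.t_unit]; exact x.2⟩
  inv g := ⟨𝒢.inv g.1, by rw [𝒢.s_inv]; exact g.2.2, by rw [𝒢.t_inv]; exact g.2.1⟩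
  mul g h e := ⟨𝒢.mul g.1 h.1 (congrArg Subtype.val e),
    by rw [𝒢.s_mul]; exact h.2.1, by rw [𝒢.t_mul]; exact g.2.2⟩
  s_unit x := Subtype.ext (𝒢.s_unit x.1)
  t_unit x := Subtype.ext (𝒢.t_unit x.1)
  s_inv g := Subtype.ext (𝒢.s_inv g.1)
  t_inv g := Subtype.ext (𝒢.t_inv g.1)
  s_mul g h e := Subtype.ext (𝒢.s_mul g.1 h.1 (congrArg Subtype.val e))
  t_mul g h e := Subtype.ext (𝒢.t_mul g.1 h.1 (congrArg Subtype.val e))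
  unit_mul g := Subtype.ext (𝒢.unit_mul g.1)
  mul_unit g := Subtype.ext (𝒢.mul_unit g.1)
  mul_assoc g h k e e' := Subtype.ext
    (𝒢.mul_assoc g.1 h.1 k.1 (congrArg Subtype.val e) (congrArg Subtype.val e'))
  inv_mul g := Subtype.ext (𝒢.inv_mul g.1)
  mul_inv g := Subtype.ext (𝒢.mul_inv g.1)
  standardBorel := by
    have := 𝒢.standardBorel
    exact ((𝒢.measurable_s hE).inter (𝒢.measurable_t hE)).standardBorel
  measurableEmbedding_unit := by
    have hm : Measurable fun x : E => 𝒢.unit x.1 :=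
      𝒢.measurableEmbedding_unit.measurable.comp measurable_subtype_coe
    refine ⟨fun x y h => Subtype.ext (𝒢.measurableEmbedding_unit.injective
      (congrArg Subtype.val h)), hm.subtype_mk, ?_⟩
    intro A hA
    have h1 : MeasurableSet (𝒢.unit '' (Subtype.val '' A)) :=
      𝒢.measurableEmbedding_unit.measurableSet_image.2 (hE.subtype_image hA)
    refine ⟨_, h1, ?_⟩
    ext g
    constructor
    · rintro ⟨x, ⟨y, hy, rfl⟩, hg⟩
      exact ⟨y, hy, Subtype.ext hg⟩
    · rintro ⟨y, hy, rfl⟩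
      exact ⟨y.1, ⟨y, hy, rfl⟩, rfl⟩
  measurable_s := (𝒢.measurable_s.comp measurable_subtype_coe).subtype_mk
  measurable_t := (𝒢.measurable_t.comp measurable_subtype_coe).subtype_mk
  measurable_inv := (𝒢.measurable_inv.comp measurable_subtype_coe).subtype_mk
  measurable_mul := by
    refine Measurable.subtype_mk ?_
    refine 𝒢.measurable_mul.comp (Measurable.subtype_mk
      (f := fun p : {p : 𝒢.RestrictArrows E × 𝒢.RestrictArrows E //
        (⟨𝒢.s p.1.1, p.1.2.1⟩ : E) = ⟨𝒢.t p.2.1, p.2.2.2⟩} => ((p.1.1.1, p.1.2.1) : G × G))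
      (h := fun p => congrArg Subtype.val p.2) ?_)
    fun_prop
  countable_s x := ((𝒢.countable_s x.1).preimage Subtype.val_injective).mono
    fun _ hg => congrArg Subtype.val hg
  countable_t x := ((𝒢.countable_t x.1).preimage Subtype.val_injective).mono
    fun _ hg => congrArg Subtype.val hg

/-- The normalized restriction `μ_E = μ(E)⁻¹ μ|_E`, as a measure on `E`. -/
def restrictMeasure (μ : Measure X) (E : Set X) : Measure E :=
  (μ E)⁻¹ • μ.comap Subtype.val

/-- Kesten's criterion: for every invariant Borel set `E ⊆ 𝒢⁽⁰⁾` of positive measure and every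
symmetric Borel field of probability measures `π`, the Markov operator `P^π_E` on
`L²(𝒢|_E, (μ_E)_t)` associated with the restriction of `π` to `𝒢|_E` is a bounded operator
of norm `1`. -/
def SatisfiesKesten (𝒢 : DiscreteBorelGroupoid X G) (μ : Measure X) : Prop :=
  ∀ (E : Set X) (hE : MeasurableSet E), 𝒢.IsInvariant μ E → 0 < μ E →
    ∀ π : G → ℂ, 𝒢.IsSymmetricProbField μ π →
      ∃ P : Lp ℂ 2 ((𝒢.restrict E hE).targetMeasure (restrictMeasure μ E)) →L[ℂ]
          Lp ℂ 2 ((𝒢.restrict E hE).targetMeasure (restrictMeasure μ E)),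
        (𝒢.restrict E hE).IsMarkovOperator (restrictMeasure μ E) (fun g => π g.1) P ∧ ‖P‖ = 1

end

end DiscreteBorelGroupoid

/-! Both implications pass through the coboundaries, the span of the functions α(γ)φ − φ with γ in
the full group and φ bounded Borel on the arrows. Invariant means annihilate coboundaries; Markov
operators of norm one prevent coboundaries from being uniformly negative; Hahn–Banach translates
between the two.

Amenable implies Kesten. Integrating Φ f against μ gives an invariant mean on bounded real
functions, positive because Φ has norm one and fixes constants; it restricts to invariant sets
through extension by zero. A Day–Namioka argument
(`IsInvariantMean.exists_almost_invariant_density`) then yields almost invariant probability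
densities f in L¹: otherwise separation in a product of L¹ spaces, together with the duality of L¹
and L^∞, produces a coboundary plus a centred function of the source that is bounded below by a
positive constant, although its mean is zero. The unit vector √f almost attains norm one for the
Markov operator, since finitely many bisections carry most of π. The neglected mass must be small
for the distribution of the source under f, not only for μ; this is why the density lemma also
controls one function of the source.

Kesten implies amenable. For π the uniform average over the units, finitely many γ and their
inverses, norm one and the parallelogram law give almost invariant vectors ξ, and ∫ v|ξ|² is almost
zero for the corresponding coboundaries v. Hence no coboundary is at most −ε over an invariant set
of positive measure. To extend the zero functional on coboundaries below the sublinear functional F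
↦ inf {∫ b : F ≤ b ∘ s}, more is needed: v ≤ b ∘ s must force ∫ b ≥ 0. Suppose ∫ b < 0. Although b
may be positive somewhere, greedily matching its positive part with its negative part along
bisections makes b plus a coboundary at most −ε on an invariant set of positive measure
(`IsPMP.exists_coboundary`); adding that coboundary to v contradicts the previous step. The
extension m gives Φ F as the L^∞ density of b ↦ m(F · b ∘ s), and equivariance of Φ is the vanishing
of m on coboundaries.

The Lusin–Novikov theorem underlies everything: it cuts the arrow space into countably many pieces
inside elements of the full group, so that fibre sums become countable sums of translates. -/

section LusinNovikov

/-! ### Lusin–Novikov: countable-to-one Borel maps -/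

open Set Filter Topology

/-- `N` is covered by countably many Borel sets on which `f` is injective. -/
def CoveredByInjOn {Z X : Type*} [MeasurableSpace Z] (f : Z → X) (N : Set Z) : Prop :=
  ∃ B : ℕ → Set Z, (∀ n, MeasurableSet (B n)) ∧ (∀ n, InjOn f (B n)) ∧ N ⊆ ⋃ n, B n

theorem CoveredByInjOn.iUnion {Z X ι : Type*} [MeasurableSpace Z] [Countable ι] {f : Z → X}
    {N : ι → Set Z} (h : ∀ i, CoveredByInjOn f (N i)) : CoveredByInjOn f (⋃ i, N i) := by
  rcases isEmpty_or_nonempty ι with hι | hι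
  · exact ⟨fun _ => ∅, by simp, by simp, by simp⟩
  choose B hm hi hc using h
  obtain ⟨e, he⟩ := exists_surjective_nat (ι × ℕ)
  refine ⟨fun n => B (e n).1 (e n).2, fun n => hm _ _, fun n => hi _ _, ?_⟩
  refine iUnion_subset fun i z hz => ?_
  obtain ⟨n, hn⟩ := mem_iUnion.1 (hc i hz)
  obtain ⟨k, hk⟩ := he (i, n)
  exact mem_iUnion.2 ⟨k, by rw [hk]; exact hn⟩

theorem CoveredByInjOn.union {Z X : Type*} [MeasurableSpace Z] {f : Z → X} {N N' : Set Z}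
    (h : CoveredByInjOn f N) (h' : CoveredByInjOn f N') : CoveredByInjOn f (N ∪ N') := by
  rw [union_eq_iUnion]
  exact CoveredByInjOn.iUnion (by rintro (_ | _) <;> assumption)

variable {Z X : Type*} [TopologicalSpace Z] [PolishSpace Z] [MeasurableSpace Z] [BorelSpace Z]
  [TopologicalSpace X] [PolishSpace X] {f : Z → X}

/-- An analytic set on which `f` is injective is contained in a Borel set with that property. -/
theorem exists_measurableSet_injOn_of_analyticSet (hf : Continuous f) {A : Set Z}
    (hA : AnalyticSet A) (hi : InjOn f A) : ∃ B, MeasurableSet B ∧ InjOn f B ∧ A ⊆ B := by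
  have key : ∀ C : Set Z, AnalyticSet C →
      AnalyticSet {w : Z | ∃ z ∈ C, f z = f w ∧ z ≠ w} := by
    intro C hC
    have h1 : AnalyticSet {p : Z × Z | f p.1 = f p.2 ∧ p.1 ≠ p.2} :=
      ((isClosed_eq (hf.comp continuous_fst) (hf.comp continuous_snd)).measurableSet.inter
        (isClosed_eq continuous_fst continuous_snd).measurableSet.compl).analyticSet
    have h2 : AnalyticSet (Prod.fst ⁻¹' C : Set (Z × Z)) := by
      rcases C.eq_empty_or_nonempty with rfl | hne
      · simpa using analyticSet_empty
      · obtain ⟨β, _, _, u, hu, rfl⟩ := analyticSet_iff_exists_polishSpace_range.1 hC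
        have : (Prod.fst ⁻¹' range u : Set (Z × Z)) =
            range (fun p : β × Z => (u p.1, p.2)) := by
          ext ⟨a, b⟩
          simp
        rw [this]
        exact analyticSet_range_of_polishSpace (by fun_prop)
    have h3 : AnalyticSet (⋂ b : Bool, cond b {p : Z × Z | f p.1 = f p.2 ∧ p.1 ≠ p.2}
        (Prod.fst ⁻¹' C)) :=
      AnalyticSet.iInter (by rintro (_ | _) <;> assumption)
    convert h3.image_of_continuous continuous_snd using 1
    ext w
    simp only [mem_ofPred_eq, mem_image, mem_iInter, Bool.forall_bool, cond_true, cond_false,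
      mem_preimage, Prod.exists]
    constructor
    · rintro ⟨z, hz, h⟩
      exact ⟨z, w, ⟨hz, h⟩, rfl⟩
    · rintro ⟨z, w, ⟨hz, h⟩, rfl⟩
      exact ⟨z, hz, h⟩
  -- Two separations are needed. `B` contains no second point of a fibre through `A`; hence `A`
  -- misses the analytic set of second points of fibres through `B`, and `C` separates these two
  -- sets.
  obtain ⟨B, hAB, hBd, hB⟩ := hA.measurablySeparable (key A hA)
    (disjoint_left.2 fun w hw ⟨z, hz, h, hne⟩ => hne (hi hz hw h))
  obtain ⟨C, hAC, hCd, hC⟩ := hA.measurablySeparable (key B hB.analyticSet)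
    (disjoint_left.2 fun w hw ⟨z, hz, h, hne⟩ =>
      disjoint_left.1 hBd ⟨w, hw, h.symm, hne.symm⟩ hz)
  refine ⟨B ∩ C, hB.inter hC, fun z hz w hw h => ?_, subset_inter hAB hAC⟩
  by_contra hne
  exact disjoint_left.1 hCd ⟨z, hz.1, h, hne⟩ hw.2

/-- Outside of any set covered by countably many Borel sets of injectivity, some fibre of `f`
meets all of `U 0, …, U n`. -/
def FibrewiseLarge {Z X : Type*} [MeasurableSpace Z] (f : Z → X) (n : ℕ) (U : ℕ → Set Z) : Prop :=
  ∀ N, CoveredByInjOn f N → ∃ z : ℕ → Z, (∀ i ≤ n, z i ∈ U i ∧ z i ∉ N) ∧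
    ∀ i ≤ n, f (z i) = f (z 0)

/-- A fibrewise large tuple stays large if one of its sets is doubled. -/
theorem FibrewiseLarge.double (hf : Continuous f) {n k : ℕ} (hk : k ≤ n) {U : ℕ → Set Z}
    (hU : ∀ i, MeasurableSet (U i)) (h : FibrewiseLarge f n U) (N : Set Z)
    (hN : CoveredByInjOn f N) :
    ∃ z : ℕ → Z, (∀ i ≤ n, z i ∈ U i ∧ z i ∉ N) ∧ (z (n + 1) ∈ U k ∧ z (n + 1) ∉ N) ∧
      z (n + 1) ≠ z k ∧ ∀ i ≤ n + 1, f (z i) = f (z 0) := by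
  obtain ⟨B, hBm, hBi, hNB⟩ := hN
  set M := ⋃ n, B n with hM
  have hMm : MeasurableSet M := MeasurableSet.iUnion hBm
  have hMc : CoveredByInjOn f M := ⟨B, hBm, hBi, subset_rfl⟩
  -- If doubling fails, two tuples in `T` over the same fibre have equal `k`-th coordinates, so
  -- these coordinates form an analytic set of injectivity. Its Borel hull can be added to `M`, and
  -- largeness provides a tuple avoiding both, which is absurd.
  by_contra! hcon
  set T : Set (ℕ → Z) := {z | ∀ i ≤ n, (z i ∈ U i ∧ z i ∉ M) ∧ f (z i) = f (z 0)} with hT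
  have hTm : MeasurableSet T := by
    have : T = ⋂ i, ⋂ (_ : i ≤ n), ((fun z : ℕ → Z => z i) ⁻¹' (U i \ M)) ∩
        {z : ℕ → Z | f (z i) = f (z 0)} := by
      ext z; simp [hT]
    rw [this]
    refine MeasurableSet.iInter fun i => MeasurableSet.iInter fun _ => ?_
    exact (measurable_pi_apply i ((hU i).diff hMm)).inter
      (isClosed_eq (hf.comp (continuous_apply i)) (hf.comp (continuous_apply 0))).measurableSet
  have hA : AnalyticSet ((fun z : ℕ → Z => z k) '' T) :=
    hTm.analyticSet.image_of_continuous (continuous_apply k)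
  have hinj : InjOn f ((fun z : ℕ → Z => z k) '' T) := by
    rintro _ ⟨z, hz, rfl⟩ _ ⟨w, hw, rfl⟩ hzw
    by_contra hne
    have hzw' : f (z k) = f (w k) := hzw
    set z' : ℕ → Z := fun i => if i ≤ n then z i else w k with hz'
    have h1 : ∀ i ≤ n, z' i = z i := fun i hi => by simp [hz', hi]
    have h2 : z' (n + 1) = w k := by simp [hz']
    obtain ⟨i, hi, hi'⟩ := hcon z'
      (fun i hi => by rw [h1 i hi]; exact ⟨(hz i hi).1.1, fun hm => (hz i hi).1.2 (hNB hm)⟩)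
      (by rw [h2]; exact ⟨(hw k hk).1.1, fun hm => (hw k hk).1.2 (hNB hm)⟩)
      (by rw [h2, h1 k hk]; exact fun he => hne he.symm)
    apply hi'
    rw [h1 0 (Nat.zero_le _)]
    rcases Nat.le_succ_iff.1 hi with hi | rfl
    · rw [h1 i hi]; exact (hz i hi).2
    · show f (z' (n + 1)) = _
      rw [h2, ← hzw']; exact (hz k hk).2
  obtain ⟨B', hB'm, hB'i, hB'⟩ := exists_measurableSet_injOn_of_analyticSet hf hA hinj
  have hB'c : CoveredByInjOn f B' :=
    ⟨fun _ => B', fun _ => hB'm, fun _ => hB'i, subset_iUnion (fun _ : ℕ => B') 0⟩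
  obtain ⟨z, hz, hzf⟩ := h _ (hMc.union hB'c)
  refine (hz k hk).2 (Or.inr (hB' ⟨z, fun i hi => ⟨⟨(hz i hi).1, fun hm => ?_⟩, hzf i hi⟩, rfl⟩))
  exact (hz i hi).2 (Or.inl hm)

/-- Doubling one set of a fibrewise large tuple, with disjoint halves and small pieces. -/
theorem FibrewiseLarge.exists_split {Z : Type*} [MetricSpace Z]
    [SecondCountableTopology Z] [CompleteSpace Z] [MeasurableSpace Z] [BorelSpace Z] {f : Z → X}
    (hf : Continuous f) {n k : ℕ}
    (hk : k ≤ n) {U : ℕ → Set Z} (hU : ∀ i, IsClosed (U i)) (h : FibrewiseLarge f n U)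
    {ε : ℝ} (hε : 0 < ε) :
    ∃ V : ℕ → Set Z, (∀ i, IsClosed (V i)) ∧ FibrewiseLarge f (n + 1) V ∧ (∀ i ≤ n, V i ⊆ U i) ∧
      V (n + 1) ⊆ U k ∧ Disjoint (V k) (V (n + 1)) ∧
      ∀ i ≤ n + 1, ∀ z ∈ V i, ∀ w ∈ V i, dist z w ≤ ε := by
  have hne : Nonempty Z := by
    obtain ⟨z, -⟩ := h ∅ ⟨fun _ => ∅, by simp, by simp, by simp⟩
    exact ⟨z 0⟩
  let q : ℕ → Z := TopologicalSpace.denseSeq Z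
  have hq : DenseRange q := TopologicalSpace.denseRange_denseSeq Z
  let U' : ℕ → Set Z := fun i => if i ≤ n then U i else U k
  have hU' : ∀ i, IsClosed (U' i) := fun i => by
    by_cases hi : i ≤ n <;> simp [U', hi, hU]
  -- Only countably many ways of cutting by balls are considered, so if none of them were large, the
  -- union of their exceptional sets would still be covered.
  let ι := {p : (Fin (n + 2) → ℕ) × ℕ // (1 : ℝ) / (p.2 + 1) ≤ ε / 2 ∧
    Disjoint (Metric.closedBall (q (p.1 ⟨k, by omega⟩)) ((1 : ℝ) / (p.2 + 1)))
      (Metric.closedBall (q (p.1 (Fin.last _))) ((1 : ℝ) / (p.2 + 1)))}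
  let V : ι → ℕ → Set Z := fun p i => if hi : i < n + 2 then
    U' i ∩ Metric.closedBall (q (p.1.1 ⟨i, hi⟩)) ((1 : ℝ) / (p.1.2 + 1)) else ∅
  have hex : ∃ p, FibrewiseLarge f (n + 1) (V p) := by
    by_contra! hcon
    have : ∀ p, ∃ N, CoveredByInjOn f N ∧ ∀ z : ℕ → Z, (∀ i ≤ n + 1, z i ∈ V p i ∧ z i ∉ N) →
        ¬ ∀ i ≤ n + 1, f (z i) = f (z 0) := by
      intro j
      have := hcon j
      unfold FibrewiseLarge at this
      push Not at this
      obtain ⟨N, hN, hz⟩ := this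
      exact ⟨N, hN, fun z hz' h => by
        obtain ⟨i, hi, h'⟩ := hz z hz'
        exact h' (h i hi)⟩
    choose N hN hz using this
    obtain ⟨z, hz1, hz2, hzne, hzf⟩ := h.double hf hk (fun i => (hU i).measurableSet) _
      (CoveredByInjOn.iUnion hN)
    -- With radius r below a fifth of the distance of the two points, centres within r of them are
    -- more than 3r apart, so the closed balls are disjoint.
    obtain ⟨m, hm⟩ := exists_nat_one_div_lt
      (lt_min (half_pos hε) (by
        have := dist_pos.2 hzne
        positivity : 0 < dist (z (n + 1)) (z k) / 5))
    have hr : (0 : ℝ) < 1 / (m + 1) := by positivity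
    have : ∀ i : Fin (n + 2), ∃ j, dist (z i) (q j) < 1 / ((m : ℝ) + 1) :=
      fun i => hq.exists_dist_lt (z i) hr
    choose j hj using this
    have hdisj : Disjoint (Metric.closedBall (q (j ⟨k, by omega⟩)) ((1 : ℝ) / (m + 1)))
        (Metric.closedBall (q (j (Fin.last _))) ((1 : ℝ) / (m + 1))) := by
      refine Metric.closedBall_disjoint_closedBall ?_
      have h1 := hj ⟨k, by omega⟩
      have h2 := hj (Fin.last _)
      have h3 := lt_of_lt_of_le hm (min_le_right _ _)
      have h4 := dist_triangle4 (z (n + 1)) (q (j (Fin.last _))) (q (j ⟨k, by omega⟩)) (z k)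
      rw [dist_comm (q (j (Fin.last _))) (q _), dist_comm (q _) (z k)] at h4
      simp only [Fin.val_last] at h1 h2
      linarith
    have hm' := lt_of_lt_of_le hm (min_le_left _ _)
    refine hz ⟨(j, m), hm'.le, hdisj⟩ z (fun i hi => ?_) hzf
    have hi2 : i < n + 2 := by omega
    have hnot : z i ∉ ⋃ i, N i ∧ z i ∈ U' i := by
      by_cases hin : i ≤ n
      · simpa [U', hin] using (hz1 i hin).symm
      · obtain rfl : i = n + 1 := by omega
        simpa [U'] using hz2.symm
    refine ⟨?_, fun hmem => hnot.1 (mem_iUnion.2 ⟨_, hmem⟩)⟩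
    simp only [V, hi2, dif_pos]
    exact ⟨hnot.2, (hj ⟨i, hi2⟩).le⟩
  obtain ⟨⟨⟨j, m⟩, hm, hd⟩, hp⟩ := hex
  have hVc : ∀ i (hi : i < n + 2), V ⟨⟨j, m⟩, hm, hd⟩ i =
      U' i ∩ Metric.closedBall (q (j ⟨i, hi⟩)) ((1 : ℝ) / (m + 1)) := fun i hi => by
    simp only [V, hi, dif_pos]
  refine ⟨V ⟨⟨j, m⟩, hm, hd⟩, fun i => ?_, hp, fun i hi => ?_, ?_, ?_, fun i hi z hz w hw => ?_⟩
  · by_cases hi : i < n + 2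
    · rw [hVc i hi]
      exact (hU' i).inter Metric.isClosed_closedBall
    · simp [V, hi]
  · rw [hVc i (by omega)]
    refine inter_subset_left.trans ?_
    simp [U', hi]
  · rw [hVc (n + 1) (by omega)]
    refine inter_subset_left.trans ?_
    simp [U']
  · rw [hVc k (by omega), hVc (n + 1) (by omega)]
    exact hd.mono inter_subset_right inter_subset_right
  · rw [hVc i (by omega)] at hz hw
    have h1 := Metric.mem_closedBall.1 hz.2
    have h2 := Metric.mem_closedBall'.1 hw.2
    have h3 := dist_triangle z (q (j ⟨i, by omega⟩)) w
    simp only at hm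
    linarith

/-- A continuous countable-to-one map on a Polish space is injective on each of countably many
Borel sets covering the space. -/
theorem coveredByInjOn_univ_of_continuous (hf : Continuous f)
    (hc : ∀ x, (f ⁻¹' {x}).Countable) : CoveredByInjOn f univ := by
  let := TopologicalSpace.upgradeIsCompletelyMetrizable Z
  by_contra hbig
  have h0 : FibrewiseLarge f 0 fun _ => univ := by
    intro N hN
    obtain ⟨z, hz⟩ : ∃ z, z ∉ N := by
      by_contra! hall
      exact hbig (by rwa [eq_univ_of_forall hall] at hN)
    exact ⟨fun _ => z, by simpa using hz, by simp⟩
  -- Stage `n` doubles the set with index `n.unpair.1 ≤ n`; thus every index is doubled at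
  -- infinitely many stages.
  have hstep : ∀ n (U : {U : ℕ → Set Z // (∀ i, IsClosed (U i)) ∧ FibrewiseLarge f n U}),
      ∃ V : {V : ℕ → Set Z // (∀ i, IsClosed (V i)) ∧ FibrewiseLarge f (n + 1) V},
        (∀ i ≤ n, V.1 i ⊆ U.1 i) ∧ V.1 (n + 1) ⊆ U.1 n.unpair.1 ∧
        Disjoint (V.1 n.unpair.1) (V.1 (n + 1)) ∧
        ∀ i ≤ n + 1, ∀ z ∈ V.1 i, ∀ w ∈ V.1 i, dist z w ≤ (1 / 2 : ℝ) ^ n := by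
    rintro n ⟨U, hU, hl⟩
    obtain ⟨V, h1, h2, h3⟩ := hl.exists_split hf (Nat.unpair_left_le n) hU
      (pow_pos (by norm_num : (0 : ℝ) < 1 / 2) n)
    exact ⟨⟨V, h1, h2⟩, h3⟩
  choose next hnext using hstep
  let U : ∀ n, {U : ℕ → Set Z // (∀ i, IsClosed (U i)) ∧ FibrewiseLarge f n U} := fun n =>
    Nat.rec ⟨fun _ => univ, fun _ => isClosed_univ, h0⟩ (fun n V => next n V) n
  have hU : ∀ n, U (n + 1) = next n (U n) := fun n => rfl
  have hmono : ∀ i n m, i ≤ n → n ≤ m → (U m).1 i ⊆ (U n).1 i := by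
    intro i n m hin hnm
    induction m, hnm using Nat.le_induction with
    | base => exact subset_rfl
    | succ m hm ih => exact ((hnext m (U m)).1 i (hin.trans hm)).trans ih
  have hsmall : ∀ i n, i ≤ n + 1 → ∀ z ∈ (U (n + 1)).1 i, ∀ w ∈ (U (n + 1)).1 i,
      dist z w ≤ (1 / 2 : ℝ) ^ n := fun i n hi => (hnext n (U n)).2.2.2 i hi
  have hpt : ∀ n, ∃ z : ℕ → Z, (∀ i ≤ n, z i ∈ (U n).1 i) ∧ ∀ i ≤ n, f (z i) = f (z 0) := by
    intro n
    obtain ⟨z, hz, hzf⟩ := (U n).2.2 ∅ ⟨fun _ => ∅, by simp, by simp, by simp⟩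
    exact ⟨z, fun i hi => (hz i hi).1, hzf⟩
  choose p hp hpf using hpt
  have hlim : ∀ i, ∃ z, Tendsto (fun n => p n i) atTop (𝓝 z) := by
    intro i
    refine cauchySeq_tendsto_of_complete ?_
    rw [Metric.cauchySeq_iff']
    intro ε hε
    obtain ⟨k, hk⟩ := exists_pow_lt_of_lt_one hε (by norm_num : (1 / 2 : ℝ) < 1)
    refine ⟨max i (k + 1), fun n hn => ?_⟩
    have h1 : k + 1 ≤ max i (k + 1) := le_max_right _ _
    have h2 : i ≤ max i (k + 1) := le_max_left _ _
    obtain ⟨l, hl⟩ : ∃ l, max i (k + 1) = l + 1 := ⟨max i (k + 1) - 1, by omega⟩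
    rw [hl] at hn h1 h2 ⊢
    refine lt_of_le_of_lt (hsmall i l h2 _ (hmono i _ _ h2 hn (hp n i (h2.trans hn))) _
      (hp _ i h2)) (lt_of_le_of_lt ?_ hk)
    exact pow_le_pow_of_le_one (by norm_num) (by norm_num) (by omega)
  choose z hz using hlim
  have hzU : ∀ i n, i ≤ n → z i ∈ (U n).1 i := fun i n hin =>
    ((U n).2.1 i).mem_of_tendsto (hz i) ((eventually_ge_atTop n).mono fun m hm =>
      hmono i n m hin hm (hp m i (hin.trans hm)))
  have hzf : ∀ i, f (z i) = f (z 0) := fun i =>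
    tendsto_nhds_unique ((hf.tendsto _).comp (hz i)) (((hf.tendsto _).comp (hz 0)).congr'
      ((eventually_ge_atTop i).mono fun m hm => (hpf m i hm).symm))
  -- At stage `n = Nat.pair i (k + 1)` the `i`-th set is split: `z (n + 1)` falls into the half not
  -- containing `z i`, but both lie in a set of diameter at most `(1 / 2) ^ (n - 1)`.
  have hpre : Preperfect (range z) := by
    rw [preperfect_iff_nhds]
    rintro _ ⟨i, rfl⟩ W hW
    obtain ⟨ε, hε, hball⟩ := Metric.mem_nhds_iff.1 hW
    obtain ⟨k, hk⟩ := exists_pow_lt_of_lt_one hε (by norm_num : (1 / 2 : ℝ) < 1)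
    set n := Nat.pair i (k + 1) with hn
    have hun : n.unpair.1 = i := by simp [hn]
    have hkn : k + 1 ≤ n := Nat.right_le_pair i (k + 1)
    have hin : i ≤ n := Nat.left_le_pair i (k + 1)
    obtain ⟨-, h2, h3, -⟩ := hnext n (U n)
    rw [← hU, hun] at h2 h3
    have h4 : z (n + 1) ∈ (U (n + 1)).1 (n + 1) := hzU (n + 1) (n + 1) le_rfl
    refine ⟨z (n + 1), ⟨hball ?_, mem_range_self _⟩, fun he =>
      disjoint_left.1 h3 (hzU i (n + 1) (by omega)) (he ▸ h4)⟩
    obtain ⟨l, hl⟩ : ∃ l, n = l + 1 := ⟨n - 1, by omega⟩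
    have h5 : z (n + 1) ∈ (U (l + 1)).1 i := hl ▸ h2 h4
    refine lt_of_le_of_lt (hsmall i l (by omega) _ h5 _ (hzU i (l + 1) (by omega)))
      (lt_of_le_of_lt ?_ hk)
    exact pow_le_pow_of_le_one (by norm_num) (by norm_num) (by omega)
  -- All limit points lie in one closed fibre, so a nonempty perfect set, and with it a copy of
  -- Cantor space, sits inside a countable set.
  have hsub : closure (range z) ⊆ f ⁻¹' {f (z 0)} :=
    closure_minimal (by rintro _ ⟨i, rfl⟩; exact hzf i) (isClosed_singleton.preimage hf)
  obtain ⟨g, hg, -, hgi⟩ := hpre.perfect_closure.exists_nat_bool_injection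
    ((range_nonempty z).closure)
  have hcount : (range g).Countable := (hc _).mono (hg.trans hsub)
  have : Countable (ℕ → Bool) := by
    rw [← countable_univ_iff]
    exact MapsTo.countable_of_injOn (fun x _ => mem_range_self x) hgi.injOn hcount
  have h1 := Cardinal.mk_le_aleph0 (α := ℕ → Bool)
  simp only [Cardinal.mk_pi, Cardinal.mk_bool, Cardinal.prod_const, Cardinal.lift_id,
    Cardinal.mk_nat] at h1
  exact absurd h1 (not_le.2 (Cardinal.cantor _))

end LusinNovikov

/-- A Borel countable-to-one map between standard Borel spaces is injective on each piece of
some countable Borel partition. -/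
theorem exists_measurable_partition_injOn {Z X : Type*} [MeasurableSpace Z] [StandardBorelSpace Z]
    [MeasurableSpace X] [StandardBorelSpace X] {f : Z → X} (hf : Measurable f)
    (hc : ∀ x, (f ⁻¹' {x}).Countable) :
    ∃ B : ℕ → Set Z, (∀ n, MeasurableSet (B n)) ∧ (∀ n, Set.InjOn f (B n)) ∧
      Pairwise (Function.onFun Disjoint B) ∧ ⋃ n, B n = Set.univ := by
  let := upgradeStandardBorel Z
  let := upgradeStandardBorel X
  have hborel := eq_borel_upgradeStandardBorel Z
  have hpolZ : PolishSpace Z := inferInstance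
  -- A finer Polish topology makes `f` continuous; comparable Polish topologies have the same Borel
  -- sets.
  obtain ⟨τ, hτ, hcont, hpol⟩ := hf.exists_continuous
  have hb : @BorelSpace Z τ _ := by
    constructor
    rw [hborel]
    exact (borel_eq_borel_of_le hpol hpolZ hτ).symm
  obtain ⟨B, hBm, hBi, hBu⟩ := @coveredByInjOn_univ_of_continuous Z X τ hpol _ hb _ _ f hcont hc
  refine ⟨disjointed B, fun n => MeasurableSet.disjointed hBm n,
    fun n => (hBi n).mono (disjointed_subset B n), disjoint_disjointed B, ?_⟩
  rw [iUnion_disjointed]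
  exact Set.univ_subset_iff.1 hBu

/-! ### Groupoid algebra and covering by the full group -/

namespace DiscreteBorelGroupoid

variable {X G : Type*} [MeasurableSpace X] [MeasurableSpace G] (𝒢 : DiscreteBorelGroupoid X G)

/-- The unit embedding is a Borel isomorphism onto a Borel subset of the arrow space, and a Polish
topology is pulled back along it. -/
theorem standardBorel_units (𝒢 : DiscreteBorelGroupoid X G) : StandardBorelSpace X := by
  have := 𝒢.standardBorel
  have h : StandardBorelSpace (Set.range 𝒢.unit) :=
    𝒢.measurableEmbedding_unit.measurableSet_range.standardBorel
  let := upgradeStandardBorel (Set.range 𝒢.unit)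
  let e := 𝒢.measurableEmbedding_unit.equivRange
  let τ : TopologicalSpace X := TopologicalSpace.induced e inferInstance
  have he : IsHomeomorph e.toEquiv :=
    (e.toEquiv.toHomeomorphOfIsInducing ⟨rfl⟩).isHomeomorph
  have hp : PolishSpace X := (he.homeomorph e.toEquiv).isClosedEmbedding.polishSpace
  refine ⟨τ, ⟨?_⟩, hp⟩
  rw [← e.measurableEmbedding.comap_eq, borel_comap]
  congr 1
  exact BorelSpace.measurable_eq

theorem mul_congr {g g' h h' : G} (hg : g = g') (hh : h = h') (e : 𝒢.s g = 𝒢.t h) :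
    𝒢.mul g h e = 𝒢.mul g' h' (hg ▸ hh ▸ e) := by
  subst hg hh
  rfl

theorem unit_mul' {g : G} {x : X} (e : 𝒢.s (𝒢.unit x) = 𝒢.t g) : 𝒢.mul (𝒢.unit x) g e = g := by
  obtain rfl : x = 𝒢.t g := by rw [← e, 𝒢.s_unit]
  exact 𝒢.unit_mul g

theorem mul_unit' {g : G} {x : X} (e : 𝒢.s g = 𝒢.t (𝒢.unit x)) : 𝒢.mul g (𝒢.unit x) e = g := by
  obtain rfl : x = 𝒢.s g := by rw [e, 𝒢.t_unit]
  exact 𝒢.mul_unit g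

theorem inv_mul_cancel_left (g h : G) (e : 𝒢.s g = 𝒢.t h) :
    𝒢.mul (𝒢.inv g) (𝒢.mul g h e) ((𝒢.s_inv g).trans (𝒢.t_mul g h e).symm) = h := by
  rw [← 𝒢.mul_assoc (𝒢.inv g) g h (𝒢.s_inv g) e, 𝒢.mul_congr (𝒢.inv_mul g) rfl]
  exact 𝒢.unit_mul' _

theorem mul_inv_cancel_right (g h k : G) (e : 𝒢.s g = 𝒢.t h) (hk : k = 𝒢.inv h) :
    𝒢.mul (𝒢.mul g h e) k (by rw [hk, 𝒢.s_mul, 𝒢.t_inv]) = g := by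
  subst hk
  rw [𝒢.mul_assoc g h (𝒢.inv h) e (𝒢.t_inv h).symm, 𝒢.mul_congr rfl (𝒢.mul_inv h)]
  exact 𝒢.mul_unit' _

theorem inv_inv (g : G) : 𝒢.inv (𝒢.inv g) = g := by
  have h := 𝒢.inv_mul_cancel_left (𝒢.inv g) g (𝒢.s_inv g)
  rw [𝒢.mul_congr rfl (𝒢.inv_mul g), 𝒢.mul_unit'] at h
  exact h

theorem inv_unit (x : X) : 𝒢.inv (𝒢.unit x) = 𝒢.unit x := by
  have h := 𝒢.inv_mul (𝒢.unit x)
  rw [𝒢.mul_unit', 𝒢.s_unit] at h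
  exact h

theorem inv_injective : Function.Injective 𝒢.inv := fun g h e => by
  rw [← 𝒢.inv_inv g, e, 𝒢.inv_inv]

theorem mem_setInv {γ : Set G} {g : G} : g ∈ 𝒢.setInv γ ↔ 𝒢.inv g ∈ γ := by
  constructor
  · rintro ⟨h, hh, rfl⟩
    rwa [𝒢.inv_inv]
  · exact fun h => ⟨_, h, 𝒢.inv_inv g⟩

theorem measurableSet_setInv {γ : Set G} (h : MeasurableSet γ) : MeasurableSet (𝒢.setInv γ) := by
  have : 𝒢.setInv γ = 𝒢.inv ⁻¹' γ := Set.ext fun g => 𝒢.mem_setInv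
  rw [this]
  exact 𝒢.measurable_inv h

theorem measurableSet_image_s {σ : Set G} (hm : MeasurableSet σ) (hs : Set.InjOn 𝒢.s σ) :
    MeasurableSet (𝒢.s '' σ) := by
  have := 𝒢.standardBorel
  have := 𝒢.standardBorel_units
  exact hm.image_of_measurable_injOn 𝒢.measurable_s hs

theorem measurableSet_image_t {σ : Set G} (hm : MeasurableSet σ) (ht : Set.InjOn 𝒢.t σ) :
    MeasurableSet (𝒢.t '' σ) := by
  have := 𝒢.standardBorel
  have := 𝒢.standardBorel_units
  exact hm.image_of_measurable_injOn 𝒢.measurable_t ht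

/-- The full group consists of the Borel sets that meet each source fibre and each target fibre
in exactly one point. -/
theorem mem_fullGroup_iff {γ : Set G} : γ ∈ 𝒢.fullGroup ↔ MeasurableSet γ ∧
    Set.InjOn 𝒢.s γ ∧ Set.InjOn 𝒢.t γ ∧ 𝒢.s '' γ = Set.univ ∧ 𝒢.t '' γ = Set.univ := by
  constructor
  · rintro ⟨⟨hm, hb⟩, h1, h2⟩
    refine ⟨hm, fun g hg h hh e => ?_, fun g hg h hh e => ?_, ?_, ?_⟩
    · refine (hb (𝒢.s g)).1 ⟨g, hg, _, rfl, (𝒢.t_unit _).symm, (𝒢.mul_unit' _).symm⟩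
        ⟨h, hh, _, rfl, by rw [𝒢.t_unit, e], (𝒢.mul_unit' _).symm⟩
    · refine (hb (𝒢.t g)).2 ⟨_, rfl, g, hg, 𝒢.s_unit _, (𝒢.unit_mul' _).symm⟩
        ⟨_, rfl, h, hh, by rw [𝒢.s_unit, e], (𝒢.unit_mul' _).symm⟩
    · refine Set.eq_univ_of_forall fun x => ?_
      have hx : 𝒢.unit x ∈ 𝒢.setMul (𝒢.setInv γ) γ := h2 ▸ Set.mem_range_self x
      obtain ⟨g, -, h, hh, e, hk⟩ := hx
      exact ⟨h, hh, by rw [← 𝒢.s_mul g h e, ← hk, 𝒢.s_unit]⟩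
    · refine Set.eq_univ_of_forall fun x => ?_
      have hx : 𝒢.unit x ∈ 𝒢.setMul γ (𝒢.setInv γ) := h1 ▸ Set.mem_range_self x
      obtain ⟨g, hg, h, -, e, hk⟩ := hx
      exact ⟨g, hg, by rw [← 𝒢.t_mul g h e, ← hk, 𝒢.t_unit]⟩
  · rintro ⟨hm, hs, ht, hsu, htu⟩
    refine ⟨⟨hm, fun x => ⟨?_, ?_⟩⟩, ?_, ?_⟩
    · rintro _ ⟨g, hg, _, rfl, e, rfl⟩ _ ⟨h, hh, _, rfl, e', rfl⟩
      rw [𝒢.mul_unit', 𝒢.mul_unit']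
      exact hs hg hh (e.trans e'.symm)
    · rintro _ ⟨_, rfl, g, hg, e, rfl⟩ _ ⟨_, rfl, h, hh, e', rfl⟩
      rw [𝒢.unit_mul', 𝒢.unit_mul']
      exact ht hg hh (e.symm.trans e')
    · ext k
      constructor
      · rintro ⟨g, hg, h, hh, e, rfl⟩
        have hgh : g = 𝒢.inv h := hs hg (𝒢.mem_setInv.1 hh) (by rw [e, 𝒢.s_inv])
        subst hgh
        rw [𝒢.inv_mul]
        exact Set.mem_range_self _
      · rintro ⟨x, rfl⟩
        obtain ⟨g, hg, rfl⟩ := htu.symm ▸ Set.mem_univ x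
        exact ⟨g, hg, 𝒢.inv g, ⟨g, hg, rfl⟩, _, (𝒢.mul_inv g).symm⟩
    · ext k
      constructor
      · rintro ⟨g, hg, h, hh, e, rfl⟩
        have hgh : h = 𝒢.inv g := ht hh (𝒢.mem_setInv.1 hg) (by rw [← e, 𝒢.t_inv])
        subst hgh
        rw [𝒢.mul_inv]
        exact Set.mem_range_self _
      · rintro ⟨x, rfl⟩
        obtain ⟨g, hg, rfl⟩ := hsu.symm ▸ Set.mem_univ x
        exact ⟨𝒢.inv g, ⟨g, hg, rfl⟩, g, hg, _, (𝒢.inv_mul g).symm⟩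

theorem range_unit_mem_fullGroup : Set.range 𝒢.unit ∈ 𝒢.fullGroup := by
  refine 𝒢.mem_fullGroup_iff.2 ⟨𝒢.measurableEmbedding_unit.measurableSet_range, ?_, ?_, ?_, ?_⟩
  · rintro _ ⟨x, rfl⟩ _ ⟨y, rfl⟩ h
    rw [𝒢.s_unit, 𝒢.s_unit] at h
    rw [h]
  · rintro _ ⟨x, rfl⟩ _ ⟨y, rfl⟩ h
    rw [𝒢.t_unit, 𝒢.t_unit] at h
    rw [h]
  · exact Set.eq_univ_of_forall fun x => ⟨_, ⟨x, rfl⟩, 𝒢.s_unit x⟩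
  · exact Set.eq_univ_of_forall fun x => ⟨_, ⟨x, rfl⟩, 𝒢.t_unit x⟩

theorem setInv_mem_fullGroup {γ : Set G} (hγ : γ ∈ 𝒢.fullGroup) : 𝒢.setInv γ ∈ 𝒢.fullGroup := by
  obtain ⟨hm, hs, ht, hsu, htu⟩ := 𝒢.mem_fullGroup_iff.1 hγ
  refine 𝒢.mem_fullGroup_iff.2 ⟨𝒢.measurableSet_setInv hm, ?_, ?_, ?_, ?_⟩
  · rintro _ ⟨g, hg, rfl⟩ _ ⟨h, hh, rfl⟩ e
    rw [𝒢.s_inv, 𝒢.s_inv] at e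
    rw [ht hg hh e]
  · rintro _ ⟨g, hg, rfl⟩ _ ⟨h, hh, rfl⟩ e
    rw [𝒢.t_inv, 𝒢.t_inv] at e
    rw [hs hg hh e]
  · refine Set.eq_univ_of_forall fun x => ?_
    obtain ⟨g, hg, rfl⟩ := htu.symm ▸ Set.mem_univ x
    exact ⟨_, ⟨g, hg, rfl⟩, 𝒢.s_inv g⟩
  · refine Set.eq_univ_of_forall fun x => ?_
    obtain ⟨g, hg, rfl⟩ := hsu.symm ▸ Set.mem_univ x
    exact ⟨_, ⟨g, hg, rfl⟩, 𝒢.t_inv g⟩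

/-- A partial bisection with equal source and target sets extends by units to an element of the
full group. -/
theorem union_units_mem_fullGroup {σ : Set G} (hm : MeasurableSet σ) (hs : Set.InjOn 𝒢.s σ)
    (ht : Set.InjOn 𝒢.t σ) (hst : 𝒢.s '' σ = 𝒢.t '' σ) :
    σ ∪ 𝒢.unit '' (𝒢.t '' σ)ᶜ ∈ 𝒢.fullGroup := by
  refine 𝒢.mem_fullGroup_iff.2 ⟨hm.union (𝒢.measurableEmbedding_unit.measurableSet_image.2
    (𝒢.measurableSet_image_t hm ht).compl), ?_, ?_, ?_, ?_⟩
  · rintro g (hg | ⟨x, hx, rfl⟩) h (hh | ⟨y, hy, rfl⟩) e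
    · exact hs hg hh e
    · rw [𝒢.s_unit] at e
      exact absurd (hst ▸ e ▸ Set.mem_image_of_mem 𝒢.s hg) hy
    · rw [𝒢.s_unit] at e
      exact absurd (hst ▸ e ▸ Set.mem_image_of_mem 𝒢.s hh) hx
    · rw [𝒢.s_unit, 𝒢.s_unit] at e
      rw [e]
  · rintro g (hg | ⟨x, hx, rfl⟩) h (hh | ⟨y, hy, rfl⟩) e
    · exact ht hg hh e
    · rw [𝒢.t_unit] at e
      exact absurd (e ▸ Set.mem_image_of_mem 𝒢.t hg) hy
    · rw [𝒢.t_unit] at e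
      exact absurd (e ▸ Set.mem_image_of_mem 𝒢.t hh) hx
    · rw [𝒢.t_unit, 𝒢.t_unit] at e
      rw [e]
  · refine Set.eq_univ_of_forall fun x => ?_
    by_cases hx : x ∈ 𝒢.t '' σ
    · rw [← hst] at hx
      exact Set.image_mono Set.subset_union_left hx
    · exact ⟨_, Or.inr ⟨x, hx, rfl⟩, 𝒢.s_unit x⟩
  · refine Set.eq_univ_of_forall fun x => ?_
    by_cases hx : x ∈ 𝒢.t '' σ
    · exact Set.image_mono Set.subset_union_left hx
    · exact ⟨_, Or.inr ⟨x, hx, rfl⟩, 𝒢.t_unit x⟩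

/-- A partial bisection with disjoint source and target sets extends to an involution in the full
group. -/
theorem union_setInv_union_units_mem_fullGroup {σ : Set G} (hm : MeasurableSet σ)
    (hs : Set.InjOn 𝒢.s σ) (ht : Set.InjOn 𝒢.t σ) (hd : ∀ g ∈ σ, ∀ h ∈ σ, 𝒢.s g ≠ 𝒢.t h) :
    (σ ∪ 𝒢.setInv σ) ∪ 𝒢.unit '' (𝒢.t '' (σ ∪ 𝒢.setInv σ))ᶜ ∈ 𝒢.fullGroup := by
  refine 𝒢.union_units_mem_fullGroup (hm.union (𝒢.measurableSet_setInv hm)) ?_ ?_ ?_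
  · rintro g (hg | ⟨g, hg, rfl⟩) h (hh | ⟨h, hh, rfl⟩) e
    · exact hs hg hh e
    · exact absurd (e.trans (𝒢.s_inv h)) (hd g hg h hh)
    · exact absurd (e.symm.trans (𝒢.s_inv g)) (hd h hh g hg)
    · rw [𝒢.s_inv, 𝒢.s_inv] at e
      rw [ht hg hh e]
  · rintro g (hg | ⟨g, hg, rfl⟩) h (hh | ⟨h, hh, rfl⟩) e
    · exact ht hg hh e
    · exact absurd ((𝒢.t_inv h).symm.trans e.symm) (hd h hh g hg)
    · exact absurd ((𝒢.t_inv g).symm.trans e) (hd g hg h hh)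
    · rw [𝒢.t_inv, 𝒢.t_inv] at e
      rw [hs hg hh e]
  · ext x
    constructor
    · rintro ⟨g, hg | ⟨g, hg, rfl⟩, rfl⟩
      · exact ⟨𝒢.inv g, Or.inr ⟨g, hg, rfl⟩, 𝒢.t_inv g⟩
      · exact ⟨g, Or.inl hg, (𝒢.s_inv g).symm⟩
    · rintro ⟨g, hg | ⟨g, hg, rfl⟩, rfl⟩
      · exact ⟨𝒢.inv g, Or.inr ⟨g, hg, rfl⟩, 𝒢.s_inv g⟩
      · exact ⟨g, Or.inl hg, (𝒢.t_inv g).symm⟩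

/-- Countably many elements of the full group cover the groupoid. -/
theorem exists_fullGroup_cover :
    ∃ γ : ℕ → Set G, (∀ n, γ n ∈ 𝒢.fullGroup) ∧ ∀ g, ∃ n, g ∈ γ n := by
  have := 𝒢.standardBorel
  have := 𝒢.standardBorel_units
  obtain ⟨B, hBm, hBi, -, hBu⟩ := exists_measurable_partition_injOn 𝒢.measurable_s 𝒢.countable_s
  obtain ⟨C, hCm, hCi, -, hCu⟩ := exists_measurable_partition_injOn 𝒢.measurable_t 𝒢.countable_t
  obtain ⟨D₀, hD₀m, hD₀⟩ :=
    exists_seq_separating X (p := MeasurableSet) MeasurableSet.empty Set.univ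
  -- A separating set tells the two ends of an arrow apart without saying which end it contains, so
  -- complements are included.
  let D : ℕ × Bool → Set X := fun k => cond k.2 (D₀ k.1) (D₀ k.1)ᶜ
  have hDm : ∀ k, MeasurableSet (D k) := by
    rintro ⟨k, _ | _⟩
    exacts [(hD₀m k).compl, hD₀m k]
  -- Isotropy pieces have equal source and target images and extend by units. On the other pieces
  -- source and target lie on opposite sides of `D k`, so adjoining inverses and units gives an
  -- involution.
  have key : ∀ i : ℕ × ℕ × Option (ℕ × Bool), ∃ γ ∈ 𝒢.fullGroup, B i.1 ∩ C i.2.1 ∩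
      {g | match i.2.2 with
        | none => 𝒢.s g = 𝒢.t g
        | some k => 𝒢.s g ∈ D k ∧ 𝒢.t g ∉ D k} ⊆ γ := by
    rintro ⟨n, m, k⟩
    have hs : Set.InjOn 𝒢.s (B n ∩ C m) := (hBi n).mono Set.inter_subset_left
    have ht : Set.InjOn 𝒢.t (B n ∩ C m) := (hCi m).mono Set.inter_subset_right
    rcases k with _ | k
    · refine ⟨_, 𝒢.union_units_mem_fullGroup (((hBm n).inter (hCm m)).inter
        (measurableSet_eq_fun 𝒢.measurable_s 𝒢.measurable_t))
        (hs.mono Set.inter_subset_left) (ht.mono Set.inter_subset_left) ?_,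
        Set.subset_union_left⟩
      exact Set.image_congr fun g hg => hg.2
    · refine ⟨_, 𝒢.union_setInv_union_units_mem_fullGroup (((hBm n).inter (hCm m)).inter
        ((𝒢.measurable_s (hDm k)).inter (𝒢.measurable_t (hDm k)).compl))
        (hs.mono Set.inter_subset_left) (ht.mono Set.inter_subset_left) ?_,
        Set.subset_union_left.trans Set.subset_union_left⟩
      intro g hg h hh e
      exact hh.2.2 (show 𝒢.t h ∈ D k from e ▸ hg.2.1)
  choose γ hγ hsub using key
  obtain ⟨e, he⟩ := exists_surjective_nat (ℕ × ℕ × Option (ℕ × Bool))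
  refine ⟨fun n => γ (e n), fun n => hγ _, fun g => ?_⟩
  obtain ⟨n, hn⟩ := Set.mem_iUnion.1 (hBu.symm ▸ Set.mem_univ g)
  obtain ⟨m, hm⟩ := Set.mem_iUnion.1 (hCu.symm ▸ Set.mem_univ g)
  have : ∃ k : Option (ℕ × Bool), match k with
        | none => 𝒢.s g = 𝒢.t g
        | some k => 𝒢.s g ∈ D k ∧ 𝒢.t g ∉ D k := by
    by_cases hg : 𝒢.s g = 𝒢.t g
    · exact ⟨none, hg⟩
    · by_contra! hcon
      refine hg (hD₀ _ trivial _ trivial fun k => ⟨fun h => ?_, fun h => ?_⟩)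
      · by_contra h'
        exact hcon (some (k, true)) ⟨h, h'⟩
      · by_contra h'
        exact hcon (some (k, false)) ⟨h', fun h'' => h'' h⟩
  obtain ⟨k, hk⟩ := this
  obtain ⟨j, hj⟩ := he (n, m, k)
  exact ⟨j, show g ∈ γ (e j) from hj ▸ hsub (n, m, k) ⟨⟨hn, hm⟩, hk⟩⟩

variable {γ : Set G} (hγ : γ ∈ 𝒢.fullGroup)

theorem fibreElt_eq {x : X} {g : G} (hg : g ∈ γ) (hx : 𝒢.t g = x) : 𝒢.fibreElt hγ x = g :=
  (𝒢.mem_fullGroup_iff.1 hγ).2.2.1 (𝒢.fibreElt_mem hγ x) hg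
    ((𝒢.eq_t_fibreElt hγ x).symm.trans hx.symm)

theorem t_fibreElt (x : X) : 𝒢.t (𝒢.fibreElt hγ x) = x := (𝒢.eq_t_fibreElt hγ x).symm

theorem measurable_fibreElt : Measurable (𝒢.fibreElt hγ) := by
  intro A hA
  obtain ⟨hm, -, ht, -, -⟩ := 𝒢.mem_fullGroup_iff.1 hγ
  have : 𝒢.fibreElt hγ ⁻¹' A = 𝒢.t '' (A ∩ γ) := by
    ext x
    constructor
    · exact fun h => ⟨_, ⟨h, 𝒢.fibreElt_mem hγ x⟩, 𝒢.t_fibreElt hγ x⟩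
    · rintro ⟨g, ⟨hg, hg'⟩, rfl⟩
      rw [Set.mem_preimage, 𝒢.fibreElt_eq hγ hg' rfl]
      exact hg
  rw [this]
  exact 𝒢.measurableSet_image_t (hA.inter hm) (ht.mono Set.inter_subset_right)

theorem measurable_translateUnit : Measurable (𝒢.translateUnit hγ) :=
  𝒢.measurable_s.comp (𝒢.measurable_fibreElt hγ)

theorem measurable_translate : Measurable (𝒢.translate hγ) :=
  𝒢.measurable_mul.comp (Measurable.subtype_mk
    (f := fun g : G => (g, 𝒢.fibreElt hγ (𝒢.s g))) (h := fun g => 𝒢.eq_t_fibreElt hγ (𝒢.s g))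
    (measurable_id.prodMk ((𝒢.measurable_fibreElt hγ).comp 𝒢.measurable_s)))

@[simp]
theorem t_translate (g : G) : 𝒢.t (𝒢.translate hγ g) = 𝒢.t g := 𝒢.t_mul _ _ _

@[simp]
theorem s_translate (g : G) : 𝒢.s (𝒢.translate hγ g) = 𝒢.translateUnit hγ (𝒢.s g) :=
  𝒢.s_mul _ _ _

theorem fibreElt_setInv (x : X) :
    𝒢.fibreElt (𝒢.setInv_mem_fullGroup hγ) (𝒢.translateUnit hγ x) =
      𝒢.inv (𝒢.fibreElt hγ x) :=
  𝒢.fibreElt_eq _ ⟨_, 𝒢.fibreElt_mem hγ x, rfl⟩ (𝒢.t_inv _)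

theorem translateUnit_setInv_translateUnit (x : X) :
    𝒢.translateUnit (𝒢.setInv_mem_fullGroup hγ) (𝒢.translateUnit hγ x) = x := by
  rw [translateUnit, fibreElt_setInv, 𝒢.s_inv, 𝒢.t_fibreElt]

theorem translate_setInv_translate (g : G) :
    𝒢.translate (𝒢.setInv_mem_fullGroup hγ) (𝒢.translate hγ g) = g := by
  refine 𝒢.mul_inv_cancel_right g _ _ _ ?_
  rw [s_translate, fibreElt_setInv]

theorem setInv_setInv : 𝒢.setInv (𝒢.setInv γ) = γ := by
  ext g
  rw [𝒢.mem_setInv, 𝒢.mem_setInv, 𝒢.inv_inv]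

theorem translate_translate_setInv (g : G) :
    𝒢.translate hγ (𝒢.translate (𝒢.setInv_mem_fullGroup hγ) g) = g := by
  have h := 𝒢.translate_setInv_translate (𝒢.setInv_mem_fullGroup hγ) g
  simp only [𝒢.setInv_setInv] at h
  exact h

theorem translate_range_unit (g : G) : 𝒢.translate 𝒢.range_unit_mem_fullGroup g = g := by
  have h : 𝒢.fibreElt 𝒢.range_unit_mem_fullGroup (𝒢.s g) = 𝒢.unit (𝒢.s g) :=
    𝒢.fibreElt_eq _ ⟨_, rfl⟩ (𝒢.t_unit _)
  rw [translate, 𝒢.mul_congr rfl h]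
  exact 𝒢.mul_unit g

end DiscreteBorelGroupoid

/-! ### Partitions into bisections and the measure on arrows -/

namespace DiscreteBorelGroupoid

variable {X G : Type*} [MeasurableSpace X] [MeasurableSpace G]

/-- A Borel partition of a groupoid into countably many pieces, each contained in a given element
of the full group. -/
structure FullGroupPartition (𝒢 : DiscreteBorelGroupoid X G) where
  /-- elements of the full group -/
  elem : ℕ → Set G
  elem_mem : ∀ n, elem n ∈ 𝒢.fullGroup
  /-- the pieces -/
  piece : ℕ → Set G
  measurableSet_piece : ∀ n, MeasurableSet (piece n)
  piece_subset : ∀ n, piece n ⊆ elem n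
  existsUnique_mem : ∀ g, ∃! n, g ∈ piece n

theorem nonempty_fullGroupPartition (𝒢 : DiscreteBorelGroupoid X G) :
    Nonempty (FullGroupPartition 𝒢) := by
  obtain ⟨γ, hγ, hcov⟩ := 𝒢.exists_fullGroup_cover
  refine ⟨⟨γ, hγ, disjointed γ,
    fun n => MeasurableSet.disjointed (fun n => (𝒢.mem_fullGroup_iff.1 (hγ n)).1) n,
    disjointed_subset γ, fun g => ?_⟩⟩
  have : g ∈ ⋃ n, disjointed γ n := by
    rw [iUnion_disjointed]
    exact Set.mem_iUnion.2 (hcov g)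
  obtain ⟨n, hn⟩ := Set.mem_iUnion.1 this
  refine ⟨n, hn, fun m hm => ?_⟩
  by_contra hne
  exact Set.disjoint_left.1 (disjoint_disjointed γ hne) hm hn

namespace FullGroupPartition

variable {𝒢 : DiscreteBorelGroupoid X G} (p : FullGroupPartition 𝒢)

/-- The partition into the inverses of the pieces. -/
def inv : FullGroupPartition 𝒢 where
  elem n := 𝒢.setInv (p.elem n)
  elem_mem n := 𝒢.setInv_mem_fullGroup (p.elem_mem n)
  piece n := 𝒢.setInv (p.piece n)
  measurableSet_piece n := 𝒢.measurableSet_setInv (p.measurableSet_piece n)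
  piece_subset n := Set.image_mono (p.piece_subset n)
  existsUnique_mem g := by
    simp only [𝒢.mem_setInv]
    exact p.existsUnique_mem (𝒢.inv g)

/-- The units `x` for which the element of `p.elem n` with target `x` lies in `p.piece n`. -/
def dom (n : ℕ) : Set X := 𝒢.fibreElt (p.elem_mem n) ⁻¹' p.piece n

theorem measurableSet_dom (n : ℕ) : MeasurableSet (p.dom n) :=
  𝒢.measurable_fibreElt (p.elem_mem n) (p.measurableSet_piece n)

/-- The elements of a target fibre correspond to the pieces that meet it. -/
noncomputable def fibreEquiv (x : X) : {n // x ∈ p.dom n} ≃ {h : G // x = 𝒢.t h} :=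
  Equiv.ofBijective (fun n => ⟨𝒢.fibreElt (p.elem_mem n) x, 𝒢.eq_t_fibreElt _ x⟩) <| by
    constructor
    · rintro ⟨n, hn⟩ ⟨m, hm⟩ h
      have h' : 𝒢.fibreElt (p.elem_mem n) x = 𝒢.fibreElt (p.elem_mem m) x :=
        congrArg Subtype.val h
      refine Subtype.ext ((p.existsUnique_mem (𝒢.fibreElt (p.elem_mem n) x)).unique hn ?_)
      rw [h']
      exact hm
    · rintro ⟨h, rfl⟩
      obtain ⟨n, hn, -⟩ := p.existsUnique_mem h
      have he := 𝒢.fibreElt_eq (p.elem_mem n) (p.piece_subset n hn) rfl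
      refine ⟨⟨n, ?_⟩, Subtype.ext he⟩
      rw [dom, Set.mem_preimage, he]
      exact hn

theorem hasSum_fibre_iff' {M : Type*} [AddCommMonoid M] [TopologicalSpace M] (x : X)
    (F : {h : G // x = 𝒢.t h} → M) (a : M) : HasSum F a ↔
      HasSum (fun n => (p.dom n).indicator
        (fun _ => F ⟨𝒢.fibreElt (p.elem_mem n) x, 𝒢.eq_t_fibreElt _ x⟩) x) a := by
  rw [← (p.fibreEquiv x).hasSum_iff]
  have h : (fun n => (p.dom n).indicator
        (fun _ => F ⟨𝒢.fibreElt (p.elem_mem n) x, 𝒢.eq_t_fibreElt _ x⟩) x) =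
      Set.indicator {n | x ∈ p.dom n}
        (fun n => F ⟨𝒢.fibreElt (p.elem_mem n) x, 𝒢.eq_t_fibreElt _ x⟩) := by
    classical
    ext n
    simp only [Set.indicator_apply, Set.mem_ofPred_eq]
  rw [h]
  exact hasSum_subtype_iff_indicator
    (f := fun n => F ⟨𝒢.fibreElt (p.elem_mem n) x, 𝒢.eq_t_fibreElt _ x⟩) (s := {n | x ∈ p.dom n})

theorem hasSum_fibre_iff {M : Type*} [AddCommMonoid M] [TopologicalSpace M] (F : G → M) (x : X)
    (a : M) : HasSum (fun h : {h : G // x = 𝒢.t h} => F h) a ↔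
      HasSum (fun n => (p.dom n).indicator (fun x => F (𝒢.fibreElt (p.elem_mem n) x)) x) a :=
  p.hasSum_fibre_iff' x (fun h => F h) a

/-- The right side is a countable sum of Borel functions of `x`; this makes the fibre counting
measures a measurable family. -/
theorem count_fibre (x : X) {A : Set G} (hA : MeasurableSet A) :
    Measure.count.restrict (𝒢.t ⁻¹' {x}) A =
      ∑' n, (p.dom n).indicator (fun x => A.indicator 1 (𝒢.fibreElt (p.elem_mem n) x)) x := by
  have := 𝒢.standardBorel
  have h := ((p.hasSum_fibre_iff (A.indicator (1 : G → ℝ≥0∞)) x _).1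
    ENNReal.summable.hasSum).tsum_eq
  rw [h, Measure.restrict_apply hA, ← lintegral_indicator_one
    (hA.inter ((𝒢.countable_t x).measurableSet)), lintegral_count, Set.inter_comm,
    ← Set.indicator_indicator, ← tsum_subtype]
  exact (Equiv.subtypeEquivRight (p := fun h => h ∈ 𝒢.t ⁻¹' {x}) (q := fun h => x = 𝒢.t h)
    fun h => eq_comm).tsum_eq (fun h : {h : G // x = 𝒢.t h} => A.indicator (1 : G → ℝ≥0∞) h)

end FullGroupPartition

variable (𝒢 : DiscreteBorelGroupoid X G) (μ : Measure X)

theorem measurable_count_target_fibre :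
    Measurable fun x => (Measure.count : Measure G).restrict (𝒢.t ⁻¹' {x}) := by
  obtain ⟨p⟩ := 𝒢.nonempty_fullGroupPartition
  refine Measure.measurable_of_measurable_coe _ fun A hA => ?_
  simp_rw [p.count_fibre _ hA]
  refine Measurable.tsum fun n => Measurable.indicator ?_ (p.measurableSet_dom n)
  exact (measurable_one.indicator hA).comp (𝒢.measurable_fibreElt _)

theorem targetMeasure_apply {A : Set G} (hA : MeasurableSet A) :
    𝒢.targetMeasure μ A = ∫⁻ x, Measure.count (A ∩ 𝒢.t ⁻¹' {x}) ∂μ := by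
  rw [targetMeasure, Measure.bind_apply hA 𝒢.measurable_count_target_fibre.aemeasurable]
  simp_rw [Measure.restrict_apply hA]

/-- Inversion is a bijection between the target fibre and the source fibre of each unit. Being
p.m.p. thus means that inversion preserves `μ_t`. -/
theorem sourceMeasure_eq_map : 𝒢.sourceMeasure μ = (𝒢.targetMeasure μ).map 𝒢.inv := by
  have := 𝒢.standardBorel
  have hinv : Function.Bijective 𝒢.inv :=
    ⟨𝒢.inv_injective, fun g => ⟨_, 𝒢.inv_inv g⟩⟩
  have h : (fun x => (Measure.count : Measure G).restrict (𝒢.s ⁻¹' {x})) =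
      fun x => ((Measure.count : Measure G).restrict (𝒢.t ⁻¹' {x})).map 𝒢.inv := by
    ext x A hA
    rw [Measure.map_apply 𝒢.measurable_inv hA, Measure.restrict_apply hA,
      Measure.restrict_apply (𝒢.measurable_inv hA)]
    have he : 𝒢.inv ⁻¹' A ∩ 𝒢.t ⁻¹' {x} = 𝒢.inv ⁻¹' (A ∩ 𝒢.s ⁻¹' {x}) := by
      ext g
      simp [𝒢.s_inv]
    have hm := hA.inter (𝒢.countable_s x).measurableSet
    rw [he, Measure.count_apply hm, Measure.count_apply (𝒢.measurable_inv hm),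
      Set.encard_preimage_of_bijective hinv]
  have hm : Measurable fun x =>
      ((Measure.count : Measure G).restrict (𝒢.t ⁻¹' {x})).map 𝒢.inv :=
    (Measure.measurable_map _ 𝒢.measurable_inv).comp 𝒢.measurable_count_target_fibre
  ext A hA
  rw [sourceMeasure, h, Measure.bind_apply hA hm.aemeasurable,
    Measure.map_apply 𝒢.measurable_inv hA, targetMeasure,
    Measure.bind_apply (𝒢.measurable_inv hA) 𝒢.measurable_count_target_fibre.aemeasurable]
  exact lintegral_congr fun x => Measure.map_apply 𝒢.measurable_inv hA

theorem isPMP_iff : 𝒢.IsPMP μ ↔ IsProbabilityMeasure μ ∧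
    MeasurePreserving 𝒢.inv (𝒢.targetMeasure μ) (𝒢.targetMeasure μ) := by
  constructor
  · exact fun h => ⟨h.1, 𝒢.measurable_inv, by rw [← sourceMeasure_eq_map, h.2]⟩
  · exact fun h => ⟨h.1, by rw [sourceMeasure_eq_map, h.2.map_eq]⟩

variable {𝒢 μ}

theorem IsPMP.measurePreserving_inv (hμ : 𝒢.IsPMP μ) :
    MeasurePreserving 𝒢.inv (𝒢.targetMeasure μ) (𝒢.targetMeasure μ) :=
  ((𝒢.isPMP_iff μ).1 hμ).2

variable (𝒢 μ)

/-- Since `γ` has exactly one arrow over each target, the fibre count of `γ ∩ A` is the indicator of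
a set of units. -/
theorem targetMeasure_fullGroup_inter {γ : Set G} (hγ : γ ∈ 𝒢.fullGroup) {A : Set G}
    (hA : MeasurableSet A) :
    𝒢.targetMeasure μ (γ ∩ A) = μ (𝒢.fibreElt hγ ⁻¹' A) := by
  have := 𝒢.standardBorel
  have hm := (𝒢.mem_fullGroup_iff.1 hγ).1
  rw [targetMeasure_apply _ _ (hm.inter hA), ← lintegral_indicator_one
    (𝒢.measurable_fibreElt hγ hA)]
  refine lintegral_congr fun x => ?_
  by_cases hx : 𝒢.fibreElt hγ x ∈ A
  · have : γ ∩ A ∩ 𝒢.t ⁻¹' {x} = {𝒢.fibreElt hγ x} := by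
      ext g
      constructor
      · rintro ⟨⟨hg, -⟩, hgx⟩
        exact (𝒢.fibreElt_eq hγ hg hgx).symm
      · rintro rfl
        exact ⟨⟨𝒢.fibreElt_mem hγ x, hx⟩, 𝒢.t_fibreElt hγ x⟩
    rw [this, Measure.count_singleton, Set.indicator_of_mem (by exact hx)]
    rfl
  · have : γ ∩ A ∩ 𝒢.t ⁻¹' {x} = ∅ := by
      ext g
      simp only [Set.mem_inter_iff, Set.mem_preimage, Set.mem_singleton_iff, Set.mem_empty_iff_false,
        iff_false]
      rintro ⟨⟨hg, hgA⟩, hgx⟩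
      exact hx (𝒢.fibreElt_eq hγ hg hgx ▸ hgA)
    rw [this, measure_empty, Set.indicator_of_notMem (by exact hx)]

theorem sigmaFinite_targetMeasure [IsFiniteMeasure μ] : SigmaFinite (𝒢.targetMeasure μ) := by
  obtain ⟨γ, hγ, hcov⟩ := 𝒢.exists_fullGroup_cover
  refine ⟨⟨⟨γ, fun _ => trivial, fun n => ?_, Set.eq_univ_of_forall fun g =>
    Set.mem_iUnion.2 (hcov g)⟩⟩⟩
  rw [← Set.inter_univ (γ n), targetMeasure_fullGroup_inter _ _ (hγ n) MeasurableSet.univ]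
  exact measure_lt_top _ _

/-- Right translation permutes every target fibre and so preserves its counting measure, whatever
`μ` is. -/
theorem measurePreserving_translate {γ : Set G} (hγ : γ ∈ 𝒢.fullGroup) :
    MeasurePreserving (𝒢.translate hγ) (𝒢.targetMeasure μ) (𝒢.targetMeasure μ) := by
  have := 𝒢.standardBorel
  refine ⟨𝒢.measurable_translate hγ, ?_⟩
  have hbij : Function.Bijective (𝒢.translate hγ) :=
    Function.bijective_iff_has_inverse.2 ⟨𝒢.translate (𝒢.setInv_mem_fullGroup hγ),
      𝒢.translate_setInv_translate hγ, 𝒢.translate_translate_setInv hγ⟩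
  ext A hA
  rw [Measure.map_apply (𝒢.measurable_translate hγ) hA, targetMeasure_apply _ _ hA,
    targetMeasure_apply _ _ (𝒢.measurable_translate hγ hA)]
  refine lintegral_congr fun x => ?_
  have he : 𝒢.translate hγ ⁻¹' A ∩ 𝒢.t ⁻¹' {x} = 𝒢.translate hγ ⁻¹' (A ∩ 𝒢.t ⁻¹' {x}) := by
    ext g
    simp
  have hm := hA.inter (𝒢.countable_t x).measurableSet
  rw [he, Measure.count_apply hm, Measure.count_apply (𝒢.measurable_translate hγ hm),
    Set.encard_preimage_of_bijective hbij]

variable {μ}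

/-- A property of almost every arrow holds on the whole of almost every target fibre. -/
theorem ae_target_fibre {Q : G → Prop} (h : ∀ᵐ g ∂(𝒢.targetMeasure μ), Q g) :
    ∀ᵐ x ∂μ, ∀ g, 𝒢.t g = x → Q g := by
  have := 𝒢.standardBorel
  obtain ⟨N, hsub, hN, hN0⟩ := exists_measurable_superset_of_null (ae_iff.1 h)
  rw [targetMeasure, Measure.bind_apply hN 𝒢.measurable_count_target_fibre.aemeasurable] at hN0
  filter_upwards [(lintegral_eq_zero_iff ((Measure.measurable_coe hN).comp
    𝒢.measurable_count_target_fibre)).1 hN0] with x hx g hg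
  by_contra hQ
  simp only [Function.comp_apply, Pi.zero_apply, Measure.restrict_apply hN] at hx
  rw [Measure.count_eq_zero_iff] at hx
  exact (hx ▸ (⟨hsub hQ, hg⟩ : g ∈ N ∩ 𝒢.t ⁻¹' {x}) : g ∈ (∅ : Set G))

variable (μ)

theorem quasiMeasurePreserving_t :
    Measure.QuasiMeasurePreserving 𝒢.t (𝒢.targetMeasure μ) μ := by
  refine ⟨𝒢.measurable_t, Measure.AbsolutelyContinuous.mk fun A hA h0 => ?_⟩
  rw [Measure.map_apply 𝒢.measurable_t hA, targetMeasure_apply _ _ (𝒢.measurable_t hA)]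
  refine (lintegral_congr_ae (g := 0) ?_).trans lintegral_zero
  filter_upwards [measure_eq_zero_iff_ae_notMem.1 h0] with x hx
  have : 𝒢.t ⁻¹' A ∩ 𝒢.t ⁻¹' {x} = ∅ := by
    ext g
    simp only [Set.mem_inter_iff, Set.mem_preimage, Set.mem_singleton_iff, Set.mem_empty_iff_false,
      iff_false, not_and]
    rintro hg rfl
    exact hx hg
  rw [this, measure_empty]
  rfl

variable {𝒢 μ}

theorem IsPMP.quasiMeasurePreserving_s (hμ : 𝒢.IsPMP μ) :
    Measure.QuasiMeasurePreserving 𝒢.s (𝒢.targetMeasure μ) μ := by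
  have h : 𝒢.s = 𝒢.t ∘ 𝒢.inv := funext fun g => (𝒢.t_inv g).symm
  rw [h]
  exact (𝒢.quasiMeasurePreserving_t μ).comp hμ.measurePreserving_inv.quasiMeasurePreserving

/-- A property of the source of almost every arrow holds at almost every unit. -/
theorem ae_of_ae_source {Q : X → Prop} (h : ∀ᵐ g ∂(𝒢.targetMeasure μ), Q (𝒢.s g)) :
    ∀ᵐ x ∂μ, Q x := by
  filter_upwards [𝒢.ae_target_fibre h] with x hx
  simpa [𝒢.s_unit] using hx (𝒢.unit x) (𝒢.t_unit x)

/-- Invariance under inversion enters here: the two measures of sets of units are the `μ_t`-measures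
of `γ ∩ s⁻¹(A)` and of its inverse `γ⁻¹ ∩ t⁻¹(A)`. -/
theorem IsPMP.measurePreserving_translateUnit (hμ : 𝒢.IsPMP μ) {γ : Set G}
    (hγ : γ ∈ 𝒢.fullGroup) : MeasurePreserving (𝒢.translateUnit hγ) μ μ := by
  refine ⟨𝒢.measurable_translateUnit hγ, ?_⟩
  ext A hA
  rw [Measure.map_apply (𝒢.measurable_translateUnit hγ) hA]
  have h1 := 𝒢.targetMeasure_fullGroup_inter μ hγ (𝒢.measurable_s hA)
  have h2 := 𝒢.targetMeasure_fullGroup_inter μ (𝒢.setInv_mem_fullGroup hγ) (𝒢.measurable_t hA)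
  have h3 := hμ.measurePreserving_inv.measure_preimage
    ((𝒢.mem_fullGroup_iff.1 hγ).1.inter (𝒢.measurable_s hA)).nullMeasurableSet
  have h4 : 𝒢.inv ⁻¹' (γ ∩ 𝒢.s ⁻¹' A) = 𝒢.setInv γ ∩ 𝒢.t ⁻¹' A := by
    ext g
    simp [𝒢.mem_setInv, 𝒢.s_inv]
  rw [h4, h2, h1] at h3
  rw [show 𝒢.translateUnit hγ ⁻¹' A = 𝒢.fibreElt hγ ⁻¹' (𝒢.s ⁻¹' A) from rfl, ← h3]
  congr 1
  ext x
  simp [𝒢.t_fibreElt]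

end DiscreteBorelGroupoid

/-! ### Duality of L¹ and L^∞ -/

section DualL1

open Filter Topology

variable {Ω : Type*} [MeasurableSpace Ω] {ν : Measure Ω}

/-- The dual of `L¹` of a `σ`-finite measure is `L^∞`. -/
theorem exists_bounded_integral_representation [SigmaFinite ν] (ℓ : Lp ℝ 1 ν →L[ℝ] ℝ) :
    ∃ φ : Ω → ℝ, Measurable φ ∧ (∀ x, |φ x| ≤ ‖ℓ‖) ∧ ∀ f : Lp ℝ 1 ν, ℓ f = ∫ x, φ x * f x ∂ν := by
  -- A positive integrable weight `w = v²` reduces the claim to Hilbert space: multiplication by `v`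
  -- maps L² into L¹, and the Riesz vector `k` of the pulled back functional gives the density `k /
  -- v`.
  obtain ⟨w, hwpos, hwm, hwint⟩ := exists_pos_lintegral_lt_of_sigmaFinite ν one_ne_zero
  let v : Ω → ℝ := fun x => Real.sqrt (w x)
  have hvpos : ∀ x, 0 < v x := fun x => Real.sqrt_pos.2 (hwpos x)
  have hvm : Measurable v := hwm.coe_nnreal_real.sqrt
  have hvv : ∀ x, v x * v x = w x := fun x => Real.mul_self_sqrt (w x).2
  have hwi : Integrable (fun x => (w x : ℝ)) ν := by
    refine ⟨hwm.coe_nnreal_real.aestronglyMeasurable, ?_⟩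
    rw [hasFiniteIntegral_iff_enorm]
    simpa using hwint.trans ENNReal.one_lt_top
  have hv2 : MemLp v 2 ν := by
    rw [memLp_two_iff_integrable_sq hvm.aestronglyMeasurable]
    refine hwi.congr (ae_of_all _ fun x => ?_)
    exact (hvv x).symm.trans (pow_two _).symm
  let J : Lp ℝ 2 ν →L[ℝ] Lp ℝ 1 ν := (ContinuousLinearMap.mul ℝ ℝ).holderL ν 2 2 1 hv2.toLp
  have hJ : ∀ u, J u =ᵐ[ν] fun x => v x * u x := fun u => by
    filter_upwards [(ContinuousLinearMap.mul ℝ ℝ).coeFn_holder (r := 1) hv2.toLp u,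
      hv2.coeFn_toLp] with x h1 h2
    rw [← h2]
    exact h1
  obtain ⟨k, hk⟩ := (InnerProductSpace.toDual ℝ (Lp ℝ 2 ν)).surjective (ℓ.comp J)
  have hk' : ∀ u, ℓ (J u) = ∫ x, k x * u x ∂ν := fun u => by
    have h : (ℓ.comp J) u = inner ℝ k u := by
      rw [← hk]
      exact InnerProductSpace.toDual_apply_apply ..
    rw [← ContinuousLinearMap.comp_apply, h, L2.inner_def]
    exact integral_congr_ae (ae_of_all _ fun x => by simp [mul_comm])
  have hkey : ∀ (F : Ω → ℝ) (hF : Integrable F ν), MemLp (fun x => F x / v x) 2 ν →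
      ℓ (hF.toL1 F) = ∫ x, k x / v x * F x ∂ν := by
    intro F hF hu
    have h : hF.toL1 F = J hu.toLp := by
      refine Lp.ext ?_
      filter_upwards [hF.coeFn_toL1, hJ hu.toLp, hu.coeFn_toLp] with x h1 h2 h3
      rw [h1, h2, h3, mul_div_cancel₀ _ (hvpos x).ne']
    rw [h, hk']
    refine integral_congr_ae ?_
    filter_upwards [hu.coeFn_toLp] with x hx
    rw [hx]
    ring
  have hkv : Integrable (fun x => k x * v x) ν := (Lp.memLp k).integrable_mul hv2
  -- Testing on `w` times indicators yields `|k v| ≤ ‖ℓ‖ v²` almost everywhere, that is, the bound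
  -- on `k / v`.
  have hset : ∀ A, MeasurableSet A → |∫ x in A, k x * v x ∂ν| ≤ ‖ℓ‖ * ∫ x in A, (w x : ℝ) ∂ν := by
    intro A hA
    have hF : Integrable (A.indicator fun x => (w x : ℝ)) ν := hwi.indicator hA
    have hu : MemLp (fun x => A.indicator (fun x => (w x : ℝ)) x / v x) 2 ν := by
      refine (hv2.indicator hA).congr_norm
        (((hwm.coe_nnreal_real.indicator hA).div hvm).aestronglyMeasurable)
        (ae_of_all _ fun x => ?_)
      by_cases hx : x ∈ A
      · simp only [Set.indicator_of_mem hx, ← hvv x, mul_div_cancel_right₀ _ (hvpos x).ne']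
      · simp [Set.indicator_of_notMem hx]
    have h1 := hkey _ hF hu
    have h2 : ∫ x, k x / v x * A.indicator (fun x => (w x : ℝ)) x ∂ν =
        ∫ x in A, k x * v x ∂ν := by
      rw [← integral_indicator hA]
      refine integral_congr_ae (ae_of_all _ fun x => ?_)
      by_cases hx : x ∈ A
      · simp only [Set.indicator_of_mem hx, ← hvv x]
        field_simp [(hvpos x).ne']
      · simp [Set.indicator_of_notMem hx]
    rw [← h2, ← h1, ← Real.norm_eq_abs]
    refine (ℓ.le_opNorm _).trans (le_of_eq ?_)
    rw [L1.norm_of_fun_eq_integral_norm, ← integral_indicator hA]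
    congr 1
    refine integral_congr_ae (ae_of_all _ fun x => ?_)
    exact Real.norm_of_nonneg (Set.indicator_nonneg (fun x _ => (w x).2) x)
  have hbound : ∀ᵐ x ∂ν, |k x / v x| ≤ ‖ℓ‖ := by
    have h1 := ae_nonneg_of_forall_setIntegral_nonneg ((hwi.const_mul ‖ℓ‖).sub hkv)
      fun A hA _ => by
        simp only [Pi.sub_apply]
        rw [integral_sub (hwi.const_mul _).integrableOn hkv.integrableOn, integral_const_mul]
        linarith [(abs_le.1 (hset A hA)).2]
    have h2 := ae_nonneg_of_forall_setIntegral_nonneg ((hwi.const_mul ‖ℓ‖).add hkv)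
      fun A hA _ => by
        simp only [Pi.add_apply]
        rw [integral_add (hwi.const_mul _).integrableOn hkv.integrableOn, integral_const_mul]
        linarith [(abs_le.1 (hset A hA)).1]
    filter_upwards [h1, h2] with x hx1 hx2
    simp only [Pi.sub_apply, Pi.add_apply, Pi.zero_apply, ← hvv x] at hx1 hx2
    rw [abs_le, le_div_iff₀ (hvpos x), div_le_iff₀ (hvpos x)]
    have := hvpos x
    constructor <;> nlinarith
  -- Truncation turns the almost everywhere bound into one that holds everywhere.
  let φ : Ω → ℝ := fun x => max (-‖ℓ‖) (min ‖ℓ‖ (k x / v x))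
  have hφm : Measurable φ := measurable_const.max
    (measurable_const.min ((Lp.stronglyMeasurable k).measurable.div hvm))
  have hφb : ∀ x, |φ x| ≤ ‖ℓ‖ := fun x =>
    abs_le.2 ⟨le_max_left _ _, max_le (by linarith [norm_nonneg ℓ]) (min_le_left _ _)⟩
  have hφe : ∀ᵐ x ∂ν, k x / v x = φ x := by
    filter_upwards [hbound] with x hx
    rw [abs_le] at hx
    simp only [φ, min_eq_right hx.2, max_eq_right hx.1]
  refine ⟨φ, hφm, hφb, fun f => ?_⟩
  -- On `A n` the quotient `f / v` is bounded by `n v`, hence lies in L², where the density is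
  -- already known; these cut-offs of `f` converge to it in L¹.
  let A : ℕ → Set Ω := fun n => {x | |f x| ≤ n * w x}
  have hfm : Measurable f := (Lp.stronglyMeasurable f).measurable
  have hA : ∀ n, MeasurableSet (A n) := fun n =>
    measurableSet_le hfm.norm (hwm.coe_nnreal_real.const_mul _)
  have hfi : Integrable f ν := L1.integrable_coeFn f
  have hφf : Integrable (fun x => φ x * f x) ν :=
    hfi.bdd_mul hφm.aestronglyMeasurable (ae_of_all _ hφb)
  have hAi : ∀ n, Integrable ((A n).indicator f) ν := fun n => hfi.indicator (hA n)
  have hev : ∀ x, ∀ᶠ n : ℕ in atTop, x ∈ A n := fun x => by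
    obtain ⟨n, hn⟩ := exists_nat_ge (|f x| / w x)
    filter_upwards [eventually_ge_atTop n] with m hm
    rw [div_le_iff₀ (NNReal.coe_pos.2 (hwpos x))] at hn
    exact hn.trans (mul_le_mul_of_nonneg_right (Nat.cast_le.2 hm) (w x).2)
  have happrox : ∀ n, ℓ ((hAi n).toL1 _) = ∫ x, (A n).indicator (fun x => φ x * f x) x ∂ν := by
    intro n
    rw [hkey _ (hAi n)]
    · refine integral_congr_ae ?_
      filter_upwards [hφe] with x hx
      rw [hx]
      by_cases hxA : x ∈ A n
      · simp [Set.indicator_of_mem hxA]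
      · simp [Set.indicator_of_notMem hxA]
    · refine (hv2.const_mul (n : ℝ)).mono ((hfm.indicator (hA n)).div hvm).aestronglyMeasurable
        (ae_of_all _ fun x => ?_)
      by_cases hxA : x ∈ A n
      · rw [Set.indicator_of_mem hxA, norm_div, Real.norm_of_nonneg (hvpos x).le,
          div_le_iff₀ (hvpos x), norm_mul, Real.norm_of_nonneg (hvpos x).le, mul_assoc, hvv,
          Real.norm_of_nonneg (Nat.cast_nonneg n)]
        exact hxA
      · rw [Set.indicator_of_notMem hxA, zero_div, norm_zero]
        exact norm_nonneg _
  have hlim1 : Tendsto (fun n => ∫ x, (A n).indicator (fun x => φ x * f x) x ∂ν) atTop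
      (𝓝 (∫ x, φ x * f x ∂ν)) := by
    refine tendsto_integral_of_dominated_convergence (fun x => ‖φ x * f x‖)
      (fun n => (hφf.indicator (hA n)).aestronglyMeasurable) hφf.norm
      (fun n => ae_of_all _ fun x => norm_indicator_le_norm_self _ _) (ae_of_all _ fun x => ?_)
    exact tendsto_const_nhds.congr' ((hev x).mono fun n hn => (Set.indicator_of_mem hn _).symm)
  have hlim2 : Tendsto (fun n => (hAi n).toL1 _) atTop (𝓝 f) := by
    rw [tendsto_iff_norm_sub_tendsto_zero]
    have h : ∀ n, ‖(hAi n).toL1 _ - f‖ = ∫ x, (A n)ᶜ.indicator (fun x => ‖f x‖) x ∂ν := by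
      intro n
      rw [L1.norm_eq_integral_norm]
      refine integral_congr_ae ?_
      filter_upwards [Lp.coeFn_sub ((hAi n).toL1 _) f, (hAi n).coeFn_toL1] with x h1 h2
      rw [h1, Pi.sub_apply, h2]
      by_cases hxA : x ∈ A n
      · simp [hxA]
      · simp [hxA]
    simp_rw [h]
    rw [← integral_zero Ω ℝ (μ := ν)]
    refine tendsto_integral_of_dominated_convergence (fun x => ‖f x‖)
      (fun n => (hfi.norm.indicator (hA n).compl).aestronglyMeasurable) hfi.norm
      (fun n => ae_of_all _ fun x => ?_) (ae_of_all _ fun x => ?_)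
    · exact (norm_indicator_le_norm_self _ _).trans (le_of_eq (norm_norm _))
    · exact tendsto_const_nhds.congr' ((hev x).mono fun n hn =>
        (Set.indicator_of_notMem (Set.notMem_compl_iff.2 hn) _).symm)
  exact tendsto_nhds_unique ((ℓ.continuous.tendsto f).comp hlim2)
    (hlim1.congr fun n => (happrox n).symm)

end DualL1

/-! ### The Markov operator is a well-defined contraction -/

theorem ENNReal.sq_tsum_mul_le {a : ℕ → ℝ≥0∞} (ha : ∑' n, a n = 1) (b : ℕ → ℝ≥0∞) :
    (∑' n, a n * b n) ^ 2 ≤ ∑' n, a n * b n ^ 2 := by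
  -- The weights define a probability measure on ℕ, and the claim is Hölder's inequality against the
  -- constant 1.
  let κ : Measure ℕ := Measure.sum fun n => a n • Measure.dirac n
  have hκ : ∀ f : ℕ → ℝ≥0∞, ∫⁻ n, f n ∂κ = ∑' n, a n * f n := fun f => by
    simp [κ, lintegral_sum_measure, lintegral_smul_measure]
  have h := ENNReal.lintegral_mul_le_Lp_mul_Lq κ (p := 2) (q := 2)
    Real.HolderConjugate.two_two (f := b) (g := 1) (by fun_prop) (by fun_prop)
  simp only [mul_one, Pi.mul_apply, Pi.one_apply, hκ, ENNReal.one_rpow, ha] at h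
  calc (∑' n, a n * b n) ^ 2
      ≤ ((∑' n, a n * b n ^ (2 : ℝ)) ^ (1 / 2 : ℝ)) ^ 2 := by gcongr
    _ = ∑' n, a n * b n ^ 2 := by
      rw [← ENNReal.rpow_natCast, ← ENNReal.rpow_mul]
      norm_num

theorem eLpNorm_two_sq {Ω E : Type*} [MeasurableSpace Ω] [NormedAddCommGroup E] (ν : Measure Ω)
    (f : Ω → E) : eLpNorm f 2 ν ^ 2 = ∫⁻ x, ‖f x‖ₑ ^ 2 ∂ν := by
  rw [eLpNorm_eq_lintegral_rpow_enorm_toReal two_ne_zero ENNReal.ofNat_ne_top,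
    ← ENNReal.rpow_natCast, ← ENNReal.rpow_mul]
  norm_num

namespace DiscreteBorelGroupoid

variable {X G : Type*} [MeasurableSpace X] [MeasurableSpace G] {𝒢 : DiscreteBorelGroupoid X G}
  {μ : Measure X} {π : G → ℂ}

theorem fibreElt_translateUnit_setInv {γ : Set G} (hγ : γ ∈ 𝒢.fullGroup) (y : X) :
    𝒢.fibreElt hγ (𝒢.translateUnit (𝒢.setInv_mem_fullGroup hγ) y) =
      𝒢.inv (𝒢.fibreElt (𝒢.setInv_mem_fullGroup hγ) y) :=
  𝒢.fibreElt_eq hγ (𝒢.mem_setInv.1 (𝒢.fibreElt_mem (𝒢.setInv_mem_fullGroup hγ) y)) (𝒢.t_inv _)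

namespace FullGroupPartition

variable (p : FullGroupPartition 𝒢)

/-- The value of `π` at the arrow of `p.piece n` with target `x`, or `0` if there is none. -/
noncomputable def weight (π : G → ℂ) (n : ℕ) (x : X) : ℂ :=
  (p.dom n).indicator (fun x => π (𝒢.fibreElt (p.elem_mem n) x)) x

theorem measurable_weight (hπ : Measurable π) (n : ℕ) : Measurable (p.weight π n) :=
  (hπ.comp (𝒢.measurable_fibreElt _)).indicator (p.measurableSet_dom n)

theorem hasSum_mul_iff (ξ : G → ℂ) (g : G) (a : ℂ) :
    HasSum (fun h : {h : G // 𝒢.s g = 𝒢.t h} => ξ (𝒢.mul g h.1 h.2) * π h.1) a ↔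
      HasSum (fun n => p.weight π n (𝒢.s g) * ξ (𝒢.translate (p.elem_mem n) g)) a := by
  rw [p.hasSum_fibre_iff']
  have : (fun n => (p.dom n).indicator (fun _ => ξ (𝒢.mul g (𝒢.fibreElt (p.elem_mem n) (𝒢.s g))
      (𝒢.eq_t_fibreElt _ _)) * π (𝒢.fibreElt (p.elem_mem n) (𝒢.s g))) (𝒢.s g)) =
      fun n => p.weight π n (𝒢.s g) * ξ (𝒢.translate (p.elem_mem n) g) := by
    ext n
    by_cases h : 𝒢.s g ∈ p.dom n
    · simp [weight, h, translate, mul_comm]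
    · simp [weight, h]
  rw [this]

theorem ae_tsum_weight_eq_one (hπ : 𝒢.IsSymmetricProbField μ π) :
    ∀ᵐ x ∂μ, ∑' n, ‖p.weight π n x‖ₑ = 1 := by
  filter_upwards [hπ.hasSum_one, 𝒢.ae_target_fibre hπ.nonneg] with x hx hnn
  have hs : HasSum (fun h : {h : G // x = 𝒢.t h} => ‖π h‖) 1 := by
    have h1 := Complex.hasSum_re ((Equiv.subtypeEquivRight
      (p := fun h => x = 𝒢.t h) (q := fun h => h ∈ 𝒢.t ⁻¹' {x}) fun h => eq_comm).hasSum_iff.2 hx)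
    refine h1.congr_fun fun h => ?_
    have h0 := hnn h h.2.symm
    have h2 : ((π h).re : ℂ) = π h := Complex.ext rfl (Complex.le_def.1 h0).2
    show ‖π h‖ = (π h).re
    rw [← h2, Complex.norm_of_nonneg (Complex.le_def.1 h0).1, Complex.ofReal_re]
  have hs' := (p.hasSum_fibre_iff (fun h => ‖π h‖) x 1).1 hs
  have he : ∀ n, ‖p.weight π n x‖ₑ = ENNReal.ofReal ((p.dom n).indicator
      (fun x => ‖π (𝒢.fibreElt (p.elem_mem n) x)‖) x) := fun n => by
    rw [weight, ← ofReal_norm, norm_indicator_eq_indicator_norm]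
  simp_rw [he]
  rw [← ENNReal.ofReal_tsum_of_nonneg (fun n => Set.indicator_nonneg (fun _ _ => norm_nonneg _) _)
    hs'.summable, hs'.tsum_eq, ENNReal.ofReal_one]

/-- The arrow of the `n`-th piece with source `x` is the inverse of the arrow of the inverted piece
with target `x`. By symmetry of `π` the sum is therefore the normalisation of `π` along the
partition `p.inv`. -/
theorem ae_tsum_weight_inv_eq_one (hπ : 𝒢.IsSymmetricProbField μ π) :
    ∀ᵐ x ∂μ, ∑' n, ‖p.weight π n (𝒢.translateUnit (p.inv.elem_mem n) x)‖ₑ = 1 := by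
  filter_upwards [p.inv.ae_tsum_weight_eq_one hπ, 𝒢.ae_target_fibre hπ.symmetric] with x hx hsym
  rw [← hx]
  refine tsum_congr fun n => ?_
  have he : 𝒢.fibreElt (p.elem_mem n) (𝒢.translateUnit (p.inv.elem_mem n) x) =
    𝒢.inv (𝒢.fibreElt (p.inv.elem_mem n) x) := fibreElt_translateUnit_setInv (p.elem_mem n) x
  by_cases h : x ∈ p.inv.dom n
  · have h' : 𝒢.translateUnit (p.inv.elem_mem n) x ∈ p.dom n := by
      rw [dom, Set.mem_preimage, he]
      exact 𝒢.mem_setInv.1 h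
    rw [weight, weight, Set.indicator_of_mem h, Set.indicator_of_mem h', he,
      hsym _ (𝒢.t_fibreElt _ _)]
    exact RCLike.enorm_conj _
  · have h' : 𝒢.translateUnit (p.inv.elem_mem n) x ∉ p.dom n := by
      rw [dom, Set.mem_preimage, he]
      exact fun h' => h (𝒢.mem_setInv.2 h')
    rw [weight, weight, Set.indicator_of_notMem h, Set.indicator_of_notMem h']

/-- Translating each term back leaves `F g` times the total weight of the arrows with source `s g`,
which is one by symmetry. -/
theorem lintegral_tsum_weight (hμ : 𝒢.IsPMP μ) (hπ : 𝒢.IsSymmetricProbField μ π) {F : G → ℝ≥0∞}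
    (hF : Measurable F) :
    ∫⁻ g, ∑' n, ‖p.weight π n (𝒢.s g)‖ₑ * F (𝒢.translate (p.elem_mem n) g) ∂(𝒢.targetMeasure μ) =
      ∫⁻ g, F g ∂(𝒢.targetMeasure μ) := by
  have hw : ∀ n, Measurable fun x => ‖p.weight π n x‖ₑ := fun n =>
    (p.measurable_weight hπ.measurable n).enorm
  have hw' : ∀ n, Measurable fun g =>
      ‖p.weight π n (𝒢.translateUnit (p.inv.elem_mem n) (𝒢.s g))‖ₑ := fun n =>
    (hw n).comp ((𝒢.measurable_translateUnit _).comp 𝒢.measurable_s)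
  rw [lintegral_tsum fun n => (show Measurable fun g => ‖p.weight π n (𝒢.s g)‖ₑ *
    F (𝒢.translate (p.elem_mem n) g) from ((hw n).comp 𝒢.measurable_s).mul
    (hF.comp (𝒢.measurable_translate _))).aemeasurable]
  have h1 : ∀ n, ∫⁻ g, ‖p.weight π n (𝒢.s g)‖ₑ * F (𝒢.translate (p.elem_mem n) g)
      ∂(𝒢.targetMeasure μ) = ∫⁻ g, ‖p.weight π n (𝒢.translateUnit (p.inv.elem_mem n) (𝒢.s g))‖ₑ *
        F g ∂(𝒢.targetMeasure μ) := fun n => by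
    refine Eq.trans (lintegral_congr fun g => ?_)
      ((𝒢.measurePreserving_translate μ (p.elem_mem n)).lintegral_comp ((hw' n).mul hF))
    rw [𝒢.s_translate]
    exact congrArg (fun y => ‖p.weight π n y‖ₑ * _)
      (𝒢.translateUnit_setInv_translateUnit (p.elem_mem n) _).symm
  simp_rw [h1]
  rw [← lintegral_tsum fun n => (show Measurable fun g =>
    ‖p.weight π n (𝒢.translateUnit (p.inv.elem_mem n) (𝒢.s g))‖ₑ * F g from
      (hw' n).mul hF).aemeasurable]
  refine lintegral_congr_ae ?_
  filter_upwards [hμ.quasiMeasurePreserving_s.ae (p.ae_tsum_weight_inv_eq_one hπ)] with g hg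
  rw [ENNReal.tsum_mul_right, hg, one_mul]

/-- The function `g ↦ ∑ ξ(gh) π(h)`, as a sum over the pieces of a partition. -/
noncomputable def average (π : G → ℂ) (ξ : G → ℂ) (g : G) : ℂ :=
  ∑' n, p.weight π n (𝒢.s g) * ξ (𝒢.translate (p.elem_mem n) g)

theorem measurable_average (hπ : Measurable π) {ξ : G → ℂ} (hξ : Measurable ξ) :
    Measurable (p.average π ξ) :=
  Measurable.tsum fun n => ((p.measurable_weight hπ n).comp 𝒢.measurable_s).mul
    (hξ.comp (𝒢.measurable_translate _))

theorem ae_sq_tsum_le (hμ : 𝒢.IsPMP μ) (hπ : 𝒢.IsSymmetricProbField μ π) (ξ : G → ℂ) :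
    ∀ᵐ g ∂(𝒢.targetMeasure μ),
      (∑' n, ‖p.weight π n (𝒢.s g) * ξ (𝒢.translate (p.elem_mem n) g)‖ₑ) ^ 2 ≤
        ∑' n, ‖p.weight π n (𝒢.s g)‖ₑ * ‖ξ (𝒢.translate (p.elem_mem n) g)‖ₑ ^ 2 := by
  filter_upwards [hμ.quasiMeasurePreserving_s.ae (p.ae_tsum_weight_eq_one hπ)] with g hg
  simp_rw [enorm_mul]
  exact ENNReal.sq_tsum_mul_le hg _

theorem ae_summable (hμ : 𝒢.IsPMP μ) (hπ : 𝒢.IsSymmetricProbField μ π) {ξ : G → ℂ}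
    (hm : Measurable ξ) (hξ : MemLp ξ 2 (𝒢.targetMeasure μ)) : ∀ᵐ g ∂(𝒢.targetMeasure μ),
      Summable fun n => p.weight π n (𝒢.s g) * ξ (𝒢.translate (p.elem_mem n) g) := by
  have hfin := ae_lt_top (μ := 𝒢.targetMeasure μ) (f := fun g => ∑' n, ‖p.weight π n (𝒢.s g)‖ₑ *
    ‖ξ (𝒢.translate (p.elem_mem n) g)‖ₑ ^ 2) (Measurable.tsum fun n =>
      ((p.measurable_weight hπ.measurable n).comp 𝒢.measurable_s).enorm.mul
        ((hm.comp (𝒢.measurable_translate _)).enorm.pow_const 2)) (by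
      rw [p.lintegral_tsum_weight hμ hπ (F := fun g => ‖ξ g‖ₑ ^ 2) (hm.enorm.pow_const 2),
        ← eLpNorm_two_sq]
      exact ENNReal.pow_ne_top hξ.2.ne)
  filter_upwards [p.ae_sq_tsum_le hμ hπ ξ, hfin] with g h1 h2
  refine Summable.of_enorm fun h => ?_
  rw [h] at h1
  exact absurd (lt_of_le_of_lt h1 h2) (by simp)

/-- Pointwise, the squared average is at most the average of the squares, and averaging preserves
integrals of nonnegative functions. -/
theorem eLpNorm_average_le (hμ : 𝒢.IsPMP μ) (hπ : 𝒢.IsSymmetricProbField μ π) {ξ : G → ℂ}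
    (hm : Measurable ξ) : eLpNorm (p.average π ξ) 2 (𝒢.targetMeasure μ) ≤
      eLpNorm ξ 2 (𝒢.targetMeasure μ) := by
  rw [← ENNReal.pow_le_pow_left_iff two_ne_zero, eLpNorm_two_sq, eLpNorm_two_sq,
    ← p.lintegral_tsum_weight hμ hπ (F := fun g => ‖ξ g‖ₑ ^ 2) (hm.enorm.pow_const 2)]
  refine lintegral_mono_ae ?_
  filter_upwards [p.ae_sq_tsum_le hμ hπ ξ] with g hg
  refine le_trans ?_ hg
  gcongr
  exact enorm_tsum_le_tsum_enorm

theorem memLp_average (hμ : 𝒢.IsPMP μ) (hπ : 𝒢.IsSymmetricProbField μ π)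
    (ξ : Lp ℂ 2 (𝒢.targetMeasure μ)) : MemLp (p.average π ξ) 2 (𝒢.targetMeasure μ) :=
  ⟨(p.measurable_average hπ.measurable (Lp.stronglyMeasurable ξ).measurable).aestronglyMeasurable,
    lt_of_le_of_lt (p.eLpNorm_average_le hμ hπ (Lp.stronglyMeasurable ξ).measurable)
      (Lp.memLp ξ).2⟩

theorem average_add (hμ : 𝒢.IsPMP μ) (hπ : 𝒢.IsSymmetricProbField μ π)
    (ξ η : Lp ℂ 2 (𝒢.targetMeasure μ)) :
    p.average π (ξ + η : Lp ℂ 2 (𝒢.targetMeasure μ)) =ᵐ[𝒢.targetMeasure μ]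
      p.average π ξ + p.average π η := by
  have h0 : ∀ᵐ g ∂(𝒢.targetMeasure μ),
      (ξ + η : Lp ℂ 2 (𝒢.targetMeasure μ)) g = ξ g + η g := Lp.coeFn_add ξ η
  have hadd := ae_all_iff.2 fun n =>
    (𝒢.measurePreserving_translate μ (p.elem_mem n)).quasiMeasurePreserving.ae h0
  filter_upwards [hadd, p.ae_summable hμ hπ (Lp.stronglyMeasurable ξ).measurable (Lp.memLp ξ),
    p.ae_summable hμ hπ (Lp.stronglyMeasurable η).measurable (Lp.memLp η)] with g h1 h2 h3
  rw [Pi.add_apply, average, average, average, ← h2.tsum_add h3]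
  exact tsum_congr fun n => by rw [h1, mul_add]

theorem average_smul (c : ℂ) (ξ : Lp ℂ 2 (𝒢.targetMeasure μ)) :
    p.average π (c • ξ : Lp ℂ 2 (𝒢.targetMeasure μ)) =ᵐ[𝒢.targetMeasure μ]
      c • p.average π ξ := by
  have h0 : ∀ᵐ g ∂(𝒢.targetMeasure μ),
      (c • ξ : Lp ℂ 2 (𝒢.targetMeasure μ)) g = c * ξ g := Lp.coeFn_smul c ξ
  have hsmul := ae_all_iff.2 fun n =>
    (𝒢.measurePreserving_translate μ (p.elem_mem n)).quasiMeasurePreserving.ae h0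
  filter_upwards [hsmul] with g h1
  rw [Pi.smul_apply, smul_eq_mul, average, average, ← tsum_mul_left]
  exact tsum_congr fun n => by rw [h1, mul_left_comm]

/-- The Markov operator as a linear map. -/
noncomputable def markovLinearMap (hμ : 𝒢.IsPMP μ) (hπ : 𝒢.IsSymmetricProbField μ π) :
    Lp ℂ 2 (𝒢.targetMeasure μ) →ₗ[ℂ] Lp ℂ 2 (𝒢.targetMeasure μ) where
  toFun ξ := (p.memLp_average hμ hπ ξ).toLp
  map_add' ξ η := by
    rw [← MemLp.toLp_add]
    exact MemLp.toLp_congr _ _ (p.average_add hμ hπ ξ η)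
  map_smul' c ξ := by
    rw [RingHom.id_apply, ← MemLp.toLp_const_smul]
    exact MemLp.toLp_congr _ _ (p.average_smul c ξ)

theorem markovLinearMap_apply (hμ : 𝒢.IsPMP μ) (hπ : 𝒢.IsSymmetricProbField μ π)
    (ξ : Lp ℂ 2 (𝒢.targetMeasure μ)) :
    p.markovLinearMap hμ hπ ξ = (p.memLp_average hμ hπ ξ).toLp := rfl

end FullGroupPartition

open FullGroupPartition in
/-- The Markov operator of a symmetric field of probability measures exists and is a
contraction. -/
theorem IsPMP.exists_isMarkovOperator (hμ : 𝒢.IsPMP μ) (hπ : 𝒢.IsSymmetricProbField μ π) :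
    ∃ P : Lp ℂ 2 (𝒢.targetMeasure μ) →L[ℂ] Lp ℂ 2 (𝒢.targetMeasure μ),
      𝒢.IsMarkovOperator μ π P ∧ ‖P‖ ≤ 1 := by
  obtain ⟨p⟩ := 𝒢.nonempty_fullGroupPartition
  have hb : ∀ ξ, ‖p.markovLinearMap hμ hπ ξ‖ ≤ 1 * ‖ξ‖ := fun ξ => by
    rw [one_mul, markovLinearMap_apply, Lp.norm_toLp, Lp.norm_def]
    exact ENNReal.toReal_mono (Lp.memLp ξ).2.ne
      (p.eLpNorm_average_le hμ hπ (Lp.stronglyMeasurable ξ).measurable)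
  refine ⟨(p.markovLinearMap hμ hπ).mkContinuous 1 hb, ?_,
    LinearMap.mkContinuous_norm_le _ zero_le_one hb⟩
  intro ξ
  filter_upwards [(p.memLp_average hμ hπ ξ).coeFn_toLp,
    p.ae_summable hμ hπ (Lp.stronglyMeasurable ξ).measurable (Lp.memLp ξ)] with g h1 h2
  rw [p.hasSum_mul_iff, LinearMap.mkContinuous_apply, markovLinearMap_apply, h1]
  exact h2.hasSum

end DiscreteBorelGroupoid

/-! ### Restriction to an invariant set of units -/

namespace DiscreteBorelGroupoid

variable {X G : Type*} [MeasurableSpace X] [MeasurableSpace G] {𝒢 : DiscreteBorelGroupoid X G}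
  {μ : Measure X} {E : Set X} (hE : MeasurableSet E)

theorem measurableSet_restrictArrows (𝒢 : DiscreteBorelGroupoid X G) (hE : MeasurableSet E) :
    MeasurableSet {g | 𝒢.s g ∈ E ∧ 𝒢.t g ∈ E} :=
  (𝒢.measurable_s hE).inter (𝒢.measurable_t hE)

theorem measurableEmbedding_restrictArrows (𝒢 : DiscreteBorelGroupoid X G)
    (hE : MeasurableSet E) :
    MeasurableEmbedding (Subtype.val : 𝒢.RestrictArrows E → G) :=
  MeasurableEmbedding.subtype_coe (𝒢.measurableSet_restrictArrows hE)

theorem targetMeasure_restrict :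
    (𝒢.restrict E hE).targetMeasure (restrictMeasure μ E) =
      (μ E)⁻¹ • (𝒢.targetMeasure μ).comap Subtype.val := by
  have := 𝒢.standardBorel
  have := (𝒢.restrict E hE).standardBorel
  have hemb := 𝒢.measurableEmbedding_restrictArrows hE
  ext A hA
  rw [targetMeasure_apply _ _ hA, restrictMeasure, lintegral_smul_measure, Measure.smul_apply,
    hemb.comap_apply, targetMeasure_apply _ _ (hemb.measurableSet_image.2 hA)]
  congr 1
  have h1 : ∀ x : E, Measure.count (A ∩ (𝒢.restrict E hE).t ⁻¹' {x}) =
      Measure.count (Subtype.val '' A ∩ 𝒢.t ⁻¹' {x.1}) := fun x => by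
    rw [← Measure.count_injective_image Subtype.val_injective]
    congr 1
    ext g
    constructor
    · rintro ⟨g, ⟨hg, hx⟩, rfl⟩
      exact ⟨⟨g, hg, rfl⟩, congrArg Subtype.val hx⟩
    · rintro ⟨⟨g, hg, rfl⟩, hx⟩
      exact ⟨g, ⟨hg, Subtype.ext hx⟩, rfl⟩
  simp_rw [h1]
  rw [lintegral_subtype_comap hE (fun x => Measure.count (Subtype.val '' A ∩ 𝒢.t ⁻¹' {x}))]
  rw [← lintegral_indicator hE]
  refine lintegral_congr fun x => ?_
  by_cases hx : x ∈ E
  · rw [Set.indicator_of_mem hx]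
  · rw [Set.indicator_of_notMem hx]
    have h2 : Subtype.val '' A ∩ 𝒢.t ⁻¹' {x} = ∅ := by
      ext g
      simp only [Set.mem_inter_iff, Set.mem_empty_iff_false, iff_false]
      rintro ⟨⟨g, -, rfl⟩, rfl⟩
      exact hx g.2.2
    rw [h2, measure_empty]

theorem targetMeasure_restrict_apply {A : Set (𝒢.RestrictArrows E)} :
    (𝒢.restrict E hE).targetMeasure (restrictMeasure μ E) A =
      (μ E)⁻¹ * 𝒢.targetMeasure μ (Subtype.val '' A) := by
  rw [targetMeasure_restrict, Measure.smul_apply,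
    (𝒢.measurableEmbedding_restrictArrows hE).comap_apply, smul_eq_mul]

theorem ae_restrict_units (hE : MeasurableSet E) {Q : X → Prop} (h : ∀ᵐ x ∂μ, x ∈ E → Q x) :
    ∀ᵐ x ∂(restrictMeasure μ E), Q x.1 := by
  rw [ae_iff, restrictMeasure, Measure.smul_apply,
    (MeasurableEmbedding.subtype_coe hE).comap_apply, smul_eq_mul]
  refine mul_eq_zero_of_right _ (measure_mono_null ?_ (ae_iff.1 h))
  rintro _ ⟨x, hx, rfl⟩
  exact fun h => hx (h x.2)

theorem ae_restrict_arrows {Q : G → Prop}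
    (h : ∀ᵐ g ∂(𝒢.targetMeasure μ), 𝒢.s g ∈ E → 𝒢.t g ∈ E → Q g) :
    ∀ᵐ g ∂((𝒢.restrict E hE).targetMeasure (restrictMeasure μ E)), Q g.1 := by
  rw [ae_iff, targetMeasure_restrict_apply]
  refine mul_eq_zero_of_right _ (measure_mono_null ?_ (ae_iff.1 h))
  rintro _ ⟨g, hg, rfl⟩
  exact fun h => hg (h g.2.1 g.2.2)

theorem ae_of_ae_restrict_arrows {Q : G → Prop} [IsFiniteMeasure μ]
    (h : ∀ᵐ g ∂((𝒢.restrict E hE).targetMeasure (restrictMeasure μ E)), Q g.1) :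
    ∀ᵐ g ∂(𝒢.targetMeasure μ), 𝒢.s g ∈ E → 𝒢.t g ∈ E → Q g := by
  rw [ae_iff, targetMeasure_restrict_apply, mul_eq_zero] at h
  have h0 := h.resolve_left (ENNReal.inv_ne_zero.2 (measure_ne_top μ E))
  rw [ae_iff]
  refine measure_mono_null ?_ h0
  intro g hg
  simp only [Set.mem_ofPred_eq, Classical.not_imp] at hg
  exact ⟨⟨g, hg.1, hg.2.1⟩, hg.2.2, rfl⟩

theorem integral_restrictMeasure (hE : MeasurableSet E) (f : X → ℝ) :
    ∫ x, f x.1 ∂(restrictMeasure μ E) = (μ E).toReal⁻¹ * ∫ x in E, f x ∂μ := by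
  rw [restrictMeasure, integral_smul_measure, integral_subtype_comap hE, ENNReal.toReal_inv,
    smul_eq_mul]

theorem IsPMP.restrict (hμ : 𝒢.IsPMP μ) (h0 : 0 < μ E) :
    (𝒢.restrict E hE).IsPMP (restrictMeasure μ E) := by
  have := hμ.1
  refine (isPMP_iff _ _).2 ⟨⟨?_⟩, (𝒢.restrict E hE).measurable_inv, ?_⟩
  · rw [restrictMeasure, Measure.smul_apply,
      (MeasurableEmbedding.subtype_coe hE).comap_apply, Set.image_univ, Subtype.range_coe,
      smul_eq_mul, ENNReal.inv_mul_cancel h0.ne' (measure_ne_top μ E)]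
  · ext A hA
    rw [Measure.map_apply (𝒢.restrict E hE).measurable_inv hA, targetMeasure_restrict_apply,
      targetMeasure_restrict_apply, ← hμ.measurePreserving_inv.measure_preimage
      ((𝒢.measurableEmbedding_restrictArrows hE).measurableSet_image.2 hA).nullMeasurableSet]
    congr 2
    ext g
    constructor
    · rintro ⟨g, hg, rfl⟩
      exact ⟨_, hg, rfl⟩
    · rintro ⟨h, hh, he⟩
      have hg : g = 𝒢.inv h.1 := by rw [he, 𝒢.inv_inv]
      subst hg
      refine ⟨(𝒢.restrict E hE).inv h, ?_, rfl⟩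
      rw [Set.mem_preimage, inv_inv]
      exact hh

/-- Invariance gives one implication for almost every arrow; applied to the inverse arrow it gives
the other. -/
theorem IsPMP.ae_mem_iff_of_isInvariant (hμ : 𝒢.IsPMP μ) (hinv : 𝒢.IsInvariant μ E) :
    ∀ᵐ g ∂(𝒢.targetMeasure μ), 𝒢.s g ∈ E ↔ 𝒢.t g ∈ E := by
  have h1 : ∀ᵐ g ∂(𝒢.targetMeasure μ), 𝒢.s g ∈ E → 𝒢.t g ∈ E := by
    filter_upwards [(𝒢.quasiMeasurePreserving_t μ).ae (measure_eq_zero_iff_ae_notMem.1 hinv)]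
      with g hg hs
    by_contra ht
    exact hg (Or.inl ⟨⟨g, ⟨g, trivial, 𝒢.unit (𝒢.s g), ⟨_, hs, rfl⟩, (𝒢.t_unit _).symm,
      (𝒢.mul_unit g).symm⟩, rfl⟩, ht⟩)
  filter_upwards [h1, hμ.measurePreserving_inv.quasiMeasurePreserving.ae h1] with g hg hg'
  rw [𝒢.s_inv, 𝒢.t_inv] at hg'
  exact ⟨hg, hg'⟩

/-- Almost every arrow with target in `E` also has its source in `E`, so restricting loses no mass.
-/
theorem IsPMP.isSymmetricProbField_restrict (hμ : 𝒢.IsPMP μ) (hinv : 𝒢.IsInvariant μ E)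
    {π : G → ℂ} (hπ : 𝒢.IsSymmetricProbField μ π) :
    (𝒢.restrict E hE).IsSymmetricProbField (restrictMeasure μ E) fun g => π g.1 where
  measurable := hπ.measurable.comp measurable_subtype_coe
  symmetric := ae_restrict_arrows (Q := fun g => π (𝒢.inv g) = starRingEnd ℂ (π g)) hE
    (hπ.symmetric.mono fun _ h _ _ => h)
  nonneg := ae_restrict_arrows (Q := fun g => 0 ≤ π g) hE (hπ.nonneg.mono fun _ h _ _ => h)
  hasSum_one := by
    have h := ae_restrict_units (μ := μ) hE (Q := fun x => HasSum (fun g : 𝒢.t ⁻¹' {x} => π g) 1 ∧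
      ∀ g, 𝒢.t g = x → (𝒢.s g ∈ E ↔ 𝒢.t g ∈ E)) (by
        filter_upwards [hπ.hasSum_one, 𝒢.ae_target_fibre (hμ.ae_mem_iff_of_isInvariant hinv)]
          with x h1 h2 _
        exact ⟨h1, h2⟩)
    filter_upwards [h] with x ⟨h1, h2⟩
    let e : (𝒢.restrict E hE).t ⁻¹' {x} ≃ 𝒢.t ⁻¹' {x.1} :=
      { toFun := fun g => ⟨g.1.1, congrArg Subtype.val g.2⟩
        invFun := fun g => ⟨⟨g.1, (h2 g.1 g.2).2 (by rw [g.2]; exact x.2), by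
          rw [g.2]; exact x.2⟩, Subtype.ext g.2⟩
        left_inv := fun g => rfl
        right_inv := fun g => rfl }
    exact e.hasSum_iff.2 h1

theorem val_translate_restrict {γ' : Set (𝒢.RestrictArrows E)}
    (hγ' : γ' ∈ (𝒢.restrict E hE).fullGroup) {γ : Set G} (hγ : γ ∈ 𝒢.fullGroup)
    (hsub : ∀ h ∈ γ', h.1 ∈ γ) (g : 𝒢.RestrictArrows E) :
    ((𝒢.restrict E hE).translate hγ' g).1 = 𝒢.translate hγ g.1 := by
  refine 𝒢.mul_congr rfl (𝒢.fibreElt_eq hγ (hsub _ (fibreElt_mem _ hγ' _)) ?_).symm _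
  exact congrArg Subtype.val ((𝒢.restrict E hE).t_fibreElt hγ' ((𝒢.restrict E hE).s g))

/-- An element of the full group of a restriction extends by units. -/
theorem exists_fullGroup_extension {γ' : Set (𝒢.RestrictArrows E)}
    (hγ' : γ' ∈ (𝒢.restrict E hE).fullGroup) :
    ∃ γ ∈ 𝒢.fullGroup, (∀ h ∈ γ', h.1 ∈ γ) ∧ ∀ x ∉ E, 𝒢.unit x ∈ γ := by
  obtain ⟨hm, hs, ht, hsu, htu⟩ := mem_fullGroup_iff _ |>.1 hγ'
  have hs' : 𝒢.s '' (Subtype.val '' γ') = E := by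
    ext x
    constructor
    · rintro ⟨_, ⟨g, -, rfl⟩, rfl⟩
      exact g.2.1
    · intro hx
      obtain ⟨g, hg, hgx⟩ := hsu.symm ▸ Set.mem_univ (⟨x, hx⟩ : E)
      exact ⟨g.1, ⟨g, hg, rfl⟩, congrArg Subtype.val hgx⟩
  have ht' : 𝒢.t '' (Subtype.val '' γ') = E := by
    ext x
    constructor
    · rintro ⟨_, ⟨g, -, rfl⟩, rfl⟩
      exact g.2.2
    · intro hx
      obtain ⟨g, hg, hgx⟩ := htu.symm ▸ Set.mem_univ (⟨x, hx⟩ : E)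
      exact ⟨g.1, ⟨g, hg, rfl⟩, congrArg Subtype.val hgx⟩
  refine ⟨_, 𝒢.union_units_mem_fullGroup
    ((𝒢.measurableEmbedding_restrictArrows hE).measurableSet_image.2 hm) ?_ ?_
    (hs'.trans ht'.symm), fun h hh => Or.inl ⟨h, hh, rfl⟩, fun x hx => Or.inr ⟨x, ?_, rfl⟩⟩
  · rintro _ ⟨g, hg, rfl⟩ _ ⟨h, hh, rfl⟩ e
    exact congrArg Subtype.val (hs hg hh (Subtype.ext e))
  · rintro _ ⟨g, hg, rfl⟩ _ ⟨h, hh, rfl⟩ e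
    exact congrArg Subtype.val (ht hg hh (Subtype.ext e))
  · rwa [ht']

theorem preimage_val_mem_fullGroup (hinv : ∀ g, 𝒢.s g ∈ E ↔ 𝒢.t g ∈ E) {γ : Set G}
    (hγ : γ ∈ 𝒢.fullGroup) :
    (Subtype.val ⁻¹' γ : Set (𝒢.RestrictArrows E)) ∈ (𝒢.restrict E hE).fullGroup := by
  obtain ⟨hm, hs, ht, hsu, htu⟩ := 𝒢.mem_fullGroup_iff.1 hγ
  refine (mem_fullGroup_iff _).2 ⟨measurable_subtype_coe hm, ?_, ?_, ?_, ?_⟩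
  · exact fun g hg h hh e => Subtype.ext (hs hg hh (congrArg Subtype.val e))
  · exact fun g hg h hh e => Subtype.ext (ht hg hh (congrArg Subtype.val e))
  · refine Set.eq_univ_of_forall fun x => ?_
    obtain ⟨g, hg, hgx⟩ := hsu.symm ▸ Set.mem_univ x.1
    have hE' : 𝒢.s g ∈ E := hgx ▸ x.2
    exact ⟨⟨g, hE', (hinv g).1 hE'⟩, hg, Subtype.ext hgx⟩
  · refine Set.eq_univ_of_forall fun x => ?_
    obtain ⟨g, hg, hgx⟩ := htu.symm ▸ Set.mem_univ x.1
    have hE' : 𝒢.t g ∈ E := hgx ▸ x.2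
    exact ⟨⟨g, (hinv g).2 hE', hE'⟩, hg, Subtype.ext hgx⟩

theorem isInvariant_of_forall_mem_iff (hinv : ∀ g, 𝒢.s g ∈ E ↔ 𝒢.t g ∈ E) :
    𝒢.IsInvariant μ E := by
  have : 𝒢.t '' 𝒢.setMul Set.univ (𝒢.unit '' E) = E := by
    ext x
    constructor
    · rintro ⟨_, ⟨g, -, _, ⟨y, hy, rfl⟩, e, rfl⟩, rfl⟩
      rw [𝒢.t_unit] at e
      rw [𝒢.t_mul, ← hinv, e]
      exact hy
    · intro hx
      exact ⟨𝒢.mul (𝒢.unit x) (𝒢.unit x) (by rw [𝒢.s_unit, 𝒢.t_unit]),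
        ⟨_, trivial, _, ⟨x, hx, rfl⟩, _, rfl⟩, by rw [𝒢.t_mul, 𝒢.t_unit]⟩
  rw [IsInvariant, this, symmDiff_self]
  exact measure_empty

end DiscreteBorelGroupoid

/-! ### Bounded Borel functions and essential bounds -/

/-- Bounded measurable real functions. -/
def IsBddMeasurable {Ω : Type*} [MeasurableSpace Ω] (f : Ω → ℝ) : Prop :=
  Measurable f ∧ ∃ C, ∀ x, |f x| ≤ C

namespace IsBddMeasurable

variable {Ω Ω' : Type*} [MeasurableSpace Ω] [MeasurableSpace Ω'] {f g : Ω → ℝ}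

theorem add (hf : IsBddMeasurable f) (hg : IsBddMeasurable g) :
    IsBddMeasurable fun x => f x + g x := by
  obtain ⟨hf, C, hC⟩ := hf
  obtain ⟨hg, D, hD⟩ := hg
  exact ⟨hf.add hg, C + D, fun x => (abs_add_le _ _).trans (add_le_add (hC x) (hD x))⟩

theorem const_mul (c : ℝ) (hf : IsBddMeasurable f) : IsBddMeasurable fun x => c * f x := by
  obtain ⟨hf, C, hC⟩ := hf
  exact ⟨hf.const_mul c, |c| * C, fun x => by
    rw [abs_mul]
    exact mul_le_mul_of_nonneg_left (hC x) (abs_nonneg c)⟩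

theorem sub (hf : IsBddMeasurable f) (hg : IsBddMeasurable g) :
    IsBddMeasurable fun x => f x - g x := by
  simpa [sub_eq_add_neg] using hf.add (hg.const_mul (-1))

theorem mul (hf : IsBddMeasurable f) (hg : IsBddMeasurable g) :
    IsBddMeasurable fun x => f x * g x := by
  obtain ⟨hf, C, hC⟩ := hf
  obtain ⟨hg, D, hD⟩ := hg
  refine ⟨hf.mul hg, C * D, fun x => ?_⟩
  rw [abs_mul]
  exact mul_le_mul (hC x) (hD x) (abs_nonneg _) ((abs_nonneg _).trans (hC x))

theorem const (c : ℝ) : IsBddMeasurable fun _ : Ω => c := ⟨measurable_const, |c|, fun _ => le_rfl⟩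

theorem comp (hf : IsBddMeasurable f) {φ : Ω' → Ω} (hφ : Measurable φ) :
    IsBddMeasurable fun x => f (φ x) :=
  ⟨hf.1.comp hφ, hf.2.choose, fun x => hf.2.choose_spec (φ x)⟩

theorem sum {ι : Type*} (s : Finset ι) {f : ι → Ω → ℝ} (hf : ∀ i, IsBddMeasurable (f i)) :
    IsBddMeasurable fun x => ∑ i ∈ s, f i x := by
  classical
  induction s using Finset.induction_on with
  | empty => simpa using const (Ω := Ω) 0
  | insert i s hi ih => simpa [Finset.sum_insert hi] using (hf i).add ih

theorem integrable {ν : Measure Ω} [IsFiniteMeasure ν] (hf : IsBddMeasurable f) :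
    Integrable f ν :=
  Integrable.of_bound hf.1.aestronglyMeasurable hf.2.choose (ae_of_all _ hf.2.choose_spec)

theorem memLp_top {ν : Measure Ω} (hf : IsBddMeasurable f) : MemLp (fun x => (f x : ℂ)) ∞ ν :=
  memLp_top_of_bound (Complex.measurable_ofReal.comp hf.1).aestronglyMeasurable hf.2.choose
    (ae_of_all _ fun x => by simpa using hf.2.choose_spec x)

theorem indicator (hf : IsBddMeasurable f) {A : Set Ω} (hA : MeasurableSet A) :
    IsBddMeasurable (A.indicator f) := by
  obtain ⟨hf, C, hC⟩ := hf
  exact ⟨hf.indicator hA, C, fun x => (norm_indicator_le_norm_self f x).trans (hC x)⟩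

end IsBddMeasurable

theorem norm_Lp_top_le_of_ae_bound {Ω E : Type*} [MeasurableSpace Ω] [NormedAddCommGroup E]
    {ν : Measure Ω} {F : Lp E ∞ ν} {C : ℝ} (hC : 0 ≤ C) (h : ∀ᵐ x ∂ν, ‖F x‖ ≤ C) : ‖F‖ ≤ C := by
  rw [Lp.norm_def, eLpNorm_exponent_top]
  exact ENNReal.toReal_le_of_le_ofReal hC (eLpNormEssSup_le_of_ae_bound h)

theorem ae_norm_le_norm_Lp_top {Ω E : Type*} [MeasurableSpace Ω] [NormedAddCommGroup E]
    {ν : Measure Ω} (F : Lp E ∞ ν) : ∀ᵐ x ∂ν, ‖F x‖ ≤ ‖F‖ := by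
  have h0 : eLpNormEssSup F ν ≠ ∞ := by
    rw [← eLpNorm_exponent_top]
    exact (Lp.memLp F).2.ne
  filter_upwards [enorm_ae_le_eLpNormEssSup F ν] with x hx
  rw [Lp.norm_def, eLpNorm_exponent_top, ← toReal_enorm]
  exact ENNReal.toReal_mono h0 hx

theorem MeasureTheory.MeasurePreserving.integral_comp_of_measurable {Ω Ω' : Type*}
    [MeasurableSpace Ω] [MeasurableSpace Ω'] {ν : Measure Ω} {ν' : Measure Ω'} {T : Ω → Ω'}
    (hT : MeasurePreserving T ν ν') {f : Ω' → ℝ} (hf : Measurable f) :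
    ∫ x, f (T x) ∂ν = ∫ y, f y ∂ν' := by
  rw [← hT.map_eq, integral_map hT.measurable.aemeasurable hf.aestronglyMeasurable]

/-! ### Invariant means on bounded functions of the arrows -/

namespace DiscreteBorelGroupoid

variable {X G : Type*} [MeasurableSpace X] [MeasurableSpace G] {𝒢 : DiscreteBorelGroupoid X G}
  {μ : Measure X}

/-- A mean on the bounded Borel functions on the arrows that extends the integral on functions of
the source and is invariant under the full group. -/
structure IsInvariantMean (𝒢 : DiscreteBorelGroupoid X G) (μ : Measure X) (m : (G → ℝ) → ℝ) :
    Prop where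
  map_add : ∀ f g, IsBddMeasurable f → IsBddMeasurable g →
    m (fun x => f x + g x) = m f + m g
  map_mul : ∀ c f, IsBddMeasurable f → m (fun x => c * f x) = c * m f
  le_of_ae_le : ∀ f c, IsBddMeasurable f → (∀ᵐ g ∂(𝒢.targetMeasure μ), f g ≤ c) → m f ≤ c
  map_source : ∀ b, IsBddMeasurable b → m (fun g => b (𝒢.s g)) = ∫ x, b x ∂μ
  map_translate : ∀ (γ : Set G) (hγ : γ ∈ 𝒢.fullGroup) f, IsBddMeasurable f →
    m (fun g => f (𝒢.translate hγ g)) = m f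

namespace IsInvariantMean

variable {m : (G → ℝ) → ℝ}

theorem map_sub (hm : 𝒢.IsInvariantMean μ m) {f g : G → ℝ} (hf : IsBddMeasurable f)
    (hg : IsBddMeasurable g) :
    m (fun x => f x - g x) = m f - m g := by
  have h := hm.map_add f _ hf (hg.const_mul (-1))
  rw [hm.map_mul _ _ hg] at h
  rw [sub_eq_add_neg, ← neg_one_mul, ← h]
  congr 1
  ext x
  ring

theorem map_sum (hm : 𝒢.IsInvariantMean μ m) {ι : Type*} (s : Finset ι)
    {f : ι → G → ℝ} (hf : ∀ i, IsBddMeasurable (f i)) :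
    m (fun x => ∑ i ∈ s, f i x) = ∑ i ∈ s, m (f i) := by
  classical
  induction s using Finset.induction_on with
  | empty =>
    have := hm.map_mul 0 _ (IsBddMeasurable.const (Ω := G) 0)
    simpa using this
  | insert i s hi ih =>
    simp only [Finset.sum_insert hi]
    rw [hm.map_add _ _ (hf i) (IsBddMeasurable.sum s hf), ih]

theorem le_of_ae_le_fun (hm : 𝒢.IsInvariantMean μ m) {f f' : G → ℝ}
    (hf : IsBddMeasurable f) (hf' : IsBddMeasurable f')
    (h : ∀ᵐ g ∂(𝒢.targetMeasure μ), f g ≤ f' g) : m f ≤ m f' := by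
  have := hm.le_of_ae_le _ 0 (hf.sub hf') (h.mono fun g hg => by simpa using hg)
  rw [hm.map_sub hf hf'] at this
  linarith

theorem eq_of_ae_eq (hm : 𝒢.IsInvariantMean μ m) {f f' : G → ℝ}
    (hf : IsBddMeasurable f) (hf' : IsBddMeasurable f')
    (h : ∀ᵐ g ∂(𝒢.targetMeasure μ), f g = f' g) : m f = m f' :=
  le_antisymm (hm.le_of_ae_le_fun hf hf' (h.mono fun _ h => h.le))
    (hm.le_of_ae_le_fun hf' hf (h.mono fun _ h => h.ge))

end IsInvariantMean

section OfGlobalMean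

variable {Φ : Lp ℂ ∞ (𝒢.targetMeasure μ) →L[ℂ] Lp ℂ ∞ μ}

open Classical in
/-- The mean on real functions obtained by integrating a map into `L^∞` of the units. -/
noncomputable def integralMean (Φ : Lp ℂ ∞ (𝒢.targetMeasure μ) →L[ℂ] Lp ℂ ∞ μ) (f : G → ℝ) : ℝ :=
  if h : IsBddMeasurable f then ∫ x, (Φ h.memLp_top.toLp x).re ∂μ else 0

theorem integralMean_eq {f : G → ℝ} (h : IsBddMeasurable f) :
    integralMean Φ f = ∫ x, (Φ h.memLp_top.toLp x).re ∂μ := dif_pos h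

theorem IsGlobalInvariantMean.map_toLp_source (hΦ : 𝒢.IsGlobalInvariantMean μ Φ)
    (hμ : 𝒢.IsPMP μ) {b : X → ℝ} (hb : IsBddMeasurable b) :
    Φ (hb.comp 𝒢.measurable_s).memLp_top.toLp = hb.memLp_top.toLp := by
  refine hΦ.map_unitSpace _ _ ?_
  have h1 : ∀ᵐ x ∂μ, hb.memLp_top.toLp (μ := μ) _ x = (b x : ℂ) := hb.memLp_top.coeFn_toLp
  have h2 := hμ.quasiMeasurePreserving_s.ae h1
  filter_upwards [(hb.comp 𝒢.measurable_s).memLp_top.coeFn_toLp, h2] with g h3 h4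
  rw [h3, h4]

/-- A norm-one map fixing constants is positive: values in `[-D, c]` stay within `(c + D) / 2` of
the midpoint `(c - D) / 2`, and `Φ` preserves this bound. -/
theorem IsGlobalInvariantMean.ae_re_le (hΦ : 𝒢.IsGlobalInvariantMean μ Φ) (hμ : 𝒢.IsPMP μ)
    {f : G → ℝ} (hf : IsBddMeasurable f) {c : ℝ}
    (h : ∀ᵐ g ∂(𝒢.targetMeasure μ), f g ≤ c) :
    ∀ᵐ x ∂μ, (Φ hf.memLp_top.toLp x).re ≤ c := by
  obtain ⟨C, hC⟩ := hf.2
  -- The entry `-c` keeps the radius `(c + D) / 2` nonnegative.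
  obtain ⟨D, hD⟩ : ∃ D, D = max C (-c) := ⟨_, rfl⟩
  have hCD : C ≤ D := hD ▸ le_max_left _ _
  have hcD : -c ≤ D := hD ▸ le_max_right _ _
  have hr : IsBddMeasurable fun _ : X => (c - D) / 2 := IsBddMeasurable.const _
  have hfr : IsBddMeasurable fun g => f g - (c - D) / 2 := hf.sub (IsBddMeasurable.const _)
  have hsplit : (hf.memLp_top (ν := 𝒢.targetMeasure μ)).toLp =
      hfr.memLp_top.toLp + (hr.comp 𝒢.measurable_s).memLp_top.toLp := by
    rw [← MemLp.toLp_add]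
    refine MemLp.toLp_congr _ _ (ae_of_all _ fun g => ?_)
    simp
  have hnorm : ‖(hfr.memLp_top (ν := 𝒢.targetMeasure μ)).toLp‖ ≤ (c + D) / 2 := by
    refine norm_Lp_top_le_of_ae_bound (by linarith) ?_
    filter_upwards [hfr.memLp_top.coeFn_toLp, h] with g h1 h2
    rw [h1, Complex.norm_real, Real.norm_eq_abs, abs_le]
    have := abs_le.1 (hC g)
    constructor <;> linarith
  have hnorm' : ‖Φ hfr.memLp_top.toLp‖ ≤ (c + D) / 2 := by
    refine (Φ.le_opNorm _).trans ?_
    rw [hΦ.norm_eq_one, one_mul]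
    exact hnorm
  rw [hsplit, map_add, hΦ.map_toLp_source hμ hr]
  filter_upwards [Lp.coeFn_add (Φ hfr.memLp_top.toLp) (hr.memLp_top (ν := μ)).toLp,
    (hr.memLp_top (ν := μ)).coeFn_toLp, ae_norm_le_norm_Lp_top (Φ hfr.memLp_top.toLp)] with x h1 h2 h3
  rw [h1, Pi.add_apply, h2, Complex.add_re, Complex.ofReal_re]
  have := (Complex.re_le_norm _).trans (h3.trans hnorm')
  linarith

theorem IsGlobalInvariantMean.isInvariantMean (hΦ : 𝒢.IsGlobalInvariantMean μ Φ)
    (hμ : 𝒢.IsPMP μ) : 𝒢.IsInvariantMean μ (integralMean Φ) := by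
  have := hμ.1
  have hint : ∀ F : Lp ℂ ∞ μ, Integrable (fun x => (F x).re) μ := fun F =>
    ((Lp.memLp F).integrable le_top).re
  refine ⟨fun f g hf hg => ?_, fun c f hf => ?_, fun f c hf h => ?_, fun b hb => ?_,
    fun γ hγ f hf => ?_⟩
  · rw [integralMean_eq hf, integralMean_eq hg, integralMean_eq (hf.add hg),
      ← integral_add (hint _) (hint _)]
    have h : ((hf.add hg).memLp_top (ν := 𝒢.targetMeasure μ)).toLp =
        hf.memLp_top.toLp + hg.memLp_top.toLp := by
      rw [← MemLp.toLp_add]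
      exact MemLp.toLp_congr _ _ (ae_of_all _ fun g => by simp)
    rw [h, map_add]
    refine integral_congr_ae ?_
    filter_upwards [Lp.coeFn_add (Φ hf.memLp_top.toLp) (Φ hg.memLp_top.toLp)] with x hx
    rw [hx, Pi.add_apply, Complex.add_re]
  · rw [integralMean_eq hf, integralMean_eq (hf.const_mul c), ← integral_const_mul]
    have h : ((hf.const_mul c).memLp_top (ν := 𝒢.targetMeasure μ)).toLp =
        (c : ℂ) • hf.memLp_top.toLp := by
      rw [← MemLp.toLp_const_smul]
      exact MemLp.toLp_congr _ _ (ae_of_all _ fun g => by simp)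
    rw [h, map_smul]
    refine integral_congr_ae ?_
    filter_upwards [Lp.coeFn_smul (c : ℂ) (Φ hf.memLp_top.toLp)] with x hx
    rw [hx, Pi.smul_apply, smul_eq_mul, Complex.re_ofReal_mul]
  · rw [integralMean_eq hf]
    refine (integral_mono_ae (hint _) (integrable_const c) (hΦ.ae_re_le hμ hf h)).trans ?_
    simp
  · rw [integralMean_eq (hb.comp 𝒢.measurable_s), hΦ.map_toLp_source hμ hb]
    refine integral_congr_ae ?_
    filter_upwards [(hb.memLp_top (ν := μ)).coeFn_toLp] with x hx
    rw [hx, Complex.ofReal_re]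
  -- Equivariance of `Φ` becomes invariance after integration, because `μ` is preserved by the
  -- action on units.
  · have hf' := hf.comp (𝒢.measurable_translate hγ)
    rw [integralMean_eq hf, integralMean_eq hf', ← (hμ.measurePreserving_translateUnit
      hγ).integral_comp_of_measurable (f := fun x => (Φ hf.memLp_top.toLp x).re)
      (Complex.measurable_re.comp (Lp.stronglyMeasurable _).measurable)]
    have h0 : ∀ᵐ g ∂(𝒢.targetMeasure μ),
        hf.memLp_top.toLp (μ := 𝒢.targetMeasure μ) _ g = (f g : ℂ) := hf.memLp_top.coeFn_toLp
    have h1 := (𝒢.measurePreserving_translate μ hγ).quasiMeasurePreserving.ae h0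
    refine integral_congr_ae ?_
    filter_upwards [hΦ.map_translate γ hγ hf.memLp_top.toLp hf'.memLp_top.toLp (by
      filter_upwards [h1, hf'.memLp_top.coeFn_toLp] with g h2 h3
      rw [h2, h3])] with x hx
    rw [hx]

end OfGlobalMean

section RestrictMean

variable {E : Set X} (hE : MeasurableSet E)

theorem isBddMeasurable_extend {f : 𝒢.RestrictArrows E → ℝ} (hE : MeasurableSet E)
    (hf : IsBddMeasurable f) : IsBddMeasurable (Function.extend Subtype.val f 0) := by
  obtain ⟨hf, C, hC⟩ := hf
  refine ⟨(𝒢.measurableEmbedding_restrictArrows hE).measurable_extend hf measurable_zero,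
    max C 0, fun g => ?_⟩
  by_cases h : 𝒢.s g ∈ E ∧ 𝒢.t g ∈ E
  · have := Subtype.val_injective.extend_apply f 0 (⟨g, h⟩ : 𝒢.RestrictArrows E)
    rw [show g = (⟨g, h⟩ : 𝒢.RestrictArrows E).1 from rfl, this]
    exact (hC _).trans (le_max_left _ _)
  · rw [Function.extend_apply' _ _ _ (fun ⟨a, ha⟩ => h (ha ▸ a.2))]
    simp

theorem extend_of_mem {f : 𝒢.RestrictArrows E → ℝ} {g : G} (h : 𝒢.s g ∈ E ∧ 𝒢.t g ∈ E) :
    Function.extend Subtype.val f 0 g = f ⟨g, h⟩ :=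
  Subtype.val_injective.extend_apply f 0 (⟨g, h⟩ : 𝒢.RestrictArrows E)

theorem extend_of_notMem {f : 𝒢.RestrictArrows E → ℝ} {g : G}
    (h : ¬ (𝒢.s g ∈ E ∧ 𝒢.t g ∈ E)) : Function.extend Subtype.val f 0 g = 0 :=
  Function.extend_apply' _ _ _ (fun ⟨a, ha⟩ => h (ha ▸ a.2))

/-- After extension by zero, a bound `c` on `𝒢|_E` becomes `c` times the indicator of `E` composed
with `s`, of mean `c μ(E)`; this explains the normalisation. -/
theorem IsInvariantMean.restrict {m : (G → ℝ) → ℝ} (hm : 𝒢.IsInvariantMean μ m)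
    (hμ : 𝒢.IsPMP μ) (hinv : 𝒢.IsInvariant μ E) (h0 : 0 < μ E) :
    (𝒢.restrict E hE).IsInvariantMean (restrictMeasure μ E)
      fun f => (μ E).toReal⁻¹ * m (Function.extend Subtype.val f 0) := by
  have := hμ.1
  have hpos : 0 < (μ E).toReal := ENNReal.toReal_pos h0.ne' (measure_ne_top μ E)
  have hae := hμ.ae_mem_iff_of_isInvariant hinv
  refine ⟨fun f g hf hg => ?_, fun c f hf => ?_, fun f c hf h => ?_, fun b hb => ?_,
    fun γ hγ f hf => ?_⟩
  · rw [← mul_add, ← hm.map_add _ _ (isBddMeasurable_extend hE hf)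
      (isBddMeasurable_extend hE hg)]
    congr 2
    ext x
    by_cases h : 𝒢.s x ∈ E ∧ 𝒢.t x ∈ E
    · simp only [extend_of_mem h]
    · simp only [extend_of_notMem h, add_zero]
  · rw [mul_left_comm, ← hm.map_mul _ _ (isBddMeasurable_extend hE hf)]
    congr 2
    ext x
    by_cases h : 𝒢.s x ∈ E ∧ 𝒢.t x ∈ E
    · simp only [extend_of_mem h]
    · simp only [extend_of_notMem h, mul_zero]
  · have hb : IsBddMeasurable (E.indicator fun _ => c) := (IsBddMeasurable.const c).indicator hE
    have h1 : m (Function.extend Subtype.val f 0) ≤ m fun g => E.indicator (fun _ => c) (𝒢.s g) := by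
      refine hm.le_of_ae_le_fun (isBddMeasurable_extend hE hf) (hb.comp 𝒢.measurable_s) ?_
      have h' := ae_of_ae_restrict_arrows (Q := fun g => Function.extend Subtype.val f 0 g ≤ c) hE
        (by
          filter_upwards [h] with g hg
          rw [extend_of_mem g.2]
          exact hg)
      filter_upwards [hae, h'] with g hg hg'
      by_cases hs : 𝒢.s g ∈ E
      · rw [Set.indicator_of_mem hs]
        exact hg' hs (hg.1 hs)
      · rw [Set.indicator_of_notMem hs, extend_of_notMem fun h => hs h.1]
    rw [hm.map_source _ hb, integral_indicator hE, setIntegral_const, smul_eq_mul] at h1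
    rw [inv_mul_le_iff₀ hpos]
    exact h1
  · have hb' : IsBddMeasurable (Function.extend Subtype.val b (0 : X → ℝ)) := by
      obtain ⟨hb, C, hC⟩ := hb
      refine ⟨(MeasurableEmbedding.subtype_coe hE).measurable_extend hb measurable_zero,
        max C 0, fun x => ?_⟩
      by_cases h : x ∈ E
      · have := Subtype.val_injective.extend_apply b 0 (⟨x, h⟩ : E)
        rw [show x = (⟨x, h⟩ : E).1 from rfl, this]
        exact (hC _).trans (le_max_left _ _)
      · rw [Function.extend_apply' _ _ _ (fun ⟨a, ha⟩ => h (ha ▸ a.2))]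
        simp
    have h1 : m (Function.extend Subtype.val (fun g => b ((𝒢.restrict E hE).s g)) 0) =
        m fun g => Function.extend Subtype.val b (0 : X → ℝ) (𝒢.s g) := by
      refine hm.eq_of_ae_eq (isBddMeasurable_extend hE (hb.comp (𝒢.restrict E hE).measurable_s))
        (hb'.comp 𝒢.measurable_s) ?_
      filter_upwards [hae] with g hg
      by_cases hs : 𝒢.s g ∈ E
      · rw [extend_of_mem ⟨hs, hg.1 hs⟩]
        exact (Subtype.val_injective.extend_apply b 0 (⟨𝒢.s g, hs⟩ : E)).symm
      · rw [extend_of_notMem fun h => hs h.1,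
          Function.extend_apply' _ _ _ (fun ⟨a, ha⟩ => hs (ha ▸ a.2))]
        rfl
    have h2 := integral_restrictMeasure (μ := μ) hE (Function.extend Subtype.val b (0 : X → ℝ))
    simp only [Subtype.val_injective.extend_apply] at h2
    rw [h1, hm.map_source _ hb', h2, setIntegral_eq_integral_of_forall_compl_eq_zero]
    intro x hx
    rw [Function.extend_apply' _ _ _ (fun ⟨a, ha⟩ => hx (ha ▸ a.2))]
    rfl
  -- The extension acts by units over the complement of `E`. An arrow outside the restriction is
  -- therefore fixed if its source is outside `E`, and otherwise keeps its target outside `E`; in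
  -- both cases the extended function vanishes before and after translation.
  · obtain ⟨γ', hγ', hsub, hunit⟩ := exists_fullGroup_extension hE hγ
    rw [← hm.map_translate γ' hγ' _ (isBddMeasurable_extend hE hf)]
    congr 2
    ext g
    by_cases h : 𝒢.s g ∈ E ∧ 𝒢.t g ∈ E
    · have hv := val_translate_restrict hE hγ hγ' hsub ⟨g, h⟩
      rw [extend_of_mem h, ← hv, Subtype.val_injective.extend_apply]
    · rw [extend_of_notMem h]
      by_cases ht : 𝒢.t g ∈ E
      · have hs : 𝒢.s g ∉ E := fun hs => h ⟨hs, ht⟩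
        have he : 𝒢.translate hγ' g = g := by
          have h' := 𝒢.fibreElt_eq hγ' (hunit _ hs) (𝒢.t_unit _)
          rw [translate, 𝒢.mul_congr rfl h']
          exact 𝒢.mul_unit g
        rw [he, extend_of_notMem h]
      · rw [extend_of_notMem fun h' => ht (by simpa using h'.2)]

end RestrictMean

end DiscreteBorelGroupoid

/-! ### Almost invariant densities; amenability implies Kesten's criterion -/

namespace DiscreteBorelGroupoid

variable {X G : Type*} [MeasurableSpace X] [MeasurableSpace G] {𝒢 : DiscreteBorelGroupoid X G}
  {μ : Measure X}

theorem integrable_bdd_mul {Ω : Type*} [MeasurableSpace Ω] {ν : Measure Ω} {φ f : Ω → ℝ}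
    (hφ : IsBddMeasurable φ) (hf : Integrable f ν) : Integrable (fun x => φ x * f x) ν :=
  hf.bdd_mul hφ.1.aestronglyMeasurable (ae_of_all _ hφ.2.choose_spec)

/-- If a bounded function `H` satisfies `∫ H f ≥ u` for all probability densities `f`, then
`H ≥ u` almost everywhere. -/
theorem ae_le_of_forall_density {Ω : Type*} [MeasurableSpace Ω] {ν : Measure Ω} [SigmaFinite ν]
    {H : Ω → ℝ} (hH : IsBddMeasurable H) {u : ℝ}
    (h : ∀ f : Lp ℝ 1 ν, 0 ≤ᵐ[ν] f → ∫ x, f x ∂ν = 1 → u ≤ ∫ x, H x * f x ∂ν) :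
    ∀ᵐ x ∂ν, u ≤ H x := by
  have hsub : IsBddMeasurable fun x => H x - u := hH.sub (IsBddMeasurable.const u)
  have hint : ∀ S, MeasurableSet S → ν S < ∞ → IntegrableOn (fun x => H x - u) S ν :=
    fun S _ hS => by
      have : IsFiniteMeasure (ν.restrict S) := ⟨by simpa using hS⟩
      exact hsub.integrable
  have h1 := ae_nonneg_of_forall_setIntegral_nonneg_of_sigmaFinite hint fun S hS hfin => by
    rcases eq_or_ne (ν S) 0 with h0 | h0
    · rw [setIntegral_measure_zero _ h0]
    · have : IsFiniteMeasure (ν.restrict S) := ⟨by simpa using hfin⟩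
      have hpos : 0 < (ν S).toReal := ENNReal.toReal_pos h0 hfin.ne
      let F : Lp ℝ 1 ν := indicatorConstLp 1 hS hfin.ne (ν S).toReal⁻¹
      have hF : F =ᵐ[ν] S.indicator fun _ => (ν S).toReal⁻¹ := indicatorConstLp_coeFn
      have h2 := h F (hF.mono fun x hx => by
          rw [Pi.zero_apply, hx]
          exact Set.indicator_nonneg (fun _ _ => inv_nonneg.2 hpos.le) x) (by
        rw [integral_congr_ae hF, integral_indicator hS, setIntegral_const, smul_eq_mul]
        exact mul_inv_cancel₀ hpos.ne')
      have h3 : ∫ x, H x * F x ∂ν = (∫ x in S, H x ∂ν) * (ν S).toReal⁻¹ := by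
        rw [← integral_mul_const, ← integral_indicator hS]
        refine integral_congr_ae (hF.mono fun x hx => ?_)
        by_cases hxS : x ∈ S
        · simp [hx, hxS]
        · simp [hx, hxS]
      rw [h3, ← div_eq_mul_inv, le_div_iff₀ hpos] at h2
      rw [integral_sub hH.integrable (integrable_const u), setIntegral_const, smul_eq_mul]
      simp only [measureReal_def]
      linarith
  filter_upwards [h1] with x hx
  simpa using hx

open Set in
/-- A groupoid with an invariant mean has almost invariant probability densities, which in
addition do not integrate a given function of the source to much more than its mean. -/
theorem IsInvariantMean.exists_almost_invariant_density {m : (G → ℝ) → ℝ}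
    (hm : 𝒢.IsInvariantMean μ m) (hμ : 𝒢.IsPMP μ) {n : ℕ} {γ : Fin n → Set G}
    (hγ : ∀ i, γ i ∈ 𝒢.fullGroup) {b : X → ℝ} (hb : IsBddMeasurable b) {δ : ℝ} (hδ : 0 < δ) :
    ∃ f : Lp ℝ 1 (𝒢.targetMeasure μ), 0 ≤ᵐ[𝒢.targetMeasure μ] f ∧
      ∫ g, f g ∂(𝒢.targetMeasure μ) = 1 ∧
      (∀ i, ∫ g, |f (𝒢.translate (hγ i) g) - f g| ∂(𝒢.targetMeasure μ) < δ) ∧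
      ∫ g, b (𝒢.s g) * f g ∂(𝒢.targetMeasure μ) < ∫ x, b x ∂μ + δ := by
  have := hμ.1
  have := 𝒢.sigmaFinite_targetMeasure μ
  set ν := 𝒢.targetMeasure μ with hν
  have hmp := fun i => 𝒢.measurePreserving_translate μ (hγ i)
  let T : Fin n → Lp ℝ 1 ν →ₗᵢ[ℝ] Lp ℝ 1 ν := fun i =>
    Lp.compMeasurePreservingₗᵢ ℝ (𝒢.translate (hγ i)) (hmp i)
  have hT : ∀ i f, ∀ᵐ g ∂ν, T i f g = f (𝒢.translate (hγ i) g) := fun i f =>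
    Lp.coeFn_compMeasurePreserving f (hmp i)
  let β : G → ℝ := fun g => b (𝒢.s g) - ∫ x, b x ∂μ
  have hβ : IsBddMeasurable β := (hb.comp 𝒢.measurable_s).sub (IsBddMeasurable.const _)
  let B : Lp ℝ 1 ν →ₗ[ℝ] ℝ :=
    { toFun := fun f => ∫ g, β g * f g ∂ν
      map_add' := fun f f' => by
        rw [← integral_add (integrable_bdd_mul hβ (L1.integrable_coeFn f))
          (integrable_bdd_mul hβ (L1.integrable_coeFn f'))]
        refine integral_congr_ae ((Lp.coeFn_add f f').mono fun g hg => ?_)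
        simp only [hg, Pi.add_apply, mul_add]
      map_smul' := fun c f => by
        rw [RingHom.id_apply, smul_eq_mul, ← integral_const_mul]
        refine integral_congr_ae ((Lp.coeFn_smul c f).mono fun g hg => ?_)
        simp only [hg, Pi.smul_apply, smul_eq_mul]
        ring }
  -- All defects are collected in one linear map. A density with image in the open `δ`-ball
  -- suffices; if there is none, Hahn–Banach separates that ball from the convex image of the
  -- densities.
  let A : Lp ℝ 1 ν →ₗ[ℝ] (Fin n → Lp ℝ 1 ν) × ℝ :=
    (LinearMap.pi fun i => (T i).toLinearMap - LinearMap.id).prod B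
  let D : Set (Lp ℝ 1 ν) := {f | 0 ≤ᵐ[ν] f ∧ ∫ g, f g ∂ν = 1}
  have hD : Convex ℝ D := by
    intro f hf f' hf' a a' ha ha' haa
    have h1 : ⇑(a • f + a' • f') =ᵐ[ν] fun g => a * f g + a' * f' g := by
      filter_upwards [Lp.coeFn_add (a • f) (a' • f'), Lp.coeFn_smul a f, Lp.coeFn_smul a' f']
        with g h1 h2 h3
      rw [h1, Pi.add_apply, h2, h3, Pi.smul_apply, Pi.smul_apply, smul_eq_mul, smul_eq_mul]
    constructor
    · filter_upwards [h1, hf.1, hf'.1] with g h1 h2 h3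
      rw [h1]
      exact add_nonneg (mul_nonneg ha h2) (mul_nonneg ha' h3)
    · rw [integral_congr_ae h1, integral_add ((L1.integrable_coeFn f).const_mul a)
        ((L1.integrable_coeFn f').const_mul a'), integral_const_mul, integral_const_mul, hf.2,
        hf'.2, mul_one, mul_one, haa]
  by_contra! hcon
  have hdisj : Disjoint (Metric.ball (0 : (Fin n → Lp ℝ 1 ν) × ℝ) δ) (A '' D) := by
    rw [Set.disjoint_left]
    rintro _ hball ⟨f, hf, rfl⟩
    rw [mem_ball_zero_iff, Prod.norm_def, max_lt_iff, pi_norm_lt_iff hδ] at hball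
    refine absurd (hcon f hf.1 hf.2 fun i => ?_) (not_le.2 ?_)
    · have h1 : ‖T i f - f‖ < δ := hball.1 i
      rw [L1.norm_eq_integral_norm] at h1
      refine lt_of_eq_of_lt (integral_congr_ae ?_) h1
      filter_upwards [Lp.coeFn_sub (T i f) f, hT i f] with g h2 h3
      rw [h2, Pi.sub_apply, h3, Real.norm_eq_abs]
    · have h1 : |∫ g, β g * f g ∂ν| < δ := hball.2
      have h2 : ∫ g, β g * f g ∂ν = ∫ g, b (𝒢.s g) * f g ∂ν - ∫ x, b x ∂μ := by
        simp only [β, sub_mul]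
        rw [integral_sub (integrable_bdd_mul (hb.comp 𝒢.measurable_s) (L1.integrable_coeFn f))
          ((L1.integrable_coeFn f).const_mul _), integral_const_mul, hf.2, mul_one]
      rw [h2] at h1
      linarith [(abs_lt.1 h1).2]
  obtain ⟨ℓ, u, hℓ1, hℓ2⟩ := geometric_hahn_banach_open (convex_ball _ _) Metric.isOpen_ball
    (hD.linear_image A) hdisj
  have hu : 0 < u := by simpa using hℓ1 0 (Metric.mem_ball_self hδ)
  let ℓi : Fin n → Lp ℝ 1 ν →L[ℝ] ℝ := fun i =>
    ℓ.comp ((ContinuousLinearMap.inl ℝ (Fin n → Lp ℝ 1 ν) ℝ).comp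
      (ContinuousLinearMap.single ℝ (fun _ : Fin n => Lp ℝ 1 ν) i))
  choose φ hφm hφb hφ using fun i => exists_bounded_integral_representation (ℓi i)
  have hφ' : ∀ i, IsBddMeasurable (φ i) := fun i => ⟨hφm i, _, hφb i⟩
  let c : ℝ := ℓ (0, 1)
  have hdecomp : ∀ v r, ℓ (v, r) = ∑ i, ℓi i (v i) + c * r := by
    intro v r
    have h1 : ((v, r) : (Fin n → Lp ℝ 1 ν) × ℝ) =
        ∑ i, (Pi.single i (v i), (0 : ℝ)) + r • ((0 : Fin n → Lp ℝ 1 ν), (1 : ℝ)) := by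
      refine Prod.ext ?_ ?_
      · simp [Prod.fst_sum, Finset.univ_sum_single]
      · simp [Prod.snd_sum]
    rw [h1, _root_.map_add, _root_.map_sum, map_smul, smul_eq_mul, mul_comm]
    rfl
  have hγi := fun i => 𝒢.setInv_mem_fullGroup (hγ i)
  -- The function that represents `ℓ ∘ A`: the adjoint of translation by `γ i` is translation by its
  -- inverse.
  let H : G → ℝ := fun g => ∑ i, (φ i (𝒢.translate (hγi i) g) - φ i g) + c * β g
  have hterm : ∀ i, IsBddMeasurable fun g => φ i (𝒢.translate (hγi i) g) - φ i g := fun i =>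
    ((hφ' i).comp (𝒢.measurable_translate _)).sub (hφ' i)
  have hH : IsBddMeasurable H := (IsBddMeasurable.sum _ hterm).add (hβ.const_mul c)
  have hHf : ∀ f : Lp ℝ 1 ν, ∫ g, H g * f g ∂ν = ℓ (A f) := by
    intro f
    have hfi := L1.integrable_coeFn f
    have h1 : ∀ i, ℓi i (T i f - f) =
        ∫ g, (φ i (𝒢.translate (hγi i) g) - φ i g) * f g ∂ν := by
      intro i
      have h2 : ∫ g, φ i g * T i f g ∂ν = ∫ g, φ i (𝒢.translate (hγi i) g) * f g ∂ν := by
        rw [← (hmp i).integral_comp_of_measurable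
          (f := fun g => φ i (𝒢.translate (hγi i) g) * f g)
          (((hφm i).comp (𝒢.measurable_translate _)).mul (Lp.stronglyMeasurable f).measurable)]
        refine integral_congr_ae ((hT i f).mono fun g hg => ?_)
        simp only [hg, 𝒢.translate_setInv_translate (hγ i)]
      rw [_root_.map_sub, hφ, hφ, h2, ← integral_sub
        (integrable_bdd_mul ((hφ' i).comp (𝒢.measurable_translate _)) hfi)
        (integrable_bdd_mul (hφ' i) hfi)]
      simp only [sub_mul]
    have h3 : ℓ (A f) = ∑ i, ℓi i (T i f - f) + c * ∫ g, β g * f g ∂ν := hdecomp _ _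
    rw [h3]
    simp only [h1, H, add_mul, Finset.sum_mul]
    rw [integral_add (integrable_finsetSum _ fun i _ => integrable_bdd_mul (hterm i) hfi)
      (by simpa only [_root_.mul_assoc] using (integrable_bdd_mul hβ hfi).const_mul c),
      integral_finsetSum _ fun i _ => integrable_bdd_mul (hterm i) hfi]
    simp only [_root_.mul_assoc, integral_const_mul]
  have hHu : ∀ᵐ g ∂ν, u ≤ H g := ae_le_of_forall_density hH fun f h1 h2 => by
    rw [hHf]
    exact hℓ2 _ ⟨f, ⟨h1, h2⟩, rfl⟩
  -- Invariance kills the coboundaries and centring kills `β`, whereas `H ≥ u > 0` almost everywhere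
  -- forces a positive mean.
  have hmH : m H = 0 := by
    rw [hm.map_add _ _ (IsBddMeasurable.sum _ hterm) (hβ.const_mul c), hm.map_sum _ hterm,
      hm.map_mul _ _ hβ, hm.map_sub (hb.comp 𝒢.measurable_s) (IsBddMeasurable.const _),
      hm.map_source b hb, hm.map_source (fun _ => ∫ x, b x ∂μ) (IsBddMeasurable.const _)]
    have : ∀ i, m (fun g => φ i (𝒢.translate (hγi i) g) - φ i g) = 0 := fun i => by
      rw [hm.map_sub ((hφ' i).comp (𝒢.measurable_translate _)) (hφ' i),
        hm.map_translate _ (hγi i) _ (hφ' i), sub_self]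
    simp [this]
  have h1 := hm.le_of_ae_le_fun (IsBddMeasurable.const u) hH hHu
  rw [hmH, hm.map_source (fun _ => u) (IsBddMeasurable.const u)] at h1
  simp at h1
  linarith

/-- The Markov operators of a groupoid with an invariant mean have norm `1`. -/
theorem IsInvariantMean.exists_isMarkovOperator_norm_eq_one {m : (G → ℝ) → ℝ}
    (hm : 𝒢.IsInvariantMean μ m) (hμ : 𝒢.IsPMP μ) {π : G → ℂ}
    (hπ : 𝒢.IsSymmetricProbField μ π) :
    ∃ P : Lp ℂ 2 (𝒢.targetMeasure μ) →L[ℂ] Lp ℂ 2 (𝒢.targetMeasure μ),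
      𝒢.IsMarkovOperator μ π P ∧ ‖P‖ = 1 := by
  have := hμ.1
  obtain ⟨P, hP, hP1⟩ := hμ.exists_isMarkovOperator hπ
  refine ⟨P, hP, le_antisymm hP1 (le_of_forall_pos_sub_le fun η hη => ?_)⟩
  obtain ⟨p⟩ := 𝒢.nonempty_fullGroupPartition
  let a : ℕ → X → ℝ := fun n x => ‖p.weight π n x‖
  have ham : ∀ n, Measurable (a n) := fun n => (p.measurable_weight hπ.measurable n).norm
  have hsum : ∀ᵐ x ∂μ, HasSum (fun n => a n x) 1 := by
    filter_upwards [p.ae_tsum_weight_eq_one hπ] with x hx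
    have h1 : HasSum (fun n => ((‖p.weight π n x‖₊ : NNReal) : ℝ≥0∞)) ((1 : NNReal) : ℝ≥0∞) := by
      rw [ENNReal.coe_one, ← hx]
      exact ENNReal.summable.hasSum
    simpa [a] using NNReal.hasSum_coe.2 (ENNReal.hasSum_coe.1 h1)
  have hnn : ∀ᵐ x ∂μ, ∀ n, p.weight π n x = (a n x : ℂ) := by
    filter_upwards [𝒢.ae_target_fibre hπ.nonneg] with x hx n
    by_cases h : x ∈ p.dom n
    · have h1 := hx (𝒢.fibreElt (p.elem_mem n) x) (𝒢.t_fibreElt _ x)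
      simp only [a, FullGroupPartition.weight, Set.indicator_of_mem h]
      exact Complex.eq_coe_norm_of_nonneg h1
    · simp [a, FullGroupPartition.weight, Set.indicator_of_notMem h]
  -- The mass of `π` outside the first `n` pieces. The truncation is inactive almost everywhere and
  -- makes `b n` bounded at every point.
  let b : ℕ → X → ℝ := fun n x => max 0 (min 1 (1 - ∑ i ∈ Finset.range n, a i x))
  have hb : ∀ n, IsBddMeasurable (b n) := fun n => by
    refine ⟨measurable_const.max (measurable_const.min
      (measurable_const.sub (Finset.measurable_sum _ fun i _ => ham i))), 1, fun x => ?_⟩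
    rw [abs_of_nonneg (le_max_left _ _)]
    exact max_le zero_le_one (min_le_left _ _)
  have hbe : ∀ᵐ x ∂μ, ∀ n, b n x = 1 - ∑ i ∈ Finset.range n, a i x := by
    filter_upwards [hsum] with x hx n
    have h1 : ∑ i ∈ Finset.range n, a i x ≤ 1 :=
      sum_le_hasSum _ (fun i _ => norm_nonneg _) hx
    have h2 : 0 ≤ ∑ i ∈ Finset.range n, a i x := Finset.sum_nonneg fun i _ => norm_nonneg _
    simp only [b]
    rw [min_eq_right (by linarith), max_eq_right (by linarith)]
  have hblim : Filter.Tendsto (fun n => ∫ x, b n x ∂μ) Filter.atTop (nhds 0) := by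
    rw [← integral_zero X ℝ (μ := μ)]
    refine tendsto_integral_of_dominated_convergence (fun _ => 1)
      (fun n => (hb n).1.aestronglyMeasurable) (integrable_const 1)
      (fun n => ae_of_all _ fun x => ?_) ?_
    · rw [Real.norm_eq_abs, abs_of_nonneg (le_max_left _ _)]
      exact max_le zero_le_one (min_le_left _ _)
    · filter_upwards [hsum, hbe] with x h1 h2
      simp only [h2]
      simpa using h1.tendsto_sum_nat.const_sub 1
  obtain ⟨n, hn⟩ := (hblim.eventually_lt_const (half_pos (half_pos hη))).exists
  -- Error budget: `η / 4` for the mean of the tail, `η / 4` for its deviation under `f`, and `η /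
  -- 4` for the `n` translation defects together; `n + 1` covers `n = 0`.
  have hδ : 0 < min (η / 4) (η / 4 / (n + 1)) := by positivity
  obtain ⟨f, hf0, hf1, hfT, hfb⟩ := hm.exists_almost_invariant_density hμ (n := n)
    (γ := fun i => p.elem i) (fun i => p.elem_mem i) (hb n) hδ
  have hfm : Measurable f := (Lp.stronglyMeasurable f).measurable
  have hfi : Integrable f (𝒢.targetMeasure μ) := L1.integrable_coeFn f
  let ρ : G → ℝ := fun g => Real.sqrt (f g)
  have hρ : MemLp (fun g => (ρ g : ℂ)) 2 (𝒢.targetMeasure μ) := by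
    refine MemLp.ofReal ((memLp_two_iff_integrable_sq hfm.sqrt.aestronglyMeasurable).2 ?_)
    exact hfi.congr (hf0.mono fun g hg => (Real.sq_sqrt hg).symm)
  have hρm : ∀ᵐ g ∂(𝒢.targetMeasure μ), hρ.toLp _ g = (ρ g : ℂ) := hρ.coeFn_toLp
  have hnorm : ‖hρ.toLp‖ = 1 := by
    have h1 : (inner ℂ hρ.toLp hρ.toLp : ℂ) = 1 := by
      rw [L2.inner_def]
      have h2 : ∫ g, inner ℂ (hρ.toLp _ g) (hρ.toLp _ g) ∂(𝒢.targetMeasure μ) = ∫ g, ((f g : ℝ) : ℂ) ∂(𝒢.targetMeasure μ) := by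
        refine integral_congr_ae ?_
        filter_upwards [hρm, hf0] with g h3 h4
        rw [h3, RCLike.inner_apply, Complex.conj_ofReal, ← Complex.ofReal_mul,
          Real.mul_self_sqrt h4]
      rw [h2, integral_complex_ofReal, hf1, Complex.ofReal_one]
    rw [inner_self_eq_norm_sq_to_K] at h1
    have h2 : ‖hρ.toLp‖ ^ 2 = 1 := Complex.ofReal_injective (by simpa using h1)
    exact (pow_eq_one_iff_of_nonneg (norm_nonneg _) two_ne_zero).1 h2
  have hTρ := ae_all_iff.2 fun i =>
    (𝒢.measurePreserving_translate μ (p.elem_mem i)).quasiMeasurePreserving.ae hρm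
  have hTf := ae_all_iff.2 fun i =>
    (𝒢.measurePreserving_translate μ (p.elem_mem i)).quasiMeasurePreserving.ae hf0
  have hTi : ∀ i, Integrable (fun g => |f (𝒢.translate (p.elem_mem i) g) - f g|) (𝒢.targetMeasure μ) := fun i =>
    (((𝒢.measurePreserving_translate μ (p.elem_mem i)).integrable_comp_of_integrable hfi).sub
      hfi).abs
  -- The terms are nonnegative, so the first `n` give a lower bound. Each is estimated by √(xy) ≥
  -- min(x, y) ≥ x − |y − x| and by weights at most 1.
  have hpt : ∀ᵐ g ∂(𝒢.targetMeasure μ), f g - b n (𝒢.s g) * f g -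
      ∑ i ∈ Finset.range n, |f (𝒢.translate (p.elem_mem i) g) - f g| ≤
        (inner ℂ (hρ.toLp _ g) (P hρ.toLp g)).re := by
    filter_upwards [hP hρ.toLp, hρm, hTρ, hf0, hTf, hμ.quasiMeasurePreserving_s.ae hbe,
      hμ.quasiMeasurePreserving_s.ae hnn, hμ.quasiMeasurePreserving_s.ae hsum]
      with g h1 h2 h3 h4 h5 h6 h7 h8
    rw [p.hasSum_mul_iff] at h1
    have h9 : HasSum (fun i => a i (𝒢.s g) * ρ (𝒢.translate (p.elem_mem i) g))
        (P hρ.toLp g).re := by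
      have h := Complex.hasSum_re h1
      simpa only [h7, h3, ← Complex.ofReal_mul, Complex.ofReal_re] using h
    have h10 := sum_le_hasSum (Finset.range n)
      (fun i _ => mul_nonneg (norm_nonneg _) (Real.sqrt_nonneg _)) h9
    rw [h2, RCLike.inner_apply, Complex.conj_ofReal, Complex.re_mul_ofReal, mul_comm _ (ρ g), h6]
    refine le_trans ?_ (mul_le_mul_of_nonneg_left h10 (Real.sqrt_nonneg _))
    rw [Finset.mul_sum, sub_mul, one_mul, sub_sub_cancel, Finset.sum_mul,
      ← Finset.sum_sub_distrib]
    refine Finset.sum_le_sum fun i _ => ?_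
    have ha0 : 0 ≤ a i (𝒢.s g) := norm_nonneg _
    have ha1 : a i (𝒢.s g) ≤ 1 := le_hasSum h8 i fun j _ => norm_nonneg _
    have hmin : f g - |f (𝒢.translate (p.elem_mem i) g) - f g| ≤
        ρ g * ρ (𝒢.translate (p.elem_mem i) g) := by
      rw [← Real.sqrt_mul h4]
      refine le_trans ?_ (Real.sqrt_le_sqrt (x := (min (f g) (f (𝒢.translate (p.elem_mem i) g))) *
        min (f g) (f (𝒢.translate (p.elem_mem i) g)))
        (mul_le_mul (min_le_left _ _) (min_le_right _ _) (le_min h4 (h5 i)) h4))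
      rw [Real.sqrt_mul_self (le_min h4 (h5 i))]
      refine le_min (by linarith [abs_nonneg (f (𝒢.translate (p.elem_mem i) g) - f g)]) ?_
      linarith [neg_abs_le (f (𝒢.translate (p.elem_mem i) g) - f g)]
    calc a i (𝒢.s g) * f g - |f (𝒢.translate (p.elem_mem i) g) - f g|
        ≤ a i (𝒢.s g) * f g - a i (𝒢.s g) * |f (𝒢.translate (p.elem_mem i) g) - f g| := by
          have := mul_le_mul_of_nonneg_right ha1
            (abs_nonneg (f (𝒢.translate (p.elem_mem i) g) - f g))
          linarith
      _ = a i (𝒢.s g) * (f g - |f (𝒢.translate (p.elem_mem i) g) - f g|) := by ring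
      _ ≤ a i (𝒢.s g) * (ρ g * ρ (𝒢.translate (p.elem_mem i) g)) :=
          mul_le_mul_of_nonneg_left hmin ha0
      _ = ρ g * (a i (𝒢.s g) * ρ (𝒢.translate (p.elem_mem i) g)) := by ring
  have hbf := integrable_bdd_mul ((hb n).comp 𝒢.measurable_s) hfi
  have hsumi := integrable_finsetSum (Finset.range n) fun i _ => hTi i
  have hinner : Integrable (fun g => inner ℂ (hρ.toLp _ g) (P hρ.toLp g)) (𝒢.targetMeasure μ) :=
    L2.integrable_inner _ _
  have hfbf : Integrable (fun g => f g - b n (𝒢.s g) * f g) (𝒢.targetMeasure μ) := hfi.sub hbf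
  have hmain := integral_mono_ae (hfbf.sub hsumi) hinner.re hpt
  have h1 : ∫ g, RCLike.re (inner ℂ (hρ.toLp _ g) (P hρ.toLp g)) ∂(𝒢.targetMeasure μ) =
      RCLike.re (inner ℂ hρ.toLp (P hρ.toLp)) := by
    rw [L2.inner_def, integral_re hinner]
  have h2 : RCLike.re (inner ℂ hρ.toLp (P hρ.toLp)) ≤ ‖P‖ := by
    refine (RCLike.re_le_norm _).trans ((norm_inner_le_norm _ _).trans ?_)
    rw [hnorm, one_mul]
    simpa [hnorm] using P.le_opNorm hρ.toLp
  have h3 : ∑ i ∈ Finset.range n, ∫ g, |f (𝒢.translate (p.elem_mem i) g) - f g| ∂(𝒢.targetMeasure μ) ≤ η / 4 := by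
    calc ∑ i ∈ Finset.range n, ∫ g, |f (𝒢.translate (p.elem_mem i) g) - f g| ∂(𝒢.targetMeasure μ)
        ≤ ∑ i ∈ Finset.range n, η / 4 / (n + 1) := Finset.sum_le_sum fun i hi =>
          (hfT ⟨i, Finset.mem_range.1 hi⟩).le.trans (min_le_right _ _)
      _ = n * (η / 4 / (n + 1)) := by simp
      _ ≤ (n + 1) * (η / 4 / (n + 1)) := by gcongr; linarith
      _ = η / 4 := mul_div_cancel₀ _ (by positivity)
  simp only [Pi.sub_apply] at hmain
  rw [integral_sub hfbf hsumi, integral_sub hfi hbf, integral_finsetSum _ fun i _ => hTi i,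
    hf1] at hmain
  have h4 := hmain.trans (h1.le.trans h2)
  have h5 := min_le_left (η / 4) (η / 4 / (n + 1))
  linarith

/-- Amenability implies Kesten's criterion. -/
theorem IsAmenable.satisfiesKesten (hμ : 𝒢.IsPMP μ) (h : 𝒢.IsAmenable μ) :
    𝒢.SatisfiesKesten μ := by
  obtain ⟨Φ, hΦ⟩ := h
  intro E hE hinv h0 π hπ
  exact ((hΦ.isInvariantMean hμ).restrict hE hμ hinv h0).exists_isMarkovOperator_norm_eq_one
    (hμ.restrict hE h0) (hμ.isSymmetricProbField_restrict hE hinv hπ)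

end DiscreteBorelGroupoid

/-! ### Coboundaries and greedy matching of units -/

namespace DiscreteBorelGroupoid

variable {X G : Type*} [MeasurableSpace X] [MeasurableSpace G] {𝒢 : DiscreteBorelGroupoid X G}
  {μ : Measure X}

/-- The coboundaries: the linear combinations of functions `α(γ) φ - φ` on the arrow space, for
`γ` in the full group and bounded Borel functions `φ`. -/
def coboundaries (𝒢 : DiscreteBorelGroupoid X G) : Submodule ℝ (G → ℝ) :=
  Submodule.span ℝ {v | ∃ (γ : Set G) (hγ : γ ∈ 𝒢.fullGroup) (φ : G → ℝ), IsBddMeasurable φ ∧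
    v = fun g => φ (𝒢.translate hγ g) - φ g}

theorem sub_mem_coboundaries {γ : Set G} (hγ : γ ∈ 𝒢.fullGroup) {φ : G → ℝ}
    (hφ : IsBddMeasurable φ) : (fun g => φ (𝒢.translate hγ g) - φ g) ∈ 𝒢.coboundaries :=
  Submodule.subset_span ⟨γ, hγ, φ, hφ, rfl⟩

/-- The units in `P` and `Q` left over after greedily matching them along the first `n` pieces of
a partition into bisections. -/
def leftover (p : FullGroupPartition 𝒢) (P Q : Set X) : ℕ → Set X × Set X
  | 0 => (P, Q)
  | n + 1 =>
    ((leftover p P Q n).1 \ 𝒢.t '' (p.piece n ∩ 𝒢.t ⁻¹' (leftover p P Q n).1 ∩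
        𝒢.s ⁻¹' (leftover p P Q n).2),
      (leftover p P Q n).2 \ 𝒢.s '' (p.piece n ∩ 𝒢.t ⁻¹' (leftover p P Q n).1 ∩
        𝒢.s ⁻¹' (leftover p P Q n).2))

/-- The arrows of the `n`-th piece used by the greedy matching. -/
def matchingPiece (p : FullGroupPartition 𝒢) (P Q : Set X) (n : ℕ) : Set G :=
  p.piece n ∩ 𝒢.t ⁻¹' (leftover p P Q n).1 ∩ 𝒢.s ⁻¹' (leftover p P Q n).2

section Matching

variable (p : FullGroupPartition 𝒢) (P Q : Set X)

theorem antitone_leftover_fst : Antitone fun n => (leftover p P Q n).1 :=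
  antitone_nat_of_succ_le fun _ => Set.sdiff_subset

theorem antitone_leftover_snd : Antitone fun n => (leftover p P Q n).2 :=
  antitone_nat_of_succ_le fun _ => Set.sdiff_subset

theorem injOn_s_piece (n : ℕ) : Set.InjOn 𝒢.s (p.piece n) :=
  (𝒢.mem_fullGroup_iff.1 (p.elem_mem n)).2.1.mono (p.piece_subset n)

theorem injOn_t_piece (n : ℕ) : Set.InjOn 𝒢.t (p.piece n) :=
  (𝒢.mem_fullGroup_iff.1 (p.elem_mem n)).2.2.1.mono (p.piece_subset n)

theorem matchingPiece_subset (n : ℕ) : matchingPiece p P Q n ⊆ p.piece n := fun _ h => h.1.1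

theorem mem_leftover_of_forall_notMem_fst {x : X} (hx : x ∈ P)
    (h : ∀ n, x ∉ 𝒢.t '' matchingPiece p P Q n) (n : ℕ) : x ∈ (leftover p P Q n).1 := by
  induction n with
  | zero => exact hx
  | succ n ih => exact ⟨ih, h n⟩

theorem mem_leftover_of_forall_notMem_snd {x : X} (hx : x ∈ Q)
    (h : ∀ n, x ∉ 𝒢.s '' matchingPiece p P Q n) (n : ℕ) : x ∈ (leftover p P Q n).2 := by
  induction n with
  | zero => exact hx
  | succ n ih => exact ⟨ih, h n⟩

variable {P Q}

theorem measurableSet_leftover (hP : MeasurableSet P) (hQ : MeasurableSet Q) (n : ℕ) :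
    MeasurableSet (leftover p P Q n).1 ∧ MeasurableSet (leftover p P Q n).2 := by
  induction n with
  | zero => exact ⟨hP, hQ⟩
  | succ n ih =>
    have h : MeasurableSet (matchingPiece p P Q n) :=
      ((p.measurableSet_piece n).inter (𝒢.measurable_t ih.1)).inter (𝒢.measurable_s ih.2)
    exact ⟨ih.1.diff (𝒢.measurableSet_image_t h
        ((injOn_t_piece p n).mono (matchingPiece_subset p P Q n))),
      ih.2.diff (𝒢.measurableSet_image_s h
        ((injOn_s_piece p n).mono (matchingPiece_subset p P Q n)))⟩

theorem measurableSet_matchingPiece (hP : MeasurableSet P) (hQ : MeasurableSet Q) (n : ℕ) :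
    MeasurableSet (matchingPiece p P Q n) :=
  ((p.measurableSet_piece n).inter (𝒢.measurable_t (measurableSet_leftover p hP hQ n).1)).inter
    (𝒢.measurable_s (measurableSet_leftover p hP hQ n).2)

/-- A target used at one stage is removed from the leftover, so later stages cannot use it again;
within a stage the piece is a bisection. -/
theorem injOn_t_matching : Set.InjOn 𝒢.t (⋃ n, matchingPiece p P Q n) := by
  have key : ∀ n m g h, g ∈ matchingPiece p P Q n → h ∈ matchingPiece p P Q m → n < m →
      𝒢.t g ≠ 𝒢.t h := fun n m g h hg hh hnm e =>
    ((antitone_leftover_fst p P Q (Nat.succ_le_of_lt hnm)) hh.1.2).2 ⟨g, hg, e⟩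
  intro g hg h hh e
  obtain ⟨n, hn⟩ := Set.mem_iUnion.1 hg
  obtain ⟨m, hm⟩ := Set.mem_iUnion.1 hh
  rcases lt_trichotomy n m with hnm | rfl | hnm
  · exact absurd e (key n m g h hn hm hnm)
  · exact injOn_t_piece p n hn.1.1 hm.1.1 e
  · exact absurd e.symm (key m n h g hm hn hnm)

theorem injOn_s_matching : Set.InjOn 𝒢.s (⋃ n, matchingPiece p P Q n) := by
  have key : ∀ n m g h, g ∈ matchingPiece p P Q n → h ∈ matchingPiece p P Q m → n < m →
      𝒢.s g ≠ 𝒢.s h := fun n m g h hg hh hnm e =>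
    ((antitone_leftover_snd p P Q (Nat.succ_le_of_lt hnm)) hh.2).2 ⟨g, hg, e⟩
  intro g hg h hh e
  obtain ⟨n, hn⟩ := Set.mem_iUnion.1 hg
  obtain ⟨m, hm⟩ := Set.mem_iUnion.1 hh
  rcases lt_trichotomy n m with hnm | rfl | hnm
  · exact absurd e (key n m g h hn hm hnm)
  · exact injOn_s_piece p n hn.1.1 hm.1.1 e
  · exact absurd e.symm (key m n h g hm hn hnm)

end Matching

/-- The saturation of a Borel set of units is Borel. -/
theorem measurableSet_saturation (𝒢 : DiscreteBorelGroupoid X G) {A : Set X}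
    (hA : MeasurableSet A) : MeasurableSet (𝒢.s '' (𝒢.t ⁻¹' A)) := by
  obtain ⟨p⟩ := 𝒢.nonempty_fullGroupPartition
  -- On each piece `s` is injective, which makes the image Borel.
  have h : 𝒢.s '' (𝒢.t ⁻¹' A) = ⋃ n, 𝒢.s '' (p.piece n ∩ 𝒢.t ⁻¹' A) := by
    rw [← Set.image_iUnion, ← Set.iUnion_inter, Set.eq_univ_of_forall fun g =>
      Set.mem_iUnion.2 (p.existsUnique_mem g).exists, Set.univ_inter]
  rw [h]
  exact MeasurableSet.iUnion fun n => 𝒢.measurableSet_image_s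
    ((p.measurableSet_piece n).inter (𝒢.measurable_t hA))
    ((injOn_s_piece p n).mono Set.inter_subset_left)

theorem mem_saturation_iff (𝒢 : DiscreteBorelGroupoid X G) (A : Set X) (g : G) :
    𝒢.s g ∈ 𝒢.s '' (𝒢.t ⁻¹' A) ↔ 𝒢.t g ∈ 𝒢.s '' (𝒢.t ⁻¹' A) := by
  constructor
  · rintro ⟨h, hh, e⟩
    exact ⟨𝒢.mul h (𝒢.inv g) (by rw [𝒢.t_inv, e]), by rwa [Set.mem_preimage, 𝒢.t_mul],
      by rw [𝒢.s_mul, 𝒢.s_inv]⟩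
  · rintro ⟨h, hh, e⟩
    exact ⟨𝒢.mul h g e, by rwa [Set.mem_preimage, 𝒢.t_mul], 𝒢.s_mul _ _ _⟩

/-- Two disjoint Borel sets of units can be matched by an element of the full group, in such a way
that on an invariant Borel set the second one is used up, and on its complement the first. -/
theorem exists_matching (𝒢 : DiscreteBorelGroupoid X G) {P Q : Set X} (hP : MeasurableSet P)
    (hQ : MeasurableSet Q) (hPQ : Disjoint P Q) :
    ∃ (γ : Set G) (hγ : γ ∈ 𝒢.fullGroup) (A B E : Set X), MeasurableSet A ∧ MeasurableSet E ∧
      A ⊆ P ∧ B ⊆ Q ∧ (∀ x, 𝒢.translateUnit hγ x ∈ A ↔ x ∈ B) ∧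
      (∀ g, 𝒢.s g ∈ E ↔ 𝒢.t g ∈ E) ∧ (∀ x ∈ E, x ∈ Q → x ∈ B) ∧ ∀ x ∉ E, x ∈ P → x ∈ A := by
  obtain ⟨p⟩ := 𝒢.nonempty_fullGroupPartition
  set σ : Set G := ⋃ n, matchingPiece p P Q n with hσ
  have hσm : MeasurableSet σ := MeasurableSet.iUnion (measurableSet_matchingPiece p hP hQ)
  have hσP : ∀ g ∈ σ, 𝒢.t g ∈ P := fun g hg => by
    obtain ⟨n, hn⟩ := Set.mem_iUnion.1 hg
    exact antitone_leftover_fst p P Q (Nat.zero_le n) hn.1.2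
  have hσQ : ∀ g ∈ σ, 𝒢.s g ∈ Q := fun g hg => by
    obtain ⟨n, hn⟩ := Set.mem_iUnion.1 hg
    exact antitone_leftover_snd p P Q (Nat.zero_le n) hn.2
  have hγ := 𝒢.union_setInv_union_units_mem_fullGroup hσm (injOn_s_matching p)
    (injOn_t_matching p) fun g hg h hh e =>
      Set.disjoint_left.1 hPQ (hσP h hh) (e ▸ hσQ g hg)
  have hAm : MeasurableSet (𝒢.t '' σ) := 𝒢.measurableSet_image_t hσm (injOn_t_matching p)
  -- `E` is the saturation of the unmatched part of `P`. An unmatched unit of `Q` in `E` would be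
  -- joined to an unmatched unit of `P` by an arrow of some piece; both ends are still left over at
  -- the stage of that piece, so the arrow would have been used.
  refine ⟨_, hγ, 𝒢.t '' σ, 𝒢.s '' σ, 𝒢.s '' (𝒢.t ⁻¹' (P \ 𝒢.t '' σ)), hAm,
    𝒢.measurableSet_saturation (hP.diff hAm), Set.image_subset_iff.2 hσP,
    Set.image_subset_iff.2 hσQ, fun x => ⟨?_, ?_⟩, 𝒢.mem_saturation_iff _, ?_, ?_⟩
  · rintro ⟨g, hg, e⟩
    have h1 : 𝒢.inv g ∈ (σ ∪ 𝒢.setInv σ) ∪ 𝒢.unit '' (𝒢.t '' (σ ∪ 𝒢.setInv σ))ᶜ :=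
      Or.inl (Or.inr ⟨g, hg, rfl⟩)
    have h2 := (𝒢.mem_fullGroup_iff.1 hγ).2.1 h1 (𝒢.fibreElt_mem hγ x) (by rw [𝒢.s_inv, e]; rfl)
    exact ⟨g, hg, by rw [← 𝒢.t_inv, h2, 𝒢.t_fibreElt]⟩
  · rintro ⟨g, hg, rfl⟩
    have h1 : 𝒢.inv g ∈ (σ ∪ 𝒢.setInv σ) ∪ 𝒢.unit '' (𝒢.t '' (σ ∪ 𝒢.setInv σ))ᶜ :=
      Or.inl (Or.inr ⟨g, hg, rfl⟩)
    exact ⟨g, hg, by rw [translateUnit, 𝒢.fibreElt_eq hγ h1 (𝒢.t_inv g), 𝒢.s_inv]⟩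
  · rintro _ ⟨g, ⟨hgP, hgA⟩, rfl⟩ hgQ
    by_contra hgB
    obtain ⟨n, hn, -⟩ := p.existsUnique_mem g
    refine hgB ⟨g, Set.mem_iUnion.2 ⟨n, ⟨hn, ?_⟩, ?_⟩, rfl⟩
    · exact mem_leftover_of_forall_notMem_fst p P Q hgP
        (fun m hm => hgA (Set.image_mono (Set.subset_iUnion _ m) hm)) n
    · exact mem_leftover_of_forall_notMem_snd p P Q hgQ
        (fun m hm => hgB (Set.image_mono (Set.subset_iUnion _ m) hm)) n
  · intro x hx hxP
    by_contra hxA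
    exact hx ⟨𝒢.unit x, by rw [Set.mem_preimage, 𝒢.t_unit]; exact ⟨hxP, hxA⟩, 𝒢.s_unit x⟩

theorem integrableOn_intCast [IsFiniteMeasure μ] {β : X → ℤ} (hβ : Measurable β) {E : Set X}
    (hE : MeasurableSet E) {k l : ℕ} (h : ∀ x ∈ E, -(k : ℤ) ≤ β x ∧ β x ≤ l) :
    IntegrableOn (fun x => (β x : ℝ)) E μ := by
  refine Integrable.of_bound (C := k + l) ?_ (ae_restrict_of_forall_mem hE fun x hx => ?_)
  · exact ((measurable_from_top (f := fun n : ℤ => (n : ℝ))).comp hβ).aestronglyMeasurable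
  · obtain ⟨h1, h2⟩ := h x hx
    have h1' : -(k : ℝ) ≤ β x := by exact_mod_cast h1
    have h2' : (β x : ℝ) ≤ l := by exact_mod_cast h2
    rw [Real.norm_eq_abs, abs_le]
    constructor <;> linarith [Nat.cast_nonneg (α := ℝ) k, Nat.cast_nonneg (α := ℝ) l]

/-- An integer valued function with negative integral over an invariant set can be made
nonpositive on an invariant subset of positive measure by adding a coboundary. -/
theorem IsPMP.exists_coboundary_int (hμ : 𝒢.IsPMP μ) (N : ℕ) : ∀ (k l : ℕ), k + l = N →
    ∀ (β : X → ℤ), Measurable β → ∀ E, MeasurableSet E → (∀ g, 𝒢.s g ∈ E ↔ 𝒢.t g ∈ E) →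
    (∀ x ∈ E, -(k : ℤ) ≤ β x ∧ β x ≤ l) → ∫ x in E, (β x : ℝ) ∂μ < 0 →
    ∃ (F : Set X) (w : X → ℝ), MeasurableSet F ∧ (∀ g, 𝒢.s g ∈ F ↔ 𝒢.t g ∈ F) ∧ 0 < μ F ∧
      (fun g => w (𝒢.s g)) ∈ 𝒢.coboundaries ∧ ∀ x ∈ F, (β x : ℝ) + w x ≤ 0 := by
  have := hμ.1
  -- The induction is on the width `k + l` of the range of `β`, which drops by one on a smaller
  -- invariant set where the integral is still negative.
  induction N with
  | zero =>
    intro k l hkl β hβ E hE hinv hb hneg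
    obtain ⟨rfl, rfl⟩ : k = 0 ∧ l = 0 := by omega
    rw [setIntegral_congr_fun (g := fun _ => 0) hE fun x hx => by
      obtain ⟨h1, h2⟩ := hb x hx
      have : β x = 0 := by push_cast at h1 h2; omega
      simp [this]] at hneg
    simp at hneg
  | succ N ih =>
    intro k l hkl β hβ E hE hinv hb hneg
    rcases l with _ | l
    · refine ⟨E, 0, hE, hinv, ?_, Submodule.zero_mem _, fun x hx => ?_⟩
      · rw [pos_iff_ne_zero]
        intro h0
        rw [setIntegral_measure_zero _ h0] at hneg
        exact lt_irrefl _ hneg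
      · have := (hb x hx).2
        simpa using (by exact_mod_cast this : (β x : ℝ) ≤ 0)
    rcases k with _ | k
    · refine absurd (setIntegral_nonneg hE fun x hx => ?_) (not_le.2 hneg)
      have := (hb x hx).1
      exact_mod_cast (by simpa using this : 0 ≤ β x)
    have hPm : MeasurableSet {x | 0 < β x} := hβ (MeasurableSet.of_discrete (s := Set.Ioi 0))
    have hQm : MeasurableSet {x | β x < 0} := hβ (MeasurableSet.of_discrete (s := Set.Iio 0))
    obtain ⟨γ, hγ, A, B, E₂, hA, hE₂, hAP, hBQ, hT, hE₂inv, hQB, hPA⟩ :=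
      𝒢.exists_matching hPm hQm (Set.disjoint_left.2 fun x (h1 : 0 < β x) (h2 : β x < 0) =>
        by omega)
    have hTm := 𝒢.measurable_translateUnit hγ
    let a : X → ℤ := A.indicator 1
    have ham : Measurable a := measurable_one.indicator hA
    -- Adding `w₁` moves one unit of mass from each point of `A`, where `β > 0`, to its partner in
    -- `B`, where `β < 0`; the integral over an invariant set does not change.
    let w₁ : X → ℝ := fun x => A.indicator 1 (𝒢.translateUnit hγ x) - A.indicator 1 x
    have hA1 : IsBddMeasurable (A.indicator (1 : X → ℝ)) :=
      (IsBddMeasurable.const 1).indicator hA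
    have hw₁ : (fun g => w₁ (𝒢.s g)) ∈ 𝒢.coboundaries := by
      have h := sub_mem_coboundaries hγ (hA1.comp 𝒢.measurable_s)
      simpa only [𝒢.s_translate] using h
    let β' : X → ℤ := fun x => β x + (a (𝒢.translateUnit hγ x) - a x)
    have hβ' : Measurable β' := hβ.add ((ham.comp hTm).sub ham)
    have hββ' : ∀ x, (β' x : ℝ) = β x + w₁ x := fun x => by
      have h : ∀ y, ((a y : ℤ) : ℝ) = A.indicator 1 y := fun y => by
        by_cases hy : y ∈ A <;> simp [a, hy]
      simp only [β', w₁, Int.cast_add, Int.cast_sub, h]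
    have hval : ∀ x, (x ∈ A ∧ x ∉ B ∧ 0 < β x ∧ β' x = β x - 1) ∨
        (x ∈ B ∧ x ∉ A ∧ β x < 0 ∧ β' x = β x + 1) ∨ (x ∉ A ∧ x ∉ B ∧ β' x = β x) := by
      intro x
      by_cases hxA : x ∈ A
      · have h1 : 0 < β x := hAP hxA
        have h2 : x ∉ B := fun h => by
          have : β x < 0 := hBQ h
          omega
        exact Or.inl ⟨hxA, h2, h1, by simp [β', a, hxA, hT x, h2]; ring⟩
      · by_cases hxB : x ∈ B
        · exact Or.inr (Or.inl ⟨hxB, hxA, hBQ hxB, by simp [β', a, hxA, hT x, hxB]⟩)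
        · exact Or.inr (Or.inr ⟨hxA, hxB, by simp [β', a, hxA, hT x, hxB]⟩)
    have hb' : ∀ x ∈ E, -((k + 1 : ℕ) : ℤ) ≤ β' x ∧ β' x ≤ (l + 1 : ℕ) := fun x hx => by
      have h1 := hb x hx
      push_cast at h1 ⊢
      rcases hval x with h | h | h <;> omega
    have hTE : ∀ x, 𝒢.translateUnit hγ x ∈ E ↔ x ∈ E := fun x => by
      rw [translateUnit, hinv, 𝒢.t_fibreElt]
    have hneg' : ∫ x in E, (β' x : ℝ) ∂μ < 0 := by
      have h1 : IntegrableOn w₁ E μ := ((hA1.comp hTm).sub hA1).integrable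
      have h2 : ∫ x in E, w₁ x ∂μ = 0 := by
        rw [integral_sub (hA1.comp hTm).integrable hA1.integrable, sub_eq_zero,
          ← integral_indicator hE, ← integral_indicator hE]
        rw [← (hμ.measurePreserving_translateUnit hγ).integral_comp_of_measurable
          (f := E.indicator (A.indicator 1)) (hA1.indicator hE).1]
        congr 1
        ext x
        by_cases hx : x ∈ E
        · simp [Set.indicator, hTE x, hx]
        · simp [Set.indicator, hTE x, hx]
      simp only [hββ']
      rw [integral_add (integrableOn_intCast hβ hE hb) h1, h2, add_zero]
      exact hneg
    have hint := integrableOn_intCast (μ := μ) hβ' hE hb'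
    rw [← integral_inter_add_sdiff hE₂ hint] at hneg'
    -- Within `E₂` every negative value has been raised, improving the lower bound; off `E₂` every
    -- positive value has been lowered, improving the upper bound. The integral is negative over one
    -- of the two parts.
    have main : ∃ (F : Set X) (w : X → ℝ), MeasurableSet F ∧ (∀ g, 𝒢.s g ∈ F ↔ 𝒢.t g ∈ F) ∧
        0 < μ F ∧ (fun g => w (𝒢.s g)) ∈ 𝒢.coboundaries ∧ ∀ x ∈ F, (β' x : ℝ) + w x ≤ 0 := by
      rcases lt_or_ge (∫ x in E ∩ E₂, (β' x : ℝ) ∂μ) 0 with h | h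
      · refine ih k (l + 1) (by omega) β' hβ' (E ∩ E₂) (hE.inter hE₂)
          (fun g => and_congr (hinv g) (hE₂inv g)) (fun x hx => ⟨?_, (hb' x hx.1).2⟩) h
        have h1 := hb x hx.1
        have h2 := hQB x hx.2
        simp only [Set.mem_ofPred_eq] at h2
        push_cast at h1 ⊢
        rcases hval x with h | h | ⟨-, h3, h4⟩
        · omega
        · omega
        · have : ¬ β x < 0 := fun h => h3 (h2 h)
          omega
      · refine ih (k + 1) l (by omega) β' hβ' (E \ E₂) (hE.diff hE₂)
          (fun g => and_congr (hinv g) (not_congr (hE₂inv g)))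
          (fun x hx => ⟨(hb' x hx.1).1, ?_⟩) (by linarith)
        have h1 := hb x hx.1
        have h2 := hPA x hx.2
        simp only [Set.mem_ofPred_eq] at h2
        push_cast at h1 ⊢
        rcases hval x with h | h | ⟨h3, -, h4⟩
        · omega
        · omega
        · have : ¬ 0 < β x := fun h => h3 (h2 h)
          omega
    obtain ⟨F, w, hF, hFinv, hF0, hw, hle⟩ := main
    refine ⟨F, w₁ + w, hF, hFinv, hF0, Submodule.add_mem _ hw₁ hw, fun x hx => ?_⟩
    have := hle x hx
    rw [hββ'] at this
    simp only [Pi.add_apply]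
    linarith

/-- A bounded function with negative integral can be made negative, uniformly on an invariant set
of positive measure, by adding a coboundary. -/
theorem IsPMP.exists_coboundary (hμ : 𝒢.IsPMP μ) {b : X → ℝ} (hb : IsBddMeasurable b)
    (hneg : ∫ x, b x ∂μ < 0) :
    ∃ (F : Set X) (w : X → ℝ) (ε : ℝ), MeasurableSet F ∧ (∀ g, 𝒢.s g ∈ F ↔ 𝒢.t g ∈ F) ∧
      0 < μ F ∧ 0 < ε ∧ (fun g => w (𝒢.s g)) ∈ 𝒢.coboundaries ∧ ∀ x ∈ F, b x + w x ≤ -ε := by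
  have := hμ.1
  obtain ⟨ε, hε, hε2⟩ : ∃ ε : ℝ, 0 < ε ∧ ∫ x, b x ∂μ + 2 * ε < 0 :=
    ⟨-(∫ x, b x ∂μ) / 4, by linarith, by linarith⟩
  -- The added 1 is the margin: `b ≤ ε (β - 1)` turns `β + w ≤ 0` into `b + ε w ≤ -ε`. It costs at
  -- most `2 ε` together with the rounding, which the choice of `ε` allows.
  let β : X → ℤ := fun x => ⌈b x / ε⌉ + 1
  have hβ : Measurable β := ((hb.1.div_const ε).ceil).add measurable_const
  have h1 : ∀ x, b x ≤ ε * (β x - 1) := fun x => by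
    have := Int.le_ceil (b x / ε)
    simp only [β, Int.cast_add, Int.cast_one, add_sub_cancel_right]
    rw [div_le_iff₀ hε] at this
    linarith
  have h2 : ∀ x, ε * β x ≤ b x + 2 * ε := fun x => by
    have := (Int.ceil_lt_add_one (b x / ε)).le
    have h3 := mul_le_mul_of_nonneg_left this hε.le
    rw [mul_add, mul_div_cancel₀ _ hε.ne'] at h3
    simp only [β, Int.cast_add, Int.cast_one]
    linarith
  obtain ⟨-, C, hC⟩ := id hb
  obtain ⟨k, hk⟩ := exists_nat_ge (C / ε + 2)
  have hk' : C + 2 * ε ≤ ε * k := by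
    have h3 := mul_le_mul_of_nonneg_left hk hε.le
    rw [mul_add, mul_div_cancel₀ _ hε.ne'] at h3
    linarith
  have hbd : ∀ x ∈ Set.univ, -(k : ℤ) ≤ β x ∧ β x ≤ k := fun x _ => by
    have h3 := abs_le.1 (hC x)
    have h4 := h1 x
    have h5 := h2 x
    constructor
    · have : -(k : ℝ) ≤ β x := by
        refine le_of_mul_le_mul_left ?_ hε
        linarith
      exact_mod_cast this
    · have : (β x : ℝ) ≤ k := by
        refine le_of_mul_le_mul_left ?_ hε
        linarith
      exact_mod_cast this
  have hint := integrableOn_intCast (μ := μ) hβ MeasurableSet.univ hbd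
  rw [integrableOn_univ] at hint
  have hβneg : ∫ x in Set.univ, (β x : ℝ) ∂μ < 0 := by
    rw [setIntegral_univ]
    have h3 := integral_mono (hint.const_mul ε) (hb.integrable.add (integrable_const (2 * ε))) h2
    simp only [Pi.add_apply] at h3
    rw [integral_const_mul, integral_add hb.integrable (integrable_const _)] at h3
    simp only [integral_const, probReal_univ, one_smul] at h3
    by_contra! h4
    linarith [mul_nonneg hε.le h4]
  obtain ⟨F, w, hF, hFinv, hF0, hw, hle⟩ := hμ.exists_coboundary_int (k + k) k k rfl β hβ Set.univ
    MeasurableSet.univ (fun _ => Iff.rfl) hbd hβneg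
  refine ⟨F, ε • w, ε, hF, hFinv, hF0, hε, Submodule.smul_mem _ ε hw, fun x hx => ?_⟩
  have h3 := h1 x
  have h4 := mul_nonpos_of_nonneg_of_nonpos hε.le (hle x hx)
  simp only [Pi.smul_apply, smul_eq_mul]
  linarith

end DiscreteBorelGroupoid

/-! ### Almost invariant vectors from norm one -/

/-- If the average of finitely many isometries, one of which is the identity, has norm `1`, then
these isometries have almost invariant vectors. -/
theorem exists_almost_invariant_of_norm_average {H ι : Type*} [NormedAddCommGroup H]
    [InnerProductSpace ℂ H] [Fintype ι] (U : ι → H →ₗᵢ[ℂ] H) {i₀ : ι} (hi₀ : ∀ ξ, U i₀ ξ = ξ)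
    {P : H →L[ℂ] H} (hP : ∀ ξ, P ξ = (Fintype.card ι : ℂ)⁻¹ • ∑ i, U i ξ) (hP1 : ‖P‖ = 1)
    {δ : ℝ} (hδ : 0 < δ) :
    ∃ ξ : H, ‖ξ‖ ≤ 1 ∧ 1 / 2 ≤ ‖ξ‖ ∧ ∀ i, ‖U i ξ - ξ‖ ≤ δ := by
  classical
  have hN : 0 < (Fintype.card ι : ℝ) := by
    have : Nonempty ι := ⟨i₀⟩
    exact_mod_cast Fintype.card_pos
  -- For N isometries the final estimate is ‖U ξ − ξ‖² ≤ 4 − (2 − Nη)² ≤ 4Nη when Nη ≤ 2, and 4 ≤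
  -- 4Nη otherwise; `η ≤ 1 / 2` gives the lower bound on `‖ξ‖`.
  obtain ⟨η, hη, hη1, hη2⟩ : ∃ η : ℝ, 0 < η ∧ η ≤ 1 / 2 ∧ 4 * Fintype.card ι * η ≤ δ ^ 2 := by
    refine ⟨min (1 / 2) (δ ^ 2 / (4 * Fintype.card ι)), by positivity, min_le_left _ _, ?_⟩
    have := min_le_right (1 / 2) (δ ^ 2 / (4 * (Fintype.card ι : ℝ)))
    rwa [le_div_iff₀ (by positivity), mul_comm] at this
  obtain ⟨ξ, hξ1, hξ⟩ := P.exists_lt_apply_of_lt_opNorm (r := 1 - η) (by rw [hP1]; linarith)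
  have hPξ : ‖P ξ‖ = (Fintype.card ι : ℝ)⁻¹ * ‖∑ i, U i ξ‖ := by
    rw [hP, norm_smul, norm_inv, Complex.norm_natCast]
  have hbig : Fintype.card ι * (1 - η) < ‖∑ i, U i ξ‖ := by
    rw [hPξ, inv_mul_eq_div, lt_div_iff₀ hN] at hξ
    linarith
  have hsum : ∀ s : Finset ι, ‖∑ i ∈ s, U i ξ‖ ≤ s.card := fun s => by
    refine (norm_sum_le _ _).trans ?_
    refine (Finset.sum_le_sum fun i _ => (U i).norm_map ξ |>.le.trans hξ1.le).trans ?_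
    simp
  refine ⟨ξ, hξ1.le, ?_, fun i => ?_⟩
  · have h1 : ‖P ξ‖ ≤ ‖ξ‖ := by simpa [hP1] using P.le_opNorm ξ
    linarith
  · rcases eq_or_ne i i₀ with rfl | hi
    · simpa [hi₀] using hδ.le
    have h1 : ∑ j, U j ξ = (U i ξ + ξ) + ∑ j ∈ (Finset.univ.erase i₀).erase i, U j ξ := by
      rw [← Finset.add_sum_erase _ _ (Finset.mem_univ i₀), ← Finset.add_sum_erase _ _
        (Finset.mem_erase.2 ⟨hi, Finset.mem_univ i⟩), hi₀]
      abel
    have h2 : (((Finset.univ.erase i₀).erase i).card : ℝ) = Fintype.card ι - 2 := by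
      have h3 := Finset.card_erase_add_one (Finset.mem_erase.2 ⟨hi, Finset.mem_univ i⟩)
      have h4 := Finset.card_erase_add_one (Finset.mem_univ i₀)
      rw [eq_sub_iff_add_eq]
      rw [Finset.card_univ] at h4
      rw [← h4, ← h3]
      push_cast
      ring
    -- The remaining N − 2 summands contribute at most N − 2, so `U i ξ` and `ξ` must nearly add up
    -- to length 2; the parallelogram law then makes them close.
    have h3 : 2 - Fintype.card ι * η < ‖U i ξ + ξ‖ := by
      have h4 := norm_add_le (U i ξ + ξ) (∑ j ∈ (Finset.univ.erase i₀).erase i, U j ξ)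
      have h5 := hsum ((Finset.univ.erase i₀).erase i)
      rw [← h1] at h4
      linarith
    have h4 := parallelogram_law_with_norm ℂ (U i ξ) ξ
    rw [(U i).norm_map] at h4
    have h5 : ‖ξ‖ * ‖ξ‖ ≤ 1 := mul_le_one₀ hξ1.le (norm_nonneg _) hξ1.le
    refine abs_le_of_sq_le_sq' ?_ hδ.le |>.2
    have h6 : 4 - 4 * Fintype.card ι * η ≤ ‖U i ξ + ξ‖ * ‖U i ξ + ξ‖ := by
      rcases le_total 0 (2 - Fintype.card ι * η) with h | h
      · have := mul_self_le_mul_self h h3.le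
        nlinarith [sq_nonneg (Fintype.card ι * η)]
      · nlinarith [mul_self_nonneg ‖U i ξ + ξ‖]
    nlinarith

/-! ### The uniform field on finitely many elements of the full group -/

namespace DiscreteBorelGroupoid

variable {X G : Type*} [MeasurableSpace X] [MeasurableSpace G] {𝒢 : DiscreteBorelGroupoid X G}
  {μ : Measure X}

/-- The average of the units and of finitely many sets of arrows and their inverses. -/
noncomputable def averageField (𝒢 : DiscreteBorelGroupoid X G) {n : ℕ} (γ : Fin n → Set G)
    (g : G) : ℂ :=
  (Fintype.card (Option (Fin n ⊕ Fin n)) : ℂ)⁻¹ *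
    ∑ j : Option (Fin n ⊕ Fin n), (j.elim (Set.range 𝒢.unit)
      (Sum.elim γ fun i => 𝒢.setInv (γ i))).indicator 1 g

theorem averageElem_mem {n : ℕ} {γ : Fin n → Set G} (hγ : ∀ i, γ i ∈ 𝒢.fullGroup)
    (j : Option (Fin n ⊕ Fin n)) :
    j.elim (Set.range 𝒢.unit) (Sum.elim γ fun i => 𝒢.setInv (γ i)) ∈ 𝒢.fullGroup := by
  rcases j with _ | i | i
  · exact 𝒢.range_unit_mem_fullGroup
  · exact hγ i
  · exact 𝒢.setInv_mem_fullGroup (hγ i)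

theorem hasSum_mul_indicator {γ : Set G} (hγ : γ ∈ 𝒢.fullGroup) (x : X)
    (F : {h : G // x = 𝒢.t h} → ℂ) :
    HasSum (fun h => F h * γ.indicator 1 h.1)
      (F ⟨𝒢.fibreElt hγ x, 𝒢.eq_t_fibreElt hγ x⟩) := by
  have h := hasSum_single (f := fun h : {h : G // x = 𝒢.t h} => F h * γ.indicator 1 h.1)
    ⟨𝒢.fibreElt hγ x, 𝒢.eq_t_fibreElt hγ x⟩ fun h hne => by
      have : h.1 ∉ γ := fun hh => hne (Subtype.ext (𝒢.fibreElt_eq hγ hh h.2.symm).symm)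
      simp [this]
  simpa [𝒢.fibreElt_mem hγ x] using h

theorem hasSum_mul_averageField {n : ℕ} {γ : Fin n → Set G} (hγ : ∀ i, γ i ∈ 𝒢.fullGroup) (x : X)
    (F : {h : G // x = 𝒢.t h} → ℂ) :
    HasSum (fun h => F h * 𝒢.averageField γ h.1)
      ((Fintype.card (Option (Fin n ⊕ Fin n)) : ℂ)⁻¹ *
        ∑ j, F ⟨𝒢.fibreElt (averageElem_mem hγ j) x, 𝒢.eq_t_fibreElt _ x⟩) := by
  have h := (hasSum_sum fun j (_ : j ∈ Finset.univ) =>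
    hasSum_mul_indicator (averageElem_mem hγ j) x F).mul_left
      (Fintype.card (Option (Fin n ⊕ Fin n)) : ℂ)⁻¹
  refine h.congr_fun fun h => ?_
  rw [averageField, ← Finset.mul_sum]
  ring

theorem indicator_setInv (A : Set G) (g : G) :
    (𝒢.setInv A).indicator (1 : G → ℂ) g = A.indicator 1 (𝒢.inv g) := by
  by_cases h : 𝒢.inv g ∈ A
  · rw [Set.indicator_of_mem h, Set.indicator_of_mem (𝒢.mem_setInv.2 h), Pi.one_apply,
      Pi.one_apply]
  · rw [Set.indicator_of_notMem h, Set.indicator_of_notMem fun h' => h (𝒢.mem_setInv.1 h')]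

/-- Inversion fixes the units and exchanges the two copies of `Fin n`. -/
theorem averageField_inv {n : ℕ} (γ : Fin n → Set G) (g : G) :
    𝒢.averageField γ (𝒢.inv g) = 𝒢.averageField γ g := by
  have h0 : 𝒢.setInv (Set.range 𝒢.unit) = Set.range 𝒢.unit := by
    rw [setInv, ← Set.range_comp]
    exact congrArg Set.range (funext 𝒢.inv_unit)
  simp only [averageField, Fintype.sum_option, Fintype.sum_sum_type, Option.elim_none,
    Option.elim_some, Sum.elim_inl, Sum.elim_inr, indicator_setInv, 𝒢.inv_inv]
  rw [← indicator_setInv (𝒢 := 𝒢), h0, add_comm (∑ i, (γ i).indicator 1 g)]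

theorem averageField_nonneg {n : ℕ} (γ : Fin n → Set G) (g : G) : 0 ≤ 𝒢.averageField γ g := by
  refine mul_nonneg (inv_nonneg.2 (Nat.cast_nonneg _)) (Finset.sum_nonneg fun j _ => ?_)
  exact Set.indicator_nonneg (fun _ _ => zero_le_one) g

theorem hasSum_averageField {n : ℕ} {γ : Fin n → Set G} (hγ : ∀ i, γ i ∈ 𝒢.fullGroup) (x : X) :
    HasSum (fun h : 𝒢.t ⁻¹' {x} => 𝒢.averageField γ h) 1 := by
  have h := hasSum_mul_averageField hγ x fun _ => 1
  have h1 : (Fintype.card (Option (Fin n ⊕ Fin n)) : ℂ) ≠ 0 :=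
    Nat.cast_ne_zero.2 Fintype.card_ne_zero
  simp only [one_mul, Finset.sum_const, Finset.card_univ, nsmul_eq_mul, mul_one,
    inv_mul_cancel₀ h1] at h
  let e : 𝒢.t ⁻¹' {x} ≃ {h : G // x = 𝒢.t h} := Equiv.subtypeEquivRight fun h => eq_comm
  exact (e.hasSum_iff (f := fun h : {h : G // x = 𝒢.t h} => 𝒢.averageField γ h)).2 h

theorem isSymmetricProbField_averageField {n : ℕ} {γ : Fin n → Set G}
    (hγ : ∀ i, γ i ∈ 𝒢.fullGroup) : 𝒢.IsSymmetricProbField μ (𝒢.averageField γ) where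
  measurable := (Finset.measurable_sum _ fun j _ => measurable_one.indicator
    (𝒢.mem_fullGroup_iff.1 (averageElem_mem hγ j)).1).const_mul _
  symmetric := ae_of_all _ fun g => by
    rw [averageField_inv]
    exact (Complex.conj_eq_iff_im.2 (Complex.nonneg_iff.1 (averageField_nonneg γ g)).2.symm).symm
  nonneg := ae_of_all _ (averageField_nonneg γ)
  hasSum_one := ae_of_all _ (hasSum_averageField hγ)

end DiscreteBorelGroupoid

/-! ### Kesten's criterion prevents uniformly negative coboundaries -/

theorem MeasureTheory.Lp.integrable_norm_sq {Ω : Type*} [MeasurableSpace Ω] {ν : Measure Ω}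
    (ξ : Lp ℂ 2 ν) : Integrable (fun g => ‖ξ g‖ ^ 2) ν :=
  (memLp_two_iff_integrable_sq_norm (Lp.aestronglyMeasurable ξ)).1 (Lp.memLp ξ)

theorem MeasureTheory.Lp.integral_norm_sq {Ω : Type*} [MeasurableSpace Ω] {ν : Measure Ω}
    (ξ : Lp ℂ 2 ν) : ∫ g, ‖ξ g‖ ^ 2 ∂ν = ‖ξ‖ ^ 2 := by
  have h := L2.inner_def (𝕜 := ℂ) ξ ξ
  simp only [inner_self_eq_norm_sq_to_K] at h
  apply Complex.ofReal_injective
  rw [← integral_complex_ofReal]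
  simpa using h.symm

namespace DiscreteBorelGroupoid

variable {X G : Type*} [MeasurableSpace X] [MeasurableSpace G] {𝒢 : DiscreteBorelGroupoid X G}
  {μ : Measure X}

/-- Factor the difference of squares and apply the arithmetic–geometric mean inequality with weight
`δ`; integrated termwise, this replaces Cauchy–Schwarz. -/
theorem abs_norm_sq_sub_norm_sq_le {a b : ℂ} {δ : ℝ} (hδ : 0 < δ) :
    |‖a‖ ^ 2 - ‖b‖ ^ 2| ≤ δ⁻¹ * ‖b - a‖ ^ 2 + δ / 2 * (‖a‖ ^ 2 + ‖b‖ ^ 2) := by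
  have h1 : |‖a‖ - ‖b‖| ≤ ‖b - a‖ := by rw [norm_sub_rev]; exact abs_norm_sub_norm_le a b
  have h2 : |‖a‖ ^ 2 - ‖b‖ ^ 2| ≤ ‖b - a‖ * (‖a‖ + ‖b‖) := by
    rw [sq_sub_sq, abs_mul, abs_of_nonneg (by positivity : 0 ≤ ‖a‖ + ‖b‖), mul_comm]
    exact mul_le_mul_of_nonneg_right h1 (by positivity)
  have h3 : δ * (‖b - a‖ * (‖a‖ + ‖b‖)) ≤
      δ * (δ⁻¹ * ‖b - a‖ ^ 2 + δ / 2 * (‖a‖ ^ 2 + ‖b‖ ^ 2)) := by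
    rw [mul_add δ (δ⁻¹ * _), mul_inv_cancel_left₀ hδ.ne']
    nlinarith [sq_nonneg (‖b - a‖ - δ / 2 * (‖a‖ + ‖b‖)),
      mul_nonneg (sq_nonneg δ) (sq_nonneg (‖a‖ - ‖b‖))]
  exact h2.trans (le_of_mul_le_mul_left h3 hδ)

/-- The densities of almost invariant vectors almost annihilate coboundaries. -/
theorem neg_le_integral_coboundary {γ : Set G} (hγ : γ ∈ 𝒢.fullGroup) {φ : G → ℝ}
    (hφ : IsBddMeasurable φ) {C : ℝ} (hC0 : 0 ≤ C) (hC : ∀ g, |φ g| ≤ C) {δ : ℝ} (hδ : 0 < δ)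
    {ξ : Lp ℂ 2 (𝒢.targetMeasure μ)} (hξ : ‖ξ‖ ≤ 1)
    (hδξ : ‖Lp.compMeasurePreserving _ (𝒢.measurePreserving_translate μ hγ) ξ - ξ‖ ≤ δ) :
    -(C * (2 * δ)) ≤
      ∫ g, (φ (𝒢.translate hγ g) - φ g) * ‖ξ g‖ ^ 2 ∂(𝒢.targetMeasure μ) := by
  have hmp := 𝒢.measurePreserving_translate μ hγ
  have hφT := hφ.comp (𝒢.measurable_translate hγ)
  have hUξ : ∀ᵐ g ∂(𝒢.targetMeasure μ), Lp.compMeasurePreserving _ hmp ξ g =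
    ξ (𝒢.translate hγ g) := Lp.coeFn_compMeasurePreserving ξ hmp
  have hnU : ‖Lp.compMeasurePreserving _ hmp ξ‖ ≤ 1 := by
    rwa [Lp.norm_compMeasurePreserving]
  have hi := Lp.integrable_norm_sq ξ
  have hiU := Lp.integrable_norm_sq (Lp.compMeasurePreserving _ hmp ξ)
  have hid := Lp.integrable_norm_sq (Lp.compMeasurePreserving _ hmp ξ - ξ)
  have h1 : ∫ g, φ g * ‖ξ g‖ ^ 2 ∂(𝒢.targetMeasure μ) = ∫ g, φ (𝒢.translate hγ g) *
      ‖Lp.compMeasurePreserving _ hmp ξ g‖ ^ 2 ∂(𝒢.targetMeasure μ) := by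
    rw [← hmp.integral_comp_of_measurable (f := fun g => φ g * ‖ξ g‖ ^ 2)
      (hφ.1.mul ((Lp.stronglyMeasurable ξ).measurable.norm.pow_const 2))]
    exact integral_congr_ae (hUξ.mono fun g hg => by simp only [hg])
  -- Translation invariance of `μ_t` moves the difference from `φ` to the density, and the density
  -- changes by at most `2 δ` in L¹.
  have h2 : ∫ g, (φ (𝒢.translate hγ g) - φ g) * ‖ξ g‖ ^ 2 ∂(𝒢.targetMeasure μ) =
      ∫ g, φ (𝒢.translate hγ g) * (‖ξ g‖ ^ 2 - ‖Lp.compMeasurePreserving _ hmp ξ g‖ ^ 2)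
        ∂(𝒢.targetMeasure μ) := by
    simp only [sub_mul, mul_sub]
    rw [integral_sub (integrable_bdd_mul hφT hi) (integrable_bdd_mul hφ hi), h1,
      integral_sub (integrable_bdd_mul hφT hi) (integrable_bdd_mul hφT hiU)]
  rw [h2]
  have h3 : ∀ᵐ g ∂(𝒢.targetMeasure μ),
      -(C * (δ⁻¹ * ‖(Lp.compMeasurePreserving _ hmp ξ - ξ : Lp ℂ 2 (𝒢.targetMeasure μ)) g‖ ^ 2 +
        δ / 2 * (‖ξ g‖ ^ 2 + ‖Lp.compMeasurePreserving _ hmp ξ g‖ ^ 2))) ≤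
      φ (𝒢.translate hγ g) * (‖ξ g‖ ^ 2 - ‖Lp.compMeasurePreserving _ hmp ξ g‖ ^ 2) := by
    filter_upwards [Lp.coeFn_sub (Lp.compMeasurePreserving _ hmp ξ) ξ] with g hg
    rw [hg, Pi.sub_apply]
    refine (abs_le.1 ?_).1
    rw [abs_mul]
    exact mul_le_mul (hC _) (abs_norm_sq_sub_norm_sq_le hδ) (abs_nonneg _) hC0
  have his : Integrable (fun g => ‖ξ g‖ ^ 2 + ‖Lp.compMeasurePreserving _ hmp ξ g‖ ^ 2)
    (𝒢.targetMeasure μ) := hi.add hiU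
  have h4 := integral_mono_ae
    (((hid.const_mul δ⁻¹).add (his.const_mul (δ / 2))).const_mul C).neg
    (integrable_bdd_mul hφT (hi.sub hiU)) h3
  refine le_trans ?_ h4
  simp only [Pi.neg_apply, Pi.add_apply]
  rw [integral_neg, integral_const_mul, integral_add (hid.const_mul δ⁻¹)
    (his.const_mul (δ / 2)), integral_const_mul, integral_const_mul, integral_add hi hiU, Lp.integral_norm_sq, Lp.integral_norm_sq, Lp.integral_norm_sq]
  refine neg_le_neg (mul_le_mul_of_nonneg_left ?_ hC0)
  have h5 : δ⁻¹ * ‖Lp.compMeasurePreserving _ hmp ξ - ξ‖ ^ 2 ≤ δ := by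
    rw [inv_mul_le_iff₀ hδ, ← sq]
    exact pow_le_pow_left₀ (norm_nonneg _) hδξ 2
  have h6 : ‖ξ‖ ^ 2 ≤ 1 := pow_le_one₀ (norm_nonneg _) hξ
  have h7 : ‖Lp.compMeasurePreserving _ hmp ξ‖ ^ 2 ≤ 1 := pow_le_one₀ (norm_nonneg _) hnU
  nlinarith

theorem IsMarkovOperator.averageField_apply {n : ℕ} {γ : Fin n → Set G}
    (hγ : ∀ i, γ i ∈ 𝒢.fullGroup)
    {P : Lp ℂ 2 (𝒢.targetMeasure μ) →L[ℂ] Lp ℂ 2 (𝒢.targetMeasure μ)}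
    (hP : 𝒢.IsMarkovOperator μ (𝒢.averageField γ) P) (ξ : Lp ℂ 2 (𝒢.targetMeasure μ)) :
    P ξ = (Fintype.card (Option (Fin n ⊕ Fin n)) : ℂ)⁻¹ • ∑ j, Lp.compMeasurePreservingₗᵢ ℂ _
      (𝒢.measurePreserving_translate μ (averageElem_mem hγ j)) ξ := by
  refine Lp.ext ?_
  have h1 := ae_all_iff.2 fun j => Lp.coeFn_compMeasurePreserving ξ
    (𝒢.measurePreserving_translate μ (averageElem_mem hγ j))
  have h2 := Lp.coeFn_fun_finsetSum Finset.univ fun j => Lp.compMeasurePreservingₗᵢ ℂ _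
      (𝒢.measurePreserving_translate μ (averageElem_mem hγ j)) ξ
  filter_upwards [hP ξ, h1, h2, Lp.coeFn_smul (Fintype.card (Option (Fin n ⊕ Fin n)) : ℂ)⁻¹
    (∑ j, Lp.compMeasurePreservingₗᵢ ℂ _
      (𝒢.measurePreserving_translate μ (averageElem_mem hγ j)) ξ)] with g h3 h4 h5 h6
  rw [h6, Pi.smul_apply, h5, smul_eq_mul,
    h3.unique (hasSum_mul_averageField hγ (𝒢.s g) fun h => ξ (𝒢.mul g h.1 h.2))]
  congr 2
  ext j
  exact (h4 j).symm

/-- If an averaging Markov operator has norm `1`, then there are almost invariant vectors. -/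
theorem IsMarkovOperator.exists_almost_invariant {n : ℕ} {γ : Fin n → Set G}
    (hγ : ∀ i, γ i ∈ 𝒢.fullGroup)
    {P : Lp ℂ 2 (𝒢.targetMeasure μ) →L[ℂ] Lp ℂ 2 (𝒢.targetMeasure μ)}
    (hP : 𝒢.IsMarkovOperator μ (𝒢.averageField γ) P) (hP1 : ‖P‖ = 1) {δ : ℝ} (hδ : 0 < δ) :
    ∃ ξ : Lp ℂ 2 (𝒢.targetMeasure μ), ‖ξ‖ ≤ 1 ∧ 1 / 2 ≤ ‖ξ‖ ∧ ∀ i,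
      ‖Lp.compMeasurePreserving _ (𝒢.measurePreserving_translate μ (hγ i)) ξ - ξ‖ ≤ δ := by
  have h0 : ∀ ξ : Lp ℂ 2 (𝒢.targetMeasure μ), Lp.compMeasurePreservingₗᵢ ℂ _
      (𝒢.measurePreserving_translate μ (averageElem_mem hγ none)) ξ = ξ := fun ξ => by
    refine Lp.ext ?_
    filter_upwards [Lp.coeFn_compMeasurePreserving ξ
      (𝒢.measurePreserving_translate μ (averageElem_mem hγ none))] with g hg
    exact hg.trans (congrArg ξ (𝒢.translate_range_unit g))
  have h1 := hP.averageField_apply hγ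
  generalize hU : (fun j => Lp.compMeasurePreservingₗᵢ (E := ℂ) (p := 2) ℂ _
    (𝒢.measurePreserving_translate μ (averageElem_mem hγ j))) = U at *
  have hU' := fun j => congrFun hU j
  simp only [hU'] at h0 h1
  obtain ⟨ξ, hξ1, hξ2, hξ⟩ := exists_almost_invariant_of_norm_average U (i₀ := none) h0 h1 hP1 hδ
  subst hU
  exact ⟨ξ, hξ1, hξ2, fun i => hξ (some (Sum.inl i))⟩

/-- If an averaging Markov operator has norm `1`, then coboundaries are not uniformly negative. -/
theorem IsMarkovOperator.not_ae_sum_coboundary_le {n : ℕ} {γ : Fin n → Set G}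
    (hγ : ∀ i, γ i ∈ 𝒢.fullGroup)
    {P : Lp ℂ 2 (𝒢.targetMeasure μ) →L[ℂ] Lp ℂ 2 (𝒢.targetMeasure μ)}
    (hP : 𝒢.IsMarkovOperator μ (𝒢.averageField γ) P) (hP1 : ‖P‖ = 1) {φ : Fin n → G → ℝ}
    (hφ : ∀ i, IsBddMeasurable (φ i)) {ε : ℝ} (hε : 0 < ε) :
    ¬ ∀ᵐ g ∂(𝒢.targetMeasure μ), ∑ i, (φ i (𝒢.translate (hγ i) g) - φ i g) ≤ -ε := by
  intro hle
  choose C hC using fun i => (hφ i).2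
  let D := ∑ i, |C i|
  have hD : 0 ≤ D := Finset.sum_nonneg fun i _ => abs_nonneg _
  -- Since `‖ξ‖² ≥ 1/4`, a coboundary at most `-ε` has integral at most `-ε / 4` against `|ξ|²`,
  -- while almost invariance keeps it at least `-(2 δ D)`.
  obtain ⟨δ, hδ, hδ1⟩ : ∃ δ : ℝ, 0 < δ ∧ D * (2 * δ) < ε / 4 := by
    refine ⟨ε / (16 * (D + 1)), by positivity, ?_⟩
    rw [← mul_div_assoc, ← mul_div_assoc, div_lt_div_iff₀ (by positivity) (by positivity)]
    nlinarith
  obtain ⟨ξ, hξ1, hξ2, hξ⟩ := hP.exists_almost_invariant hγ hP1 hδ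
  have hi := Lp.integrable_norm_sq ξ
  have hterm : ∀ i, IsBddMeasurable fun g => φ i (𝒢.translate (hγ i) g) - φ i g := fun i =>
    ((hφ i).comp (𝒢.measurable_translate _)).sub (hφ i)
  have h1 : ∀ i, -(|C i| * (2 * δ)) ≤
      ∫ g, (φ i (𝒢.translate (hγ i) g) - φ i g) * ‖ξ g‖ ^ 2 ∂(𝒢.targetMeasure μ) := fun i =>
    neg_le_integral_coboundary (hγ i) (hφ i) (abs_nonneg _) (fun g => (hC i g).trans (le_abs_self _)) hδ hξ1
      (hξ i)
  have h2 : ∫ g, (∑ i, (φ i (𝒢.translate (hγ i) g) - φ i g)) * ‖ξ g‖ ^ 2 ∂(𝒢.targetMeasure μ) ≤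
      ∫ g, -ε * ‖ξ g‖ ^ 2 ∂(𝒢.targetMeasure μ) := by
    refine integral_mono_ae (integrable_bdd_mul (IsBddMeasurable.sum _ hterm) hi)
      (hi.const_mul _) (hle.mono fun g hg => ?_)
    exact mul_le_mul_of_nonneg_right hg (sq_nonneg _)
  rw [integral_const_mul, Lp.integral_norm_sq] at h2
  simp only [Finset.sum_mul] at h2
  rw [integral_finsetSum _ fun i _ => integrable_bdd_mul (hterm i) hi] at h2
  have h3 := Finset.sum_le_sum fun i (_ : i ∈ Finset.univ) => h1 i
  rw [Finset.sum_neg_distrib, ← Finset.sum_mul] at h3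
  have h4 : (1 / 2 : ℝ) ^ 2 ≤ ‖ξ‖ ^ 2 := pow_le_pow_left₀ (by norm_num) hξ2 2
  have h5 : D * (2 * δ) < ε / 4 := hδ1
  have h6 : (∑ i, |C i|) = D := rfl
  rw [h6] at h3
  nlinarith

theorem averageField_restrict {E : Set X} (hE : MeasurableSet E) {n : ℕ} (γ : Fin n → Set G)
    (g : 𝒢.RestrictArrows E) :
    (𝒢.restrict E hE).averageField (fun i => Subtype.val ⁻¹' γ i) g = 𝒢.averageField γ g.1 := by
  refine congrArg _ (Finset.sum_congr rfl fun j _ => ?_)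
  have key : ∀ (A : Set (𝒢.RestrictArrows E)) (B : Set G), (g ∈ A ↔ g.1 ∈ B) →
      A.indicator (1 : 𝒢.RestrictArrows E → ℂ) g = B.indicator 1 g.1 := fun A B h => by
    by_cases hg : g ∈ A
    · rw [Set.indicator_of_mem hg, Set.indicator_of_mem (h.1 hg), Pi.one_apply, Pi.one_apply]
    · rw [Set.indicator_of_notMem hg, Set.indicator_of_notMem fun h' => hg (h.2 h')]
  refine key _ _ ?_
  rcases j with _ | i | i
  · constructor
    · rintro ⟨x, rfl⟩
      exact ⟨x.1, rfl⟩
    · rintro ⟨x, hx⟩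
      have hxE : x ∈ E := by
        rw [← 𝒢.s_unit x, hx]
        exact g.2.1
      exact ⟨⟨x, hxE⟩, Subtype.ext hx⟩
  · exact Iff.rfl
  · exact ((𝒢.restrict E hE).mem_setInv).trans 𝒢.mem_setInv.symm

theorem exists_sum_of_mem_coboundaries {v : G → ℝ} (hv : v ∈ 𝒢.coboundaries) :
    ∃ (n : ℕ) (γ : Fin n → Set G) (hγ : ∀ i, γ i ∈ 𝒢.fullGroup) (φ : Fin n → G → ℝ),
      (∀ i, IsBddMeasurable (φ i)) ∧
        v = fun g => ∑ i, (φ i (𝒢.translate (hγ i) g) - φ i g) := by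
  obtain ⟨n, c, w, rfl⟩ := Submodule.mem_span_set'.1 hv
  choose γ hγ φ hφ hw using fun i => (w i).2
  refine ⟨n, γ, hγ, fun i g => c i * φ i g, fun i => (hφ i).const_mul (c i), ?_⟩
  ext g
  simp [hw, mul_sub]

/-- Under Kesten's criterion, no coboundary is uniformly negative on the arrows over an invariant
set of positive measure. -/
theorem SatisfiesKesten.not_ae_coboundary_le (hK : 𝒢.SatisfiesKesten μ) {E : Set X}
    (hE : MeasurableSet E) (hinv : ∀ g, 𝒢.s g ∈ E ↔ 𝒢.t g ∈ E) (h0 : 0 < μ E) {v : G → ℝ}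
    (hv : v ∈ 𝒢.coboundaries) {ε : ℝ} (hε : 0 < ε) :
    ¬ ∀ᵐ g ∂(𝒢.targetMeasure μ), 𝒢.s g ∈ E → v g ≤ -ε := by
  intro hle
  obtain ⟨n, γ, hγ, φ, hφ, rfl⟩ := exists_sum_of_mem_coboundaries hv
  obtain ⟨P, hP, hP1⟩ := hK E hE (isInvariant_of_forall_mem_iff hinv) h0 _
    (isSymmetricProbField_averageField hγ)
  have hγ' := fun i => preimage_val_mem_fullGroup hE hinv (hγ i)
  have hP' : (𝒢.restrict E hE).IsMarkovOperator (restrictMeasure μ E)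
      ((𝒢.restrict E hE).averageField fun i => Subtype.val ⁻¹' γ i) P := by
    simpa only [IsMarkovOperator, averageField_restrict] using hP
  refine hP'.not_ae_sum_coboundary_le hγ' hP1 (φ := fun i g => φ i g.1)
    (fun i => (hφ i).comp measurable_subtype_coe) hε ?_
  have h := ae_restrict_arrows (Q := fun g =>
    ∑ i, (φ i (𝒢.translate (hγ i) g) - φ i g) ≤ -ε) hE (hle.mono fun g h h1 _ => h h1)
  filter_upwards [h] with g hg
  simpa only [val_translate_restrict hE (hγ' _) (hγ _) (fun _ h => h)] using hg

end DiscreteBorelGroupoid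

/-! ### Hahn–Banach: a functional annihilating coboundaries -/

namespace DiscreteBorelGroupoid

variable {X G : Type*} [MeasurableSpace X] [MeasurableSpace G] {𝒢 : DiscreteBorelGroupoid X G}
  {μ : Measure X}

/-- The functions on the arrow space that are dominated by an integrable function of the
source. -/
def sourceDominated (𝒢 : DiscreteBorelGroupoid X G) (μ : Measure X) : Submodule ℝ (G → ℝ) where
  carrier := {F | ∃ b : X → ℝ, Integrable b μ ∧ ∀ᵐ g ∂(𝒢.targetMeasure μ), |F g| ≤ b (𝒢.s g)}
  add_mem' := by
    rintro F F' ⟨b, hb, h⟩ ⟨b', hb', h'⟩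
    refine ⟨b + b', hb.add hb', ?_⟩
    filter_upwards [h, h'] with g h1 h2
    exact (abs_add_le _ _).trans (add_le_add h1 h2)
  zero_mem' := ⟨0, integrable_zero _ _ _, by simp⟩
  smul_mem' := by
    rintro c F ⟨b, hb, h⟩
    refine ⟨fun x => |c| * b x, hb.const_mul _, ?_⟩
    filter_upwards [h] with g h1
    rw [Pi.smul_apply, smul_eq_mul, abs_mul]
    exact mul_le_mul_of_nonneg_left h1 (abs_nonneg c)

/-- The integrals of the functions of the source that dominate `F`. -/
def upperIntegrals (𝒢 : DiscreteBorelGroupoid X G) (μ : Measure X) (F : G → ℝ) : Set ℝ :=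
  {r | ∃ b : X → ℝ, Integrable b μ ∧ (∀ᵐ g ∂(𝒢.targetMeasure μ), F g ≤ b (𝒢.s g)) ∧
    ∫ x, b x ∂μ = r}

theorem upperIntegrals_nonempty {F : G → ℝ} (hF : F ∈ 𝒢.sourceDominated μ) :
    (𝒢.upperIntegrals μ F).Nonempty := by
  obtain ⟨b, hb, h⟩ := hF
  exact ⟨_, b, hb, h.mono fun g hg => (le_abs_self _).trans hg, rfl⟩

/-- If `|F| ≤ b ∘ s`, then every dominating function is at least `-b` at almost every source, hence
at almost every unit. -/
theorem bddBelow_upperIntegrals {F : G → ℝ} (hF : F ∈ 𝒢.sourceDominated μ) :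
    BddBelow (𝒢.upperIntegrals μ F) := by
  obtain ⟨b, hb, h⟩ := hF
  refine ⟨∫ x, -b x ∂μ, ?_⟩
  rintro _ ⟨b', hb', h', rfl⟩
  refine integral_mono_ae hb.neg hb' (ae_of_ae_source (𝒢 := 𝒢) ?_)
  filter_upwards [h, h'] with g h1 h2
  exact (neg_le_of_abs_le h1).trans h2

/-- Under Kesten's criterion a function of the source that dominates a coboundary has nonnegative
integral. -/
theorem SatisfiesKesten.integral_nonneg_of_coboundary_le (hK : 𝒢.SatisfiesKesten μ)
    (hμ : 𝒢.IsPMP μ) {v : G → ℝ} (hv : v ∈ 𝒢.coboundaries) {b : X → ℝ} (hb : Integrable b μ)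
    (h : ∀ᵐ g ∂(𝒢.targetMeasure μ), v g ≤ b (𝒢.s g)) : 0 ≤ ∫ x, b x ∂μ := by
  have := hμ.1
  obtain ⟨C, hC⟩ : ∃ C, ∀ g, |v g| ≤ C := by
    obtain ⟨n, γ, hγ, φ, hφ, rfl⟩ := exists_sum_of_mem_coboundaries hv
    exact (IsBddMeasurable.sum _ fun i =>
      ((hφ i).comp (𝒢.measurable_translate (hγ i))).sub (hφ i)).2
  by_contra! hneg
  obtain ⟨b₁, hb₁, hbb₁⟩ := hb.1.aemeasurable
  -- Rearrangement needs a bounded function. As `|v| ≤ C`, truncating to `[-C, C]` preserves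
  -- domination of `v`, and almost everywhere it does not increase `b`, which is at least `-C`.
  let c : X → ℝ := fun x => max (-C) (min C (b₁ x))
  have hc : IsBddMeasurable c := by
    refine ⟨measurable_const.max (measurable_const.min hb₁), |C|, fun x => abs_le.2 ⟨?_, ?_⟩⟩
    · exact (neg_le_neg (le_abs_self C)).trans (le_max_left _ _)
    · exact max_le (neg_le_abs C) ((min_le_left _ _).trans (le_abs_self C))
  have h1 : ∀ᵐ x ∂μ, -C ≤ b x := ae_of_ae_source (𝒢 := 𝒢) (h.mono fun g hg =>
    (neg_le_of_abs_le (hC g)).trans hg)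
  have h2 : ∫ x, c x ∂μ < 0 := by
    refine lt_of_le_of_lt (integral_mono_ae hc.integrable hb ?_) hneg
    filter_upwards [h1, hbb₁] with x h3 h4
    exact max_le h3 ((min_le_right _ _).trans h4.ge)
  have h3 : ∀ᵐ g ∂(𝒢.targetMeasure μ), v g ≤ c (𝒢.s g) := by
    filter_upwards [h, hμ.quasiMeasurePreserving_s.ae hbb₁] with g h4 h5
    refine le_max_of_le_right (le_min (le_of_abs_le (hC g)) ?_)
    rwa [← h5]
  -- Over `F` the coboundary `v + w ∘ s` is at most `(c + w) ∘ s ≤ -ε`, which Kesten's criterion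
  -- excludes.
  obtain ⟨F, w, ε, hF, hFinv, hF0, hε, hw, hle⟩ := hμ.exists_coboundary hc h2
  refine hK.not_ae_coboundary_le hF hFinv hF0 (Submodule.add_mem _ hv hw) hε ?_
  filter_upwards [h3] with g h4 h5
  have := hle _ h5
  rw [Pi.add_apply]
  linarith

/-- Under Kesten's criterion there is an invariant linear functional on the functions on the
arrow space that is dominated by integration of functions of the source. -/
theorem SatisfiesKesten.exists_linearMap (hK : 𝒢.SatisfiesKesten μ) (hμ : 𝒢.IsPMP μ) :
    ∃ m : (G → ℝ) →ₗ[ℝ] ℝ, (∀ v ∈ 𝒢.coboundaries, m v = 0) ∧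
      ∀ F ∈ 𝒢.sourceDominated μ, ∀ b : X → ℝ, Integrable b μ →
        (∀ᵐ g ∂(𝒢.targetMeasure μ), F g ≤ b (𝒢.s g)) → m F ≤ ∫ x, b x ∂μ := by
  let W := 𝒢.sourceDominated μ
  -- The least integral of a function of the source dominating `F`. By
  -- `integral_nonneg_of_coboundary_le` the zero functional on coboundaries lies below it.
  let N : W → ℝ := fun F => sInf (𝒢.upperIntegrals μ F)
  have hV : 𝒢.coboundaries ≤ W := by
    intro v hv
    have := hμ.1
    obtain ⟨n, γ, hγ, φ, hφ, rfl⟩ := exists_sum_of_mem_coboundaries hv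
    obtain ⟨C, hC⟩ := (IsBddMeasurable.sum Finset.univ fun i =>
      ((hφ i).comp (𝒢.measurable_translate (hγ i))).sub (hφ i)).2
    exact ⟨fun _ => C, integrable_const _, ae_of_all _ hC⟩
  have hN_hom : ∀ c : ℝ, 0 < c → ∀ F, N (c • F) = c * N F := by
    have key : ∀ c : ℝ, 0 < c → ∀ F, N (c • F) ≤ c * N F := by
      intro c hc F
      rw [mul_comm, ← div_le_iff₀ hc]
      refine le_csInf (upperIntegrals_nonempty F.2) ?_
      rintro _ ⟨b, hb, h, rfl⟩
      rw [div_le_iff₀ hc, mul_comm]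
      refine csInf_le (bddBelow_upperIntegrals (c • F).2) ⟨fun x => c * b x, hb.const_mul c, ?_,
        integral_const_mul _ _⟩
      filter_upwards [h] with g hg
      exact mul_le_mul_of_nonneg_left hg hc.le
    intro c hc F
    refine le_antisymm (key c hc F) ?_
    have h := key c⁻¹ (inv_pos.2 hc) (c • F)
    rw [inv_smul_smul₀ hc.ne', inv_mul_eq_div, le_div_iff₀ hc] at h
    rwa [mul_comm]
  have hN_add : ∀ F F', N (F + F') ≤ N F + N F' := by
    intro F F'
    rw [← sub_le_iff_le_add]
    refine le_csInf (upperIntegrals_nonempty F.2) ?_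
    rintro _ ⟨b, hb, h, rfl⟩
    rw [sub_le_comm]
    refine le_csInf (upperIntegrals_nonempty F'.2) ?_
    rintro _ ⟨b', hb', h', rfl⟩
    rw [sub_le_iff_le_add', ← integral_add hb hb']
    refine csInf_le (bddBelow_upperIntegrals (F + F').2) ⟨fun x => b x + b' x, hb.add hb', ?_, rfl⟩
    filter_upwards [h, h'] with g h1 h2
    exact add_le_add h1 h2
  obtain ⟨m₀, hm₀, hm₀N⟩ := exists_extension_of_le_sublinear
    (⟨𝒢.coboundaries.comap W.subtype, 0⟩ : W →ₗ.[ℝ] ℝ) N hN_hom hN_add (by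
      rintro ⟨v, hv⟩
      refine le_csInf (upperIntegrals_nonempty v.2) ?_
      rintro _ ⟨b, hb, h, rfl⟩
      exact hK.integral_nonneg_of_coboundary_le hμ hv hb h)
  -- Values outside `W` play no role; a purely algebraic extension makes `m` defined on all
  -- functions.
  obtain ⟨m, hm⟩ := LinearMap.exists_extend m₀
  have hmW : ∀ F (hF : F ∈ W), m F = m₀ ⟨F, hF⟩ := fun F hF => DFunLike.congr_fun hm ⟨F, hF⟩
  refine ⟨m, fun v hv => ?_, fun F hF b hb h => ?_⟩
  · rw [hmW v (hV hv)]
    exact hm₀ ⟨⟨v, hV hv⟩, hv⟩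
  · rw [hmW F hF]
    exact (hm₀N _).trans (csInf_le (bddBelow_upperIntegrals hF) ⟨b, hb, h, rfl⟩)

end DiscreteBorelGroupoid

/-! ### From the functional to a global invariant mean -/

namespace DiscreteBorelGroupoid

variable {X G : Type*} [MeasurableSpace X] [MeasurableSpace G] {𝒢 : DiscreteBorelGroupoid X G}
  {μ : Measure X} {m : (G → ℝ) →ₗ[ℝ] ℝ}

/-- The functional `m` is dominated by integration of functions of the source. -/
def IsSourceDominated (𝒢 : DiscreteBorelGroupoid X G) (μ : Measure X) (m : (G → ℝ) →ₗ[ℝ] ℝ) :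
    Prop :=
  ∀ F ∈ 𝒢.sourceDominated μ, ∀ b : X → ℝ, Integrable b μ →
    (∀ᵐ g ∂(𝒢.targetMeasure μ), F g ≤ b (𝒢.s g)) → m F ≤ ∫ x, b x ∂μ

namespace IsSourceDominated

theorem abs_le (hm : 𝒢.IsSourceDominated μ m) {F : G → ℝ} {b : X → ℝ} (hb : Integrable b μ)
    (h : ∀ᵐ g ∂(𝒢.targetMeasure μ), |F g| ≤ b (𝒢.s g)) : |m F| ≤ ∫ x, b x ∂μ := by
  have hF : F ∈ 𝒢.sourceDominated μ := ⟨b, hb, h⟩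
  refine abs_le'.2 ⟨hm F hF b hb (h.mono fun g hg => le_of_abs_le hg), ?_⟩
  rw [← _root_.map_neg]
  exact hm (-F) (Submodule.neg_mem _ hF) b hb (h.mono fun g hg => neg_le_of_neg_le
    (neg_le_of_abs_le hg))

theorem congr_ae (hm : 𝒢.IsSourceDominated μ m) {F F' : G → ℝ}
    (h : ∀ᵐ g ∂(𝒢.targetMeasure μ), F g = F' g) : m F = m F' := by
  rw [← sub_eq_zero, ← _root_.map_sub, ← abs_nonpos_iff]
  refine (hm.abs_le (integrable_zero X ℝ μ) (h.mono fun g hg => ?_)).trans_eq (by simp)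
  simp [hg]

theorem map_source (hm : 𝒢.IsSourceDominated μ m) {b : X → ℝ} (hb : Integrable b μ) :
    m (fun g => b (𝒢.s g)) = ∫ x, b x ∂μ := by
  have hF : (fun g => b (𝒢.s g)) ∈ 𝒢.sourceDominated μ :=
    ⟨fun x => |b x|, hb.abs, ae_of_all _ fun g => le_rfl⟩
  refine le_antisymm (hm _ hF b hb (ae_of_all _ fun g => le_rfl)) ?_
  have h := hm _ (Submodule.neg_mem _ hF) (-b) hb.neg (ae_of_all _ fun g => le_rfl)
  rw [_root_.map_neg, integral_neg'] at h
  linarith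

/-- The functional `b ↦ m (f · b ∘ s)` is given by a bounded density. -/
theorem exists_density (hm : 𝒢.IsSourceDominated μ m) (hμ : 𝒢.IsPMP μ) {f : G → ℝ} {C : ℝ}
    (hf : ∀ᵐ g ∂(𝒢.targetMeasure μ), |f g| ≤ C) :
    ∃ ψ : X → ℝ, IsBddMeasurable ψ ∧ ∀ S, MeasurableSet S →
      ∫ x in S, ψ x ∂μ = m fun g => f g * S.indicator 1 (𝒢.s g) := by
  have := hμ.1
  let L : Lp ℝ 1 μ →ₗ[ℝ] ℝ :=
    { toFun := fun b => m fun g => f g * b (𝒢.s g)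
      map_add' := fun b b' => by
        rw [← _root_.map_add]
        refine hm.congr_ae ?_
        filter_upwards [hμ.quasiMeasurePreserving_s.ae (Lp.coeFn_add b b')] with g hg
        rw [hg, Pi.add_apply, Pi.add_apply, mul_add]
      map_smul' := fun c b => by
        rw [RingHom.id_apply, ← map_smul]
        refine hm.congr_ae ?_
        filter_upwards [hμ.quasiMeasurePreserving_s.ae (Lp.coeFn_smul c b)] with g hg
        rw [hg, Pi.smul_apply, Pi.smul_apply, smul_eq_mul, smul_eq_mul]
        ring }
  let ℓ : Lp ℝ 1 μ →L[ℝ] ℝ := L.mkContinuous C fun b => by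
    rw [L1.norm_eq_integral_norm, ← integral_const_mul]
    refine hm.abs_le ((L1.integrable_coeFn b).norm.const_mul C) (hf.mono fun g hg => ?_)
    rw [abs_mul]
    exact mul_le_mul_of_nonneg_right hg (abs_nonneg _)
  obtain ⟨ψ, hψ, hψC, h⟩ := exists_bounded_integral_representation ℓ
  refine ⟨ψ, ⟨hψ, _, hψC⟩, fun S hS => ?_⟩
  have h1 := indicatorConstLp_coeFn (p := 1) (hs := hS) (hμs := measure_ne_top μ S) (c := (1 : ℝ))
  have h2 : m (fun g => f g * indicatorConstLp 1 hS (measure_ne_top μ S) (1 : ℝ) (𝒢.s g)) =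
      ∫ x, ψ x * indicatorConstLp 1 hS (measure_ne_top μ S) (1 : ℝ) x ∂μ := h _
  rw [← integral_indicator hS]
  calc ∫ x, S.indicator ψ x ∂μ
      = ∫ x, ψ x * indicatorConstLp 1 hS (measure_ne_top μ S) (1 : ℝ) x ∂μ := by
        refine integral_congr_ae (h1.mono fun x hx => ?_)
        by_cases hxS : x ∈ S <;> simp [hx, hxS]
    _ = _ := by
        rw [← h2]
        refine hm.congr_ae ?_
        filter_upwards [hμ.quasiMeasurePreserving_s.ae h1] with g hg
        rw [hg]
        rfl

end IsSourceDominated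

/-- `Ψ` is the density of the functional that `m` and `F` define on functions of the source. -/
structure Represents (𝒢 : DiscreteBorelGroupoid X G) (μ : Measure X) (m : (G → ℝ) →ₗ[ℝ] ℝ)
    (F : G → ℂ) (Ψ : X → ℂ) : Prop where
  integrable : Integrable Ψ μ
  setIntegral_eq : ∀ (c : ℂ) (S : Set X), MeasurableSet S →
    ∫ x in S, (c * Ψ x).re ∂μ = m fun g => (c * F g).re * S.indicator 1 (𝒢.s g)

namespace Represents

variable {F F' : G → ℂ} {Ψ Ψ' : X → ℂ}

theorem integrable_re (h : Integrable Ψ μ) (c : ℂ) : Integrable (fun x => (c * Ψ x).re) μ :=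
  (h.const_mul c).re

theorem congr_ae (hm : 𝒢.IsSourceDominated μ m) (h : 𝒢.Represents μ m F Ψ)
    (hF : ∀ᵐ g ∂(𝒢.targetMeasure μ), F' g = F g) (hΨ : ∀ᵐ x ∂μ, Ψ' x = Ψ x) :
    𝒢.Represents μ m F' Ψ' := by
  refine ⟨h.integrable.congr (hΨ.mono fun x hx => hx.symm), fun c S hS => ?_⟩
  rw [hm.congr_ae (F' := fun g => (c * F g).re * S.indicator 1 (𝒢.s g))
    (hF.mono fun g hg => by simp only [hg]), ← h.setIntegral_eq c S hS]
  exact integral_congr_ae (ae_restrict_of_ae (hΨ.mono fun x hx => by simp only [hx]))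

theorem add (h : 𝒢.Represents μ m F Ψ) (h' : 𝒢.Represents μ m F' Ψ') :
    𝒢.Represents μ m (fun g => F g + F' g) fun x => Ψ x + Ψ' x := by
  refine ⟨h.integrable.add h'.integrable, fun c S hS => ?_⟩
  have h1 : (fun g => (c * (F g + F' g)).re * S.indicator 1 (𝒢.s g)) =
      (fun g => (c * F g).re * S.indicator 1 (𝒢.s g)) +
        fun g => (c * F' g).re * S.indicator 1 (𝒢.s g) := by
    ext g
    rw [Pi.add_apply, mul_add, Complex.add_re, add_mul]
  rw [h1, map_add, ← h.setIntegral_eq c S hS, ← h'.setIntegral_eq c S hS,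
    ← integral_add (integrable_re h.integrable c).integrableOn
      (integrable_re h'.integrable c).integrableOn]
  simp only [mul_add, Complex.add_re]

/-- The scalar `c` in `Represents` absorbs `a`. Testing against all complex `c` is how a real
functional yields a complex linear map. -/
theorem const_mul (h : 𝒢.Represents μ m F Ψ) (a : ℂ) :
    𝒢.Represents μ m (fun g => a * F g) fun x => a * Ψ x := by
  refine ⟨h.integrable.const_mul a, fun c S hS => ?_⟩
  simpa only [_root_.mul_assoc] using h.setIntegral_eq (c * a) S hS

/-- Domination gives Re(cΨ) ≤ |c| C almost everywhere for each `c`. A countable dense set of `c`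
leaves a single null set; off it, `c` may be taken as the conjugate of `Ψ x`. -/
theorem ae_norm_le (h : 𝒢.Represents μ m F Ψ) (hm : 𝒢.IsSourceDominated μ m) (hμ : 𝒢.IsPMP μ)
    {C : ℝ} (hC : 0 ≤ C) (hF : ∀ᵐ g ∂(𝒢.targetMeasure μ), ‖F g‖ ≤ C) : ∀ᵐ x ∂μ, ‖Ψ x‖ ≤ C := by
  have := hμ.1
  have h1 : ∀ c : ℂ, ∀ᵐ x ∂μ, (c * Ψ x).re ≤ ‖c‖ * C := fun c => by
    refine ae_le_of_forall_setIntegral_le (integrable_re h.integrable c) (integrable_const _)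
      fun S hS _ => ?_
    rw [h.setIntegral_eq c S hS, ← integral_indicator hS]
    refine (le_abs_self _).trans (hm.abs_le ((integrable_const _).indicator hS)
      (hF.mono fun g hg => ?_))
    by_cases hgS : 𝒢.s g ∈ S
    · simp only [hgS, Set.indicator_of_mem, Pi.one_apply, mul_one]
      refine (Complex.abs_re_le_norm _).trans ?_
      rw [norm_mul]
      exact mul_le_mul_of_nonneg_left hg (norm_nonneg c)
    · simp [hgS]
  filter_upwards [ae_all_iff.2 fun n => h1 (TopologicalSpace.denseSeq ℂ n)] with x hx
  have h2 : ∀ c : ℂ, (c * Ψ x).re ≤ ‖c‖ * C := fun c => by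
    refine (TopologicalSpace.denseRange_denseSeq ℂ).induction_on (p := fun c : ℂ =>
      (c * Ψ x).re ≤ ‖c‖ * C) c ?_ hx
    exact isClosed_le (Complex.continuous_re.comp (continuous_mul_const _))
      (continuous_norm.mul continuous_const)
  have h3 := h2 (starRingEnd ℂ (Ψ x))
  rw [mul_comm, Complex.mul_conj, Complex.ofReal_re, Complex.normSq_eq_norm_sq,
    Complex.norm_conj, sq] at h3
  rcases (norm_nonneg (Ψ x)).eq_or_lt with h0 | h0
  · rwa [← h0]
  · exact le_of_mul_le_mul_left h3 h0

/-- The difference of the densities represents zero, so the norm bound with `C = 0` applies. -/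
theorem ae_eq (h : 𝒢.Represents μ m F Ψ) (h' : 𝒢.Represents μ m F Ψ')
    (hm : 𝒢.IsSourceDominated μ m) (hμ : 𝒢.IsPMP μ) : ∀ᵐ x ∂μ, Ψ x = Ψ' x := by
  filter_upwards [(h.add (h'.const_mul (-1))).ae_norm_le hm hμ le_rfl
    (ae_of_all _ fun g => by simp)] with x hx
  rw [norm_le_zero_iff, neg_one_mul, ← sub_eq_add_neg] at hx
  exact sub_eq_zero.1 hx

theorem source (hm : 𝒢.IsSourceDominated μ m) (hΨ : Integrable Ψ μ) :
    𝒢.Represents μ m (fun g => Ψ (𝒢.s g)) Ψ := by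
  refine ⟨hΨ, fun c S hS => ?_⟩
  rw [← integral_indicator hS, ← hm.map_source ((integrable_re hΨ c).indicator hS)]
  congr 1
  ext g
  by_cases hg : 𝒢.s g ∈ S <;> simp [hg]

/-- A change of variables on the units replaces `S` by its translate; the remaining discrepancy on
the arrows is a coboundary up to a null set, and `m` kills it. -/
theorem translate (h : 𝒢.Represents μ m F Ψ) (hm : 𝒢.IsSourceDominated μ m) (hμ : 𝒢.IsPMP μ)
    (hm0 : ∀ v ∈ 𝒢.coboundaries, m v = 0) (hΨ : Measurable Ψ) (hF : Measurable F) {C : ℝ}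
    (hC : ∀ᵐ g ∂(𝒢.targetMeasure μ), ‖F g‖ ≤ C) {γ : Set G} (hγ : γ ∈ 𝒢.fullGroup) :
    𝒢.Represents μ m (fun g => F (𝒢.translate hγ g)) fun x => Ψ (𝒢.translateUnit hγ x) := by
  have hmp := hμ.measurePreserving_translateUnit hγ
  refine ⟨hmp.integrable_comp_of_integrable h.integrable, fun c S hS => ?_⟩
  have hγ' := 𝒢.setInv_mem_fullGroup hγ
  have hS' : MeasurableSet (𝒢.translateUnit hγ' ⁻¹' S) := 𝒢.measurable_translateUnit hγ' hS
  have hmem : ∀ x, 𝒢.translateUnit hγ x ∈ 𝒢.translateUnit hγ' ⁻¹' S ↔ x ∈ S := fun x => by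
    rw [Set.mem_preimage, 𝒢.translateUnit_setInv_translateUnit]
  have h1 : ∫ x in S, (c * Ψ (𝒢.translateUnit hγ x)).re ∂μ =
      ∫ x in 𝒢.translateUnit hγ' ⁻¹' S, (c * Ψ x).re ∂μ := by
    rw [← integral_indicator hS, ← integral_indicator hS', ← hmp.integral_comp_of_measurable
      (f := (𝒢.translateUnit hγ' ⁻¹' S).indicator fun x => (c * Ψ x).re)
      ((Complex.measurable_re.comp (hΨ.const_mul c)).indicator hS')]
    congr 1
    ext x
    by_cases hx : x ∈ S
    · rw [Set.indicator_of_mem hx, Set.indicator_of_mem ((hmem x).2 hx)]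
    · rw [Set.indicator_of_notMem hx, Set.indicator_of_notMem fun h => hx ((hmem x).1 h)]
  rw [h1, h.setIntegral_eq c _ hS']
  -- Coboundaries are built from functions bounded everywhere, while `F` is only essentially
  -- bounded; hence the truncation.
  let φ : G → ℝ := fun g => max (-(‖c‖ * |C|)) (min (‖c‖ * |C|) (c * F g).re) *
    (𝒢.translateUnit hγ' ⁻¹' S).indicator 1 (𝒢.s g)
  have hφ : IsBddMeasurable φ := by
    refine IsBddMeasurable.mul ⟨measurable_const.max (measurable_const.min
      (Complex.measurable_re.comp (hF.const_mul c))), ‖c‖ * |C|, fun g => _root_.abs_le.2 ⟨?_, ?_⟩⟩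
      (((IsBddMeasurable.const 1).indicator hS').comp 𝒢.measurable_s)
    · exact le_max_left _ _
    · exact max_le (by linarith [mul_nonneg (norm_nonneg c) (abs_nonneg C)]) (min_le_left _ _)
  have hφF : ∀ᵐ g ∂(𝒢.targetMeasure μ), φ g =
      (c * F g).re * (𝒢.translateUnit hγ' ⁻¹' S).indicator 1 (𝒢.s g) := by
    filter_upwards [hC] with g hg
    have h2 : |(c * F g).re| ≤ ‖c‖ * |C| := by
      refine (Complex.abs_re_le_norm _).trans ?_
      rw [norm_mul]
      exact mul_le_mul_of_nonneg_left (hg.trans (le_abs_self C)) (norm_nonneg c)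
    simp only [φ]
    rw [min_eq_right (le_of_abs_le h2), max_eq_right (neg_le_of_abs_le h2)]
  have h3 : m (fun g => φ (𝒢.translate hγ g)) = m φ := by
    rw [← sub_eq_zero, ← map_sub]
    exact hm0 _ (sub_mem_coboundaries hγ hφ)
  rw [← hm.congr_ae hφF, ← h3]
  refine hm.congr_ae ?_
  filter_upwards [(𝒢.measurePreserving_translate μ hγ).quasiMeasurePreserving.ae hφF] with g hg
  rw [hg, 𝒢.s_translate]
  congr 1
  by_cases hx : 𝒢.s g ∈ S
  · rw [Set.indicator_of_mem hx, Set.indicator_of_mem ((hmem _).2 hx), Pi.one_apply, Pi.one_apply]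
  · rw [Set.indicator_of_notMem hx, Set.indicator_of_notMem fun h => hx ((hmem _).1 h)]

end Represents

theorem IsSourceDominated.exists_represents (hm : 𝒢.IsSourceDominated μ m) (hμ : 𝒢.IsPMP μ)
    (F : Lp ℂ ∞ (𝒢.targetMeasure μ)) : ∃ Ψ : Lp ℂ ∞ μ, 𝒢.Represents μ m F Ψ := by
  have := hμ.1
  obtain ⟨ψ₁, hψ₁, h1⟩ := hm.exists_density hμ (f := fun g => (F g).re)
    ((ae_norm_le_norm_Lp_top F).mono fun g hg => (Complex.abs_re_le_norm _).trans hg)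
  obtain ⟨ψ₂, hψ₂, h2⟩ := hm.exists_density hμ (f := fun g => (F g).im)
    ((ae_norm_le_norm_Lp_top F).mono fun g hg => (Complex.abs_im_le_norm _).trans hg)
  have hΨ : MemLp (fun x => (ψ₁ x : ℂ) + ψ₂ x * Complex.I) ∞ μ :=
    hψ₁.memLp_top.add (hψ₂.memLp_top.mul_const _)
  have h : 𝒢.Represents μ m F fun x => (ψ₁ x : ℂ) + ψ₂ x * Complex.I := by
    refine ⟨hΨ.integrable le_top, fun c S hS => ?_⟩
    have h3 : (fun g => (c * F g).re * S.indicator 1 (𝒢.s g)) =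
        c.re • (fun g => (F g).re * S.indicator 1 (𝒢.s g)) -
          c.im • fun g => (F g).im * S.indicator 1 (𝒢.s g) := by
      ext g
      simp only [Complex.mul_re, Pi.sub_apply, Pi.smul_apply, smul_eq_mul]
      ring
    rw [h3, map_sub, map_smul, map_smul, ← h1 S hS, ← h2 S hS, smul_eq_mul, smul_eq_mul,
      ← integral_const_mul, ← integral_const_mul, ← integral_sub (hψ₁.const_mul _).integrable
        (hψ₂.const_mul _).integrable]
    congr 1
    ext x
    simp
  exact ⟨hΨ.toLp, h.congr_ae hm (ae_of_all _ fun g => rfl) hΨ.coeFn_toLp⟩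

/-- Kesten's criterion implies amenability. -/
theorem SatisfiesKesten.isAmenable (hμ : 𝒢.IsPMP μ) (hK : 𝒢.SatisfiesKesten μ) :
    𝒢.IsAmenable μ := by
  have := hμ.1
  obtain ⟨m, hm0, hm⟩ := hK.exists_linearMap hμ
  change 𝒢.IsSourceDominated μ m at hm
  -- The choice is arbitrary; almost everywhere uniqueness of the density makes it linear.
  choose Φ₀ hΦ₀ using hm.exists_represents hμ
  let L : Lp ℂ ∞ (𝒢.targetMeasure μ) →ₗ[ℂ] Lp ℂ ∞ μ :=
    { toFun := Φ₀
      map_add' := fun F F' => Lp.ext <| by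
        refine (hΦ₀ (F + F')).ae_eq ?_ hm hμ
        exact ((hΦ₀ F).add (hΦ₀ F')).congr_ae hm (Lp.coeFn_add F F')
          (Lp.coeFn_add (Φ₀ F) (Φ₀ F'))
      map_smul' := fun c F => Lp.ext <| by
        refine (hΦ₀ (c • F)).ae_eq ?_ hm hμ
        exact ((hΦ₀ F).const_mul c).congr_ae hm (Lp.coeFn_smul c F) (Lp.coeFn_smul c (Φ₀ F)) }
  have hL : ∀ F, ‖L F‖ ≤ 1 * ‖F‖ := fun F => by
    rw [one_mul]
    exact norm_Lp_top_le_of_ae_bound (norm_nonneg F)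
      ((hΦ₀ F).ae_norm_le hm hμ (norm_nonneg F) (ae_norm_le_norm_Lp_top F))
  have hsource : ∀ (f : Lp ℂ ∞ μ) (F : Lp ℂ ∞ (𝒢.targetMeasure μ)),
      (∀ᵐ g ∂(𝒢.targetMeasure μ), F g = f (𝒢.s g)) → L F = f := fun f F hF => Lp.ext <| by
    refine (hΦ₀ F).ae_eq ?_ hm hμ
    exact (Represents.source hm ((Lp.memLp f).integrable le_top)).congr_ae hm hF
      (ae_of_all _ fun x => rfl)
  refine ⟨L.mkContinuous 1 hL, le_antisymm (L.mkContinuous_norm_le zero_le_one hL) ?_, hsource,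
    fun γ hγ f f' hf' => ?_⟩
  -- The norm is at least one because `L` maps the constant 1 to the constant 1.
  · have h1 : MemLp (fun _ : X => (1 : ℂ)) ∞ μ := memLp_top_const 1
    have h2 : MemLp (fun _ : G => (1 : ℂ)) ∞ (𝒢.targetMeasure μ) := memLp_top_const 1
    have h3 : L h2.toLp = h1.toLp := hsource _ _ (by
      filter_upwards [h2.coeFn_toLp, hμ.quasiMeasurePreserving_s.ae h1.coeFn_toLp] with g h4 h5
      rw [h4, h5])
    have h4 : ‖h1.toLp‖ = 1 := by
      rw [Lp.norm_toLp, eLpNorm_const _ (by simp) (IsProbabilityMeasure.ne_zero μ)]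
      simp
    have h5 : ‖h2.toLp‖ ≤ 1 := norm_Lp_top_le_of_ae_bound zero_le_one
      (h2.coeFn_toLp.mono fun g hg => by rw [hg]; simp)
    have h6 := (L.mkContinuous 1 hL).le_opNorm h2.toLp
    rw [LinearMap.mkContinuous_apply, h3, h4] at h6
    exact h6.trans (mul_le_of_le_one_right (norm_nonneg _) h5)
  · refine (hΦ₀ f').ae_eq ?_ hm hμ
    exact ((hΦ₀ f).translate hm hμ hm0 (Lp.stronglyMeasurable _).measurable
      (Lp.stronglyMeasurable _).measurable (ae_norm_le_norm_Lp_top f) hγ).congr_ae hm hf'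
      (ae_of_all _ fun x => rfl)

end DiscreteBorelGroupoid

/-- A discrete p.m.p. groupoid is amenable if and only if it satisfies Kesten's criterion. -/
theorem theoremA {X G : Type*} [MeasurableSpace X] [MeasurableSpace G]
    (𝒢 : DiscreteBorelGroupoid X G) (μ : MeasureTheory.Measure X) (hμ : 𝒢.IsPMP μ) :
    𝒢.IsAmenable μ ↔ 𝒢.SatisfiesKesten μ :=
  ⟨DiscreteBorelGroupoid.IsAmenable.satisfiesKesten hμ,
    DiscreteBorelGroupoid.SatisfiesKesten.isAmenable hμ⟩
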